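/- **Setting.** Let $T>0$, $d,l,k\in\mathbb N$, let $\mathcal P_2=\mathcal P_2(\mathbb R^d\times\mathbb R^l)$ be the set of Borel probability measures with finite second moment, with the 2-Wasserstein topology, and let $b:[0,T]\times\mathcal P_2\times\mathbb R^d\times\mathbb R^l\to\mathbb R^d$, $\sigma:[0,T]\times\mathcal P_2\times\mathbb R^d\times\mathbb R^l\to\mathbb R^{d\times k}$, $\gamma:[0,T]\to\mathbb R^{d\times l}$, $c:[0,T]\times\mathcal P_2\times\mathbb R^d\times\mathbb R^l\to\mathbb R^{1\times l}$ be such that $b,\sigma$ are continuous in $t$ and Lipschitz in $(m,x,\xi)$ uniformly in $t$; $\gamma$ is continuous; $c$ is (jointly) continuous and of linear growth in $(x,\xi)$, locally uniformly in $m$ and uniformly in $t$. Inequalities between vectors and monotonicity of $\mathbb R^l$-valued paths are understood componentwise. **Reachable states.** Let $D^0([a,b])$ be the space of càdlàg $\mathbb R^d\times\mathbb R^l$-valued paths on $[a-,b]$ (a path on $[a,b]$ together with a value at $a-$), and $\mathcal P_2(D^0([a,b]))$ the set of laws on it with finite second moment (of the supremum norm). For $(t,m)\in[0,T]\times\mathcal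 P_2$, $\mathcal P(t,m)$ is the set of $\mathbb P\in\mathcal P_2(D^0([t,T]))$ with canonical process $(X,\xi)$ such that $(X_{t-},\xi_{t-})\sim m$, $\xi$ is a.s. non-decreasing on $[t-,T]$, and $\mathbb P$ is the law of the $(X,\xi)$-component of a weak solution on $[t-,T]$ of $$dX_s=b(s,m_s,X_s,\xi_s)\,ds+\sigma(s,m_s,X_s,\xi_s)\,dW_s+\gamma(s)\,d\xi_s,\qquad m_s=\mathrm{Law}(X_s,\xi_s),$$ that is, on $D^0([t,T])\times C([t,T];\mathbb R^k)$ the last component $W$ is a Brownian motion for the filtration generated by $(X,\xi,W)$, $X_t=X_{t-}+\gamma(t)(\xi_t-\xi_{t-})$, and the equation holds on $[t,T]$. Write $m'\preceq_t m$ if there is $\mathbb P\in\mathcal P(t,m)$ with $\mathrm{Law}_{\mathbb P}(X_t,\xi_t)=m'$. **Jump costs.** For $\xi\le\xi'$ in $\mathbb R^l$ let $$C_{D^0}(t,m,x,\xi,\xi')=\inf_\zeta\int_0^1 c\big(t,m,x+\gamma(t)(\zeta_\lambda-\xi),\zeta_\lambda\big)\,d\zeta_\lambda,$$ the infimum over continuous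 non-decreasing $\zeta:[0,1]\to\mathbb R^l$ with $\zeta_0=\xi$, $\zeta_1=\xi'$. Let $\Gamma(t,m,m')$ be the set of laws $\mu\in\mathcal P_2(D^0([0,1]))$, with canonical process $(Y,\zeta)$ having no jump at time $0$, such that $(Y_0,\zeta_0)\sim m$, $(Y_1,\zeta_1)\sim m'$, $\zeta$ is a.s. non-decreasing, $\lambda\mapsto\mu_\lambda:=\mathrm{Law}_\mu(Y_\lambda,\zeta_\lambda)\in\mathcal P_2$ is continuous on $[0,1]$, and a.s. $Y_\lambda-Y_0=\gamma(t)(\zeta_\lambda-\zeta_0)$ for all $\lambda\in[0,1]$. Put $$C_m(t,m,m')=\inf_{\mu\in\Gamma(t,m,m')}\mathbb E^\mu\Big[\int_{\{\lambda\in[0,1]:\zeta_{\lambda-}=\zeta_\lambda\}}c(t,\mu_\lambda,Y_\lambda,\zeta_\lambda)\,d\zeta_\lambda+\sum_{\lambda\in[0,1]:\zeta_{\lambda-}\ne\zeta_\lambda}C_{D^0}(t,\mu_\lambda,Y_{\lambda-},\zeta_{\lambda-},\zeta_\lambda)\Big]$$ (an infimum in $[-\infty,\infty]$). **The class $C_2^{1,2}$.**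 A linear derivative of $v:\mathcal P_2\to\mathbb R$ is a function $\delta_m v:\mathcal P_2\times\mathbb R^d\times\mathbb R^l\to\mathbb R$ with $$v(m')-v(m)=\int_0^1\int\delta_m v(\lambda m'+(1-\lambda)m,x,\xi)\,(m'-m)(dx,d\xi)\,d\lambda\qquad\text{for all }m,m'\in\mathcal P_2.$$ Write $u\in C_2^{1,2}$ for $u:[0,T]\times\mathcal P_2\to\mathbb R$ if $\partial_t u$, $\delta_m u$, $\partial_{(x,\xi)}\delta_m u$ and $\partial^2_{(x,\xi)(x,\xi)}\delta_m u$ exist and are jointly continuous, the last three being of quadratic growth in $(x,\xi)$ uniformly in $(t,m)$. **Lemma.** Let $u\in C_2^{1,2}$ and $t\in[0,T]$, and assume that for all $m\in\mathcal P_2$ $$u(t,m)+C_m(t,m,m')\ \ge\ u(t,m')\qquad\text{for all } m'\preceq_t m.$$ Then for all $m\in\mathcal P_2$ $$\partial_{(x,\xi)}\delta_m u(t,m,x,\xi)\cdot(\gamma(t),1)\ \le\ c(t,m,x,\xi)\qquad\text{for all }(x,\xi)\in\mathbb R^d\times\mathbb R^l,$$ where $(\gamma(t),1)$ is the $(d+l)\times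 l$ matrix with blocks $\gamma(t)$ and the identity, so that the inequality is one between row vectors in $\mathbb R^{1\times l}$, i.e. $\sum_{i}\partial_{x_i}\delta_m u\,\gamma_{ij}(t)+\partial_{\xi_j}\delta_m u\le c_j$ for each $j=1,\dots,l$. -/

import Mathlib

open MeasureTheory ProbabilityTheory Set Filter Topology
open scoped ENNReal NNReal

noncomputable section

namespace SingularMFC

/-! ## The Wasserstein space -/

/-- The state-control space `ℝᵈ × ℝˡ`; points are written `(x, ξ)`. All metric notions used below
are insensitive to the choice of norm on this space. -/
abbrev State (d l : ℕ) : Type := (Fin d → ℝ) × (Fin l → ℝ)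

/-- Borel probability measures on `E` with finite second moment. -/
def P2 (E : Type*) [NormedAddCommGroup E] [MeasurableSpace E] : Type _ :=
  {m : Measure E // IsProbabilityMeasure m ∧ ∫⁻ z, ‖z‖ₑ ^ 2 ∂m < ∞}

namespace P2

variable {E : Type*} [NormedAddCommGroup E] [MeasurableSpace E]

/-- The underlying measure. -/
def meas (m : P2 E) : Measure E := m.1

/-- The 2-Wasserstein distance: the infimum over all couplings `π` of `m` and `m'` of
`(∫ |z - z'|² dπ)^{1/2}`. -/
def wass (m m' : P2 E) : ℝ≥0∞ :=
  (⨅ π : {π : Measure (E × E) // π.map Prod.fst = m.meas ∧ π.map Prod.snd = m'.meas},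
    ∫⁻ p, edist p.1 p.2 ^ 2 ∂π.1) ^ (1 / 2 : ℝ)

/-- The topology of the 2-Wasserstein distance: a set is open iff it contains, with each of its
points, a ball around it. -/
instance : TopologicalSpace (P2 E) where
  IsOpen U := ∀ m ∈ U, ∃ ε : ℝ≥0∞, 0 < ε ∧ ∀ m', wass m m' < ε → m' ∈ U
  isOpen_univ := fun _ _ => ⟨1, one_pos, fun _ _ => mem_univ _⟩
  isOpen_inter := fun U V hU hV m hm => by
    obtain ⟨ε, hε, h⟩ := hU m hm.1
    obtain ⟨δ, hδ, h'⟩ := hV m hm.2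
    exact ⟨min ε δ, lt_min hε hδ, fun m' hm' =>
      ⟨h m' (hm'.trans_le (min_le_left _ _)), h' m' (hm'.trans_le (min_le_right _ _))⟩⟩
  isOpen_sUnion := fun S hS m hm => by
    obtain ⟨U, hU, hmU⟩ := hm
    obtain ⟨ε, hε, h⟩ := hS U hU m hmU
    exact ⟨ε, hε, fun m' hm' => ⟨U, hU, h m' hm'⟩⟩

/-- The mixture `lam • m' + (1 - lam) • m` of two elements of `P2 E`. -/
def mix (lam : unitInterval) (m m' : P2 E) : P2 E :=
  ⟨ENNReal.ofReal lam • m'.meas + ENNReal.ofReal (1 - lam) • m.meas, by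
    have h : ENNReal.ofReal lam + ENNReal.ofReal (1 - lam) = 1 := by
      rw [← ENNReal.ofReal_add lam.2.1 (by linarith [lam.2.2])]
      simp
    have h1 : m.meas univ = 1 := m.2.1.measure_univ
    have h2 : m'.meas univ = 1 := m'.2.1.measure_univ
    refine ⟨⟨by simp [h1, h2, h]⟩, ?_⟩
    rw [lintegral_add_measure, lintegral_smul_measure, lintegral_smul_measure]
    exact ENNReal.add_lt_top.2 ⟨ENNReal.mul_lt_top ENNReal.ofReal_lt_top m'.2.2,
      ENNReal.mul_lt_top ENNReal.ofReal_lt_top m.2.2⟩⟩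

end P2

/-! ## Path spaces -/

/-- Càdlàg functions on the real line. -/
def IsCadlag {E : Type*} [TopologicalSpace E] (y : ℝ → E) : Prop :=
  ∀ s, ContinuousWithinAt y (Ici s) s ∧ ∃ e, Tendsto y (𝓝[<] s) (𝓝 e)

/-- The path space `D⁰([a,b]; ℝᵈ × ℝˡ)` of càdlàg paths on `[a-,b]`, i.e. of càdlàg paths that are
constant before time `a` (the constant being the value at `a-`) and, as a convention that extends
paths to the whole line, constant after time `b`. It carries the `σ`-algebra generated by the
evaluation maps. -/
abbrev D0 (a b : ℝ) (d l : ℕ) : Type :=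
  {y : ℝ → State d l // IsCadlag y ∧ (∀ s < a, y s = y (a - 1)) ∧ ∀ s ≥ b, y s = y b}

/-- The path space `C([a,b]; ℝᵏ)`; paths are extended to the whole line by constants. -/
abbrev CPath (a b : ℝ) (k : ℕ) : Type :=
  {w : ℝ → (Fin k → ℝ) // Continuous w ∧ (∀ s ≤ a, w s = w a) ∧ ∀ s ≥ b, w s = w b}

namespace D0

variable {a b : ℝ} {d l : ℕ}

/-- The value of the path at `a-`. -/
def pre (y : D0 a b d l) : State d l := y.1 (a - 1)

/-- The `X`-component (also called `Y`) at time `s`. -/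
def X (y : D0 a b d l) (s : ℝ) : Fin d → ℝ := (y.1 s).1

/-- The `ξ`-component (also called `ζ`) at time `s`. -/
def xi (y : D0 a b d l) (s : ℝ) : Fin l → ℝ := (y.1 s).2

theorem measurable_eval (s : ℝ) : Measurable fun y : D0 a b d l => y.1 s :=
  (measurable_pi_apply s).comp measurable_subtype_coe

end D0

/-- `P₂(D⁰([a,b]))`: laws on the path space whose (supremum norm) second moment is finite. -/
def P2D (a b : ℝ) (d l : ℕ) : Type :=
  {μ : Measure (D0 a b d l) //
    IsProbabilityMeasure μ ∧ ∫⁻ y, (⨆ s : ℝ, ‖y.1 s‖ₑ) ^ 2 ∂μ < ∞}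

namespace P2D

variable {a b : ℝ} {d l : ℕ}

/-- The underlying measure on path space. -/
def meas (μ : P2D a b d l) : Measure (D0 a b d l) := μ.1

/-- The law at time `s` of the canonical process under `μ`. For `s < a` this is the law at `a-`. -/
def marginal (μ : P2D a b d l) (s : ℝ) : P2 (State d l) :=
  ⟨μ.meas.map (fun y => y.1 s), by
    have : IsProbabilityMeasure μ.meas := μ.2.1
    refine ⟨Measure.isProbabilityMeasure_map (D0.measurable_eval s).aemeasurable, ?_⟩
    rw [lintegral_map (by fun_prop) (D0.measurable_eval s)]
    refine lt_of_le_of_lt (lintegral_mono fun y => ?_) μ.2.2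
    exact pow_le_pow_left' (le_iSup (fun r : ℝ => ‖y.1 r‖ₑ) s) 2⟩

/-- The law at time `a-`. -/
def preMarginal (μ : P2D a b d l) : P2 (State d l) := μ.marginal (a - 1)

end P2D

/-! ## Integration against non-decreasing paths -/

open Classical in
/-- The Lebesgue-Stieltjes measure of a non-decreasing right-continuous function. -/
def stieltjes (f : ℝ → ℝ) : Measure ℝ :=
  if h : Monotone f then h.stieltjesFunction.measure else 0

/-- `∫_A h(s) dζ(s) = ∑ⱼ ∫_A hⱼ(s) dζʲ(s)` for a row vector `h` and a non-decreasing right-continuous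
`ζ : ℝ → ℝˡ`. -/
def intAgainst {l : ℕ} (A : Set ℝ) (h ζ : ℝ → Fin l → ℝ) : ℝ :=
  ∑ j, ∫ s in A, h s j ∂stieltjes (fun s => ζ s j)

/-! ## Weak solutions and admissible controls -/

variable {d l k : ℕ}

/-- The filtration generated by the canonical process `(X, ξ, W)` on `D⁰([t,T]) × C([t,T])`. -/
abbrev natFiltration (t T : ℝ) (d l k : ℕ) (s : ℝ) : MeasurableSpace (D0 t T d l × CPath t T k) :=
  ⨆ r ≤ s, MeasurableSpace.comap (fun ω => (ω.1.1 r, ω.2.1 r)) inferInstance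

/-- Under `Q`, the canonical process `W` is a `k`-dimensional standard Brownian motion on `[t,T]`
with respect to the filtration generated by `(X, ξ, W)`. -/
def IsFBrownian (t T : ℝ) (Q : Measure (D0 t T d l × CPath t T k)) : Prop :=
  (∀ᵐ ω ∂Q, ω.2.1 t = 0) ∧
  ∀ s r, t ≤ s → s ≤ r → r ≤ T →
    Q.map (fun ω => ω.2.1 r - ω.2.1 s)
        = Measure.pi (fun _ : Fin k => gaussianReal 0 (r - s).toNNReal) ∧
    Indep (MeasurableSpace.comap (fun ω => ω.2.1 r - ω.2.1 s) inferInstance)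
      (natFiltration t T d l k s) Q

/-- `Q` is a weak solution on `[t-,T]` of the McKean-Vlasov equation
`dX = b(s,mₛ,X,ξ) ds + σ(s,mₛ,X,ξ) dW + γ(s) dξ`, where `mₛ` is the law of `(Xₛ,ξₛ)` under `P`
(the first marginal of `Q`), that is `Xₜ = Xₜ₋ + γ(t) (ξₜ - ξₜ₋)` and the equation holds on `[t,T]`.

The integrand of the Itô integral is càdlàg and adapted, so that the Itô integral over `[t,s]` is
the limit in probability of the left-endpoint Riemann sums along equidistant partitions; the
equation says that this limit is `Xₛ - Xₜ - ∫ₜˢ b dr - ∫_{(t,s]} γ dξ`. -/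
structure IsWeakSolution (t T : ℝ)
    (b : ℝ → P2 (State d l) → State d l → Fin d → ℝ)
    (σ : ℝ → P2 (State d l) → State d l → Matrix (Fin d) (Fin k) ℝ)
    (γ : ℝ → Matrix (Fin d) (Fin l) ℝ)
    (P : P2D t T d l) (Q : Measure (D0 t T d l × CPath t T k)) : Prop where
  law_eq : Q.map Prod.fst = P.meas
  brownian : IsFBrownian t T Q
  jump : ∀ᵐ ω ∂Q, ω.1.X t = ω.1.pre.1 + (γ t).mulVec (ω.1.xi t - ω.1.pre.2)
  sde : ∀ s ∈ Icc t T,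
    TendstoInMeasure Q
      (fun (n : ℕ) ω => ∑ i ∈ Finset.range n,
        (σ (t + i * ((s - t) / n)) (P.marginal (t + i * ((s - t) / n)))
            (ω.1.1 (t + i * ((s - t) / n)))).mulVec
          (ω.2.1 (t + (i + 1) * ((s - t) / n)) - ω.2.1 (t + i * ((s - t) / n))))
      atTop
      (fun ω => ω.1.X s - ω.1.X t
        - (∫ r in t..s, b r (P.marginal r) (ω.1.1 r))
        - fun i => intAgainst (Ioc t s) (fun r => γ r i) ω.1.xi)

/-- The set `P(t,m)` of admissible controls. -/
def admissible (T : ℝ)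
    (b : ℝ → P2 (State d l) → State d l → Fin d → ℝ)
    (σ : ℝ → P2 (State d l) → State d l → Matrix (Fin d) (Fin k) ℝ)
    (γ : ℝ → Matrix (Fin d) (Fin l) ℝ) (t : ℝ) (m : P2 (State d l)) : Set (P2D t T d l) :=
  {P | P.preMarginal = m ∧ (∀ᵐ y ∂P.meas, Monotone y.xi) ∧ ∃ Q, IsWeakSolution t T b σ γ P Q}

/-- `m' ⪯ₜ m`: the state `m'` is reachable from `m` at time `t`. -/
def Reachable (T : ℝ)
    (b : ℝ → P2 (State d l) → State d l → Fin d → ℝ)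
    (σ : ℝ → P2 (State d l) → State d l → Matrix (Fin d) (Fin k) ℝ)
    (γ : ℝ → Matrix (Fin d) (Fin l) ℝ) (t : ℝ) (m' m : P2 (State d l)) : Prop :=
  ∃ P ∈ admissible T b σ γ t m, P.marginal t = m'

/-! ## Minimal jump costs -/

/-- The minimal pathwise jump cost `C_{D⁰}(t,m,x,ξ,ξ')`: the infimum over all continuous
non-decreasing paths `ζ` on `[0,1]` (extended to the line) from `ξ` to `ξ'` of
`∫₀¹ c(t, m, x + γ(t)(ζ_λ - ξ), ζ_λ) dζ_λ`. -/
def CD0 (γ : ℝ → Matrix (Fin d) (Fin l) ℝ)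
    (c : ℝ → P2 (State d l) → State d l → Fin l → ℝ)
    (t : ℝ) (m : P2 (State d l)) (x : Fin d → ℝ) (ξ ξ' : Fin l → ℝ) : ℝ :=
  ⨅ ζ : {ζ : ℝ → Fin l → ℝ // Continuous ζ ∧ Monotone ζ ∧ ζ 0 = ξ ∧ ζ 1 = ξ'},
    intAgainst (Icc 0 1) (fun r => c t m (x + (γ t).mulVec (ζ.1 r - ξ), ζ.1 r)) ζ.1

/-- The set `Γ(t,m,m')` of interpolating paths between `m` and `m'` at time `t`. Paths on `[0,1]`
start at time `0`, i.e. they have no jump at the initial time. -/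
def interp (γ : ℝ → Matrix (Fin d) (Fin l) ℝ) (t : ℝ) (m m' : P2 (State d l)) :
    Set (P2D 0 1 d l) :=
  {μ | μ.marginal 0 = m ∧ μ.marginal 1 = m' ∧
    (∀ᵐ y ∂μ.meas, y.1 0 = y.pre) ∧
    (∀ᵐ y ∂μ.meas, Monotone y.xi) ∧
    ContinuousOn μ.marginal (Icc 0 1) ∧
    ∀ᵐ y ∂μ.meas, ∀ r ∈ Icc (0 : ℝ) 1, y.X r - y.X 0 = (γ t).mulVec (y.xi r - y.xi 0)}

/-- The expected cost of the interpolating path `μ`: the expectation of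
`∫_{Jᶜ(ζ)} c(t,μ_λ,Y_λ,ζ_λ) dζ_λ + ∑_{Jᵈ(ζ)} C_{D⁰}(t,μ_λ,Y_{λ-},ζ_{λ-},ζ_λ)`, where `Jᶜ(ζ)` and
`Jᵈ(ζ)` are the sets of continuity points and of jumps of `ζ` in `[0,1]`. -/
def pathCost (γ : ℝ → Matrix (Fin d) (Fin l) ℝ)
    (c : ℝ → P2 (State d l) → State d l → Fin l → ℝ) (t : ℝ) (μ : P2D 0 1 d l) : ℝ :=
  ∫ y, (intAgainst {r ∈ Icc 0 1 | Function.leftLim y.xi r = y.xi r}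
        (fun r => c t (μ.marginal r) (y.1 r)) y.xi
    + ∑' r : {r : ℝ // r ∈ Icc 0 1 ∧ Function.leftLim y.xi r ≠ y.xi r},
        CD0 γ c t (μ.marginal r) (Function.leftLim y.X r) (Function.leftLim y.xi r) (y.xi r))
    ∂μ.meas

/-- The minimal jump cost `C_m(t,m,m')`, an infimum in the extended reals. -/
def Cm (γ : ℝ → Matrix (Fin d) (Fin l) ℝ)
    (c : ℝ → P2 (State d l) → State d l → Fin l → ℝ)
    (t : ℝ) (m m' : P2 (State d l)) : EReal :=
  ⨅ μ ∈ interp γ t m m', (pathCost γ c t μ : EReal)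

/-! ## Differential calculus on the Wasserstein space -/

/-- `δ` is a linear (flat) derivative of `u : P₂ → ℝ`. -/
def IsLinearDeriv (u : P2 (State d l) → ℝ) (δ : P2 (State d l) → State d l → ℝ) : Prop :=
  ∀ m m', u m' - u m =
    ∫ lam : unitInterval, ((∫ z, δ (P2.mix lam m m') z ∂m'.meas) - ∫ z, δ (P2.mix lam m m') z ∂m.meas)

/-- `u ∈ C₂^{1,2}([0,T] × P₂)`, with (a version of the) linear derivative `δ = δₘu`: the derivatives
`∂ₜu`, `δₘu`, `∂_{(x,ξ)} δₘu`, `∂²_{(x,ξ)(x,ξ)} δₘu` exist and are jointly continuous, and the last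
three are of quadratic growth in `(x,ξ)`, uniformly in `(t,m)`. -/
structure IsC122 (T : ℝ) (u : ℝ → P2 (State d l) → ℝ)
    (δ : ℝ → P2 (State d l) → State d l → ℝ) : Prop where
  time_deriv : ∃ u' : ℝ → P2 (State d l) → ℝ,
    (∀ t ∈ Icc 0 T, ∀ m, HasDerivWithinAt (fun s => u s m) (u' t m) (Icc 0 T) t) ∧
    ContinuousOn (fun p : ℝ × P2 (State d l) => u' p.1 p.2) (Icc 0 T ×ˢ univ)
  linear_deriv : ∀ t ∈ Icc 0 T, IsLinearDeriv (u t) (δ t)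
  smooth : ∀ t ∈ Icc 0 T, ∀ m, ContDiff ℝ 2 (δ t m)
  cont₀ : ContinuousOn (fun p : ℝ × P2 (State d l) × State d l => δ p.1 p.2.1 p.2.2)
    (Icc 0 T ×ˢ univ)
  cont₁ : ContinuousOn
    (fun p : ℝ × P2 (State d l) × State d l => fderiv ℝ (δ p.1 p.2.1) p.2.2) (Icc 0 T ×ˢ univ)
  cont₂ : ContinuousOn
    (fun p : ℝ × P2 (State d l) × State d l => fderiv ℝ (fderiv ℝ (δ p.1 p.2.1)) p.2.2)
    (Icc 0 T ×ˢ univ)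
  growth : ∃ K : ℝ, ∀ t ∈ Icc 0 T, ∀ m z,
    |δ t m z| ≤ K * (1 + ‖z‖ ^ 2) ∧ ‖fderiv ℝ (δ t m) z‖ ≤ K * (1 + ‖z‖ ^ 2) ∧
    ‖fderiv ℝ (fderiv ℝ (δ t m)) z‖ ≤ K * (1 + ‖z‖ ^ 2)

/-! ## Assumptions on the coefficients -/

/-- The assumptions on `b`, `σ`, `γ` and `c`: on `[0,T]`, `b` and `σ` are continuous in `t` and
Lipschitz in `(m,x,ξ)` uniformly in `t`; `γ` is continuous; `c` is continuous and of linear growth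
in `(x,ξ)`, locally uniformly in `m` and uniformly in `t`. -/
structure Coefficients (T : ℝ)
    (b : ℝ → P2 (State d l) → State d l → Fin d → ℝ)
    (σ : ℝ → P2 (State d l) → State d l → Matrix (Fin d) (Fin k) ℝ)
    (γ : ℝ → Matrix (Fin d) (Fin l) ℝ)
    (c : ℝ → P2 (State d l) → State d l → Fin l → ℝ) : Prop where
  b_cont : ∀ m z, ContinuousOn (fun t => b t m z) (Icc 0 T)
  σ_cont : ∀ m z, ContinuousOn (fun t => σ t m z) (Icc 0 T)
  b_lip : ∃ L : ℝ≥0, ∀ t ∈ Icc 0 T, ∀ m m' z z',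
    edist (b t m z) (b t m' z') ≤ L * (P2.wass m m' + edist z z')
  σ_lip : ∃ L : ℝ≥0, ∀ t ∈ Icc 0 T, ∀ m m' z z' i j,
    edist (σ t m z i j) (σ t m' z' i j) ≤ L * (P2.wass m m' + edist z z')
  γ_cont : ContinuousOn γ (Icc 0 T)
  c_cont : ContinuousOn (fun p : ℝ × P2 (State d l) × State d l => c p.1 p.2.1 p.2.2)
    (Icc 0 T ×ˢ univ)
  c_growth : ∀ m, ∃ U ∈ 𝓝 m, ∃ K : ℝ, ∀ t ∈ Icc 0 T, ∀ m' ∈ U, ∀ z,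
    ‖c t m' z‖ ≤ K * (1 + ‖z‖)

end SingularMFC

end

namespace SingularMFC

/-! ## Wasserstein estimates -/

namespace P2

section Norm

variable {E : Type*} [NormedAddCommGroup E] [MeasurableSpace E]

/-! Suppose the inequality fails at `(m, z)` for the index `j`, and let `v = (γ(t), 1) eⱼ`. By
continuity there are numbers `κ₁ < κ₂` such that `cⱼ < κ₁` and `κ₂ < ∂δₘu · v` at all measures near
`m` and all points near `z`. Replace `m` by `(1 - a) m + a δ_z` with a small mass `a`, and move only
this atom, from `z` to `z + h v`. Running through the segment is an interpolating path without
jumps, of cost at most `a h κ₁` (`pathCost_segLaw_le`). In the linear derivative the common part `(1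
- a) m` cancels, so that `u` increases by at least `a h κ₂` (`linearDeriv_increment`,
`sub_ge_of_fderiv_ge`). The two bounds contradict the assumed inequality between `u` and the jump
cost. The added atom is what gives the conclusion at every point `z`, inside or outside the support
of `m`. All measures that occur stay near `m` if `a` is small, uniformly in the position of the atom
(`exists_mix_near`). This is `fderiv_le_of_reachable`.

It remains to see that the shifted mixture is reachable, and this is most of the work: a control
lives on all of `[t, T]`, so the jump at time `t` has to be continued by a solution of the
McKean-Vlasov equation, for which `ξ` is kept constant after `t`.

Such a solution is constructed in `L²`. Brownian motion comes from an isonormal Gaussian process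
(`exists_isonormal`) and Kolmogorov's criterion (`exists_continuous_modification`). Integrals of
continuous adapted processes are limits of elementary integrals in `L²(Ω; C([t,T]))`. The only input
is the maximal estimate of `IsIntegrator`, which holds for Brownian motion by the Itô isometry and
Doob's inequality, and for time by the Cauchy-Schwarz inequality; drift and noise are thus treated
alike. The coefficients are regarded as maps of random variables, so that the dependence on the law
is one more Lipschitz dependence in `L²` and Picard iteration applies (`exists_sde_solution`). The
joint law of the solution and the noise on path space is a weak solution
(`IsSolution.isWeakSolution`), which yields `reachable_of_coupling`. -/

instance isProbabilityMeasure_meas (m : P2 E) : IsProbabilityMeasure m.meas := m.2.1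

theorem ext {m m' : P2 E} (h : m.meas = m'.meas) : m = m' := Subtype.ext h

theorem wass_le_of_coupling {m m' : P2 E} (π : Measure (E × E)) (h : π.map Prod.fst = m.meas)
    (h' : π.map Prod.snd = m'.meas) :
    wass m m' ≤ (∫⁻ p, edist p.1 p.2 ^ 2 ∂π) ^ (1 / 2 : ℝ) := by
  unfold wass
  gcongr
  exact iInf_le_of_le ⟨π, h, h'⟩ le_rfl

/-- An open set contains a ball around each of its points by the very definition of the topology; no
triangle inequality for `wass` enters. -/
theorem tendsto_of_wass {ι : Type*} {l : Filter ι} {f : ι → P2 E} {m : P2 E}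
    (h : Tendsto (fun i => wass m (f i)) l (𝓝 0)) : Tendsto f l (𝓝 m) := by
  rw [tendsto_nhds]
  intro U hU hm
  obtain ⟨ε, hε, hb⟩ := hU m hm
  filter_upwards [h.eventually_lt_const hε] with i hi using hb _ hi

theorem exists_ball_subset {m : P2 E} {U : Set (P2 E)} (hU : U ∈ 𝓝 m) :
    ∃ ε : ℝ≥0∞, 0 < ε ∧ ∀ m', wass m m' < ε → m' ∈ U := by
  obtain ⟨V, hVU, hV, hm⟩ := mem_nhds_iff.1 hU
  obtain ⟨ε, hε, hb⟩ := hV m hm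
  exact ⟨ε, hε, fun m' h => hVU (hb m' h)⟩

theorem mix_meas (lam : unitInterval) (m m' : P2 E) : (mix lam m m').meas =
    ENNReal.ofReal lam • m'.meas + ENNReal.ofReal (1 - lam) • m.meas := rfl

/-- The second moment. -/
noncomputable def moment (m : P2 E) : ℝ≥0∞ := ∫⁻ z, ‖z‖ₑ ^ 2 ∂m.meas

theorem moment_lt_top (m : P2 E) : m.moment < ∞ := m.2.2

omit [MeasurableSpace E] in
theorem edist_sq_le (x y : E) : edist x y ^ 2 ≤ 2 * (‖x‖ₑ ^ 2 + ‖y‖ₑ ^ 2) := by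
  have h : edist x y ≤ ‖x‖ₑ + ‖y‖ₑ := by
    rw [edist_eq_enorm_sub]; exact enorm_sub_le
  refine (pow_le_pow_left' h 2).trans ?_
  have := ENNReal.rpow_add_le_mul_rpow_add_rpow ‖x‖ₑ ‖y‖ₑ (p := 2) (by norm_num)
  norm_num at this
  exact_mod_cast this

theorem mix_zero (m m' : P2 E) : mix 0 m m' = m := ext (by simp [mix_meas])

/-- Mixing is affine in its last argument. Hence the segment that appears in the linear derivative
between two mixtures with `m` consists of mixtures with `m` again. -/
theorem mix_mix_right (a b : unitInterval) (m ν ν' : P2 E) :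
    mix b (mix a m ν) (mix a m ν') = mix a m (mix b ν ν') := by
  refine ext ?_
  have h : ENNReal.ofReal b + ENNReal.ofReal (1 - b) = 1 := by
    rw [← ENNReal.ofReal_add b.2.1 (by linarith [b.2.2])]
    simp
  change ENNReal.ofReal b • (ENNReal.ofReal a • ν'.meas + ENNReal.ofReal (1 - a) • m.meas) +
    ENNReal.ofReal (1 - b) • (ENNReal.ofReal a • ν.meas + ENNReal.ofReal (1 - a) • m.meas) =
    ENNReal.ofReal a • (ENNReal.ofReal b • ν'.meas + ENNReal.ofReal (1 - b) • ν.meas) +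
      ENNReal.ofReal (1 - a) • m.meas
  simp only [smul_add, smul_smul]
  have : ENNReal.ofReal (1 - a) • m.meas = (ENNReal.ofReal b * ENNReal.ofReal (1 - a)) • m.meas +
      (ENNReal.ofReal (1 - b) * ENNReal.ofReal (1 - a)) • m.meas := by
    rw [← add_smul, ← add_mul, h, one_mul]
  rw [this, mul_comm (ENNReal.ofReal b) (ENNReal.ofReal a),
    mul_comm (ENNReal.ofReal (1 - b)) (ENNReal.ofReal a)]
  abel

theorem moment_mix (a : unitInterval) (m m' : P2 E) : (mix a m m').moment =
    ENNReal.ofReal a * m'.moment + ENNReal.ofReal (1 - a) * m.moment := by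
  unfold moment
  rw [show (mix a m m').meas = ENNReal.ofReal a • m'.meas + ENNReal.ofReal (1 - a) • m.meas from rfl,
    lintegral_add_measure, lintegral_smul_measure, lintegral_smul_measure]
  rfl

variable [BorelSpace E] [SecondCountableTopology E]

theorem wass_le_of_map {Ω : Type*} [MeasurableSpace Ω] {P : Measure Ω} {f g : Ω → E}
    (hf : AEMeasurable f P) (hg : AEMeasurable g P) {m m' : P2 E} (h : P.map f = m.meas)
    (h' : P.map g = m'.meas) :
    wass m m' ≤ (∫⁻ ω, edist (f ω) (g ω) ^ 2 ∂P) ^ (1 / 2 : ℝ) := by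
  refine (wass_le_of_coupling (P.map fun ω => (f ω, g ω)) ?_ ?_).trans_eq ?_
  · rw [AEMeasurable.map_map_of_aemeasurable (by fun_prop) (hf.prodMk hg)]
    exact h
  · rw [AEMeasurable.map_map_of_aemeasurable (by fun_prop) (hf.prodMk hg)]
    exact h'
  · rw [lintegral_map' (by fun_prop) (hf.prodMk hg)]

@[simp]
theorem wass_self (m : P2 E) : wass m m = 0 := by
  refine le_antisymm ?_ zero_le
  refine (wass_le_of_map (P := m.meas) (f := id) (g := id) (by fun_prop) (by fun_prop)
    (by simp) (by simp)).trans_eq ?_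
  simp

theorem wass_comm (m m' : P2 E) : wass m m' = wass m' m := by
  have key : ∀ m m' : P2 E, wass m m' ≤ wass m' m := by
    intro m m'
    unfold wass
    gcongr
    refine le_iInf fun π => iInf_le_of_le ⟨π.1.map Prod.swap, ?_, ?_⟩ ?_
    · rw [Measure.map_map (by fun_prop) (by fun_prop)]
      exact π.2.2
    · rw [Measure.map_map (by fun_prop) (by fun_prop)]
      exact π.2.1
    · rw [lintegral_map (by fun_prop) (by fun_prop)]
      simp [edist_comm]
  exact le_antisymm (key _ _) (key _ _)

theorem lintegral_edist_sq_prod_le (m m' : P2 E) :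
    ∫⁻ p, edist p.1 p.2 ^ 2 ∂(m.meas.prod m'.meas) ≤ 2 * (m.moment + m'.moment) := by
  have h1 := lintegral_map (μ := m.meas.prod m'.meas) (f := fun x => ‖x‖ₑ ^ 2)
    (g := Prod.fst) (by fun_prop) (by fun_prop)
  have h2 := lintegral_map (μ := m.meas.prod m'.meas) (f := fun x => ‖x‖ₑ ^ 2)
    (g := Prod.snd) (by fun_prop) (by fun_prop)
  rw [Measure.map_fst_prod, measure_univ, one_smul] at h1
  rw [Measure.map_snd_prod, measure_univ, one_smul] at h2
  calc ∫⁻ p, edist p.1 p.2 ^ 2 ∂(m.meas.prod m'.meas)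
      ≤ ∫⁻ p : E × E, 2 * (‖p.1‖ₑ ^ 2 + ‖p.2‖ₑ ^ 2) ∂(m.meas.prod m'.meas) :=
        lintegral_mono fun p : E × E => edist_sq_le p.1 p.2
    _ = 2 * (m.moment + m'.moment) := by
        rw [lintegral_const_mul _ (by fun_prop), lintegral_add_left (by fun_prop), ← h1, ← h2]
        rfl

/-- The common part `a m' + (1 - b) m` stays on the diagonal; only the remaining mass `b - a` is
transported, by the independent coupling of `m` and `m'`. -/
theorem wass_mix_mix_le_aux {a b : unitInterval} (hab : a ≤ b) (m m' : P2 E) :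
    wass (mix a m m') (mix b m m') ≤
      (ENNReal.ofReal (b - a) * (2 * (m.moment + m'.moment))) ^ (1 / 2 : ℝ) := by
  have e1 : ENNReal.ofReal (1 - b) + ENNReal.ofReal (b - a) = ENNReal.ofReal (1 - a) := by
    rw [← ENNReal.ofReal_add (by linarith [b.2.2]) (by linarith [Subtype.coe_le_coe.2 hab])]
    congr 1; ring
  have e2 : ENNReal.ofReal a + ENNReal.ofReal (b - a) = ENNReal.ofReal b := by
    rw [← ENNReal.ofReal_add a.2.1 (by linarith [Subtype.coe_le_coe.2 hab])]
    congr 1; ring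
  refine (wass_le_of_coupling (ENNReal.ofReal a • m'.meas.map (fun x => (x, x)) +
    (ENNReal.ofReal (1 - b) • m.meas.map (fun x => (x, x)) +
      ENNReal.ofReal (b - a) • m.meas.prod m'.meas)) ?_ ?_).trans ?_
  · rw [Measure.map_add _ _ (by fun_prop), Measure.map_add _ _ (by fun_prop), Measure.map_smul,
      Measure.map_smul, Measure.map_smul, Measure.map_map (by fun_prop) (by fun_prop),
      Measure.map_map (by fun_prop) (by fun_prop), Measure.map_fst_prod, mix_meas, ← e1, add_smul]
    simp [Function.comp_def]
  · rw [Measure.map_add _ _ (by fun_prop), Measure.map_add _ _ (by fun_prop), Measure.map_smul,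
      Measure.map_smul, Measure.map_smul, Measure.map_map (by fun_prop) (by fun_prop),
      Measure.map_map (by fun_prop) (by fun_prop), Measure.map_snd_prod, mix_meas, ← e2, add_smul]
    simp only [Function.comp_def, measure_univ, one_smul, Measure.map_id']
    abel
  · gcongr
    rw [lintegral_add_measure, lintegral_add_measure, lintegral_smul_measure,
      lintegral_smul_measure, lintegral_smul_measure, lintegral_map (by fun_prop) (by fun_prop),
      lintegral_map (by fun_prop) (by fun_prop)]
    simp only [edist_self, smul_eq_mul]
    have := lintegral_edist_sq_prod_le m m'
    have h0 : ((0 : ℝ≥0∞) ^ 2) = 0 := by norm_num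
    rw [h0, lintegral_zero, lintegral_zero, mul_zero, mul_zero, zero_add, zero_add]
    gcongr

theorem wass_mix_mix_le (a b : unitInterval) (m m' : P2 E) :
    wass (mix a m m') (mix b m m') ≤
      (ENNReal.ofReal |(b : ℝ) - a| * (2 * (m.moment + m'.moment))) ^ (1 / 2 : ℝ) := by
  rcases le_total a b with h | h
  · rw [abs_of_nonneg (by linarith [Subtype.coe_le_coe.2 h])]
    exact wass_mix_mix_le_aux h m m'
  · rw [abs_of_nonpos (by linarith [Subtype.coe_le_coe.2 h]), wass_comm, neg_sub]
    exact wass_mix_mix_le_aux h m m'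

theorem continuous_mix (m m' : P2 E) : Continuous fun lam => mix lam m m' := by
  refine continuous_iff_continuousAt.2 fun a => tendsto_of_wass ?_
  refine tendsto_of_tendsto_of_tendsto_of_le_of_le tendsto_const_nhds ?_ (fun _ => zero_le)
    (fun b => wass_mix_mix_le a b m m')
  have hfin : 2 * (m.moment + m'.moment) ≠ ∞ :=
    ENNReal.mul_ne_top (by simp) (ENNReal.add_lt_top.2 ⟨m.moment_lt_top, m'.moment_lt_top⟩).ne
  have h1 : Tendsto (fun b : unitInterval => ENNReal.ofReal |(b : ℝ) - a|) (𝓝 a) (𝓝 0) := by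
    have : Continuous fun b : unitInterval => ENNReal.ofReal |(b : ℝ) - a| :=
      ENNReal.continuous_ofReal.comp (by fun_prop)
    simpa using this.tendsto a
  have h2 := ENNReal.Tendsto.mul_const h1 (Or.inr hfin)
  rw [zero_mul] at h2
  have h3 := (ENNReal.continuous_rpow_const (y := 1 / 2)).tendsto 0 |>.comp h2
  simpa [Function.comp_def] using h3

/-- The Dirac mass at `z`. -/
noncomputable def dirac (z : E) : P2 E :=
  ⟨Measure.dirac z, inferInstance, by
    rw [lintegral_dirac' _ (by fun_prop)]; finiteness⟩

theorem dirac_meas (z : E) : (dirac z).meas = Measure.dirac z := rfl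

theorem moment_dirac (z : E) : (dirac z).moment = ‖z‖ₑ ^ 2 := by
  rw [moment, dirac_meas, lintegral_dirac' _ (by fun_prop)]

end Norm

end P2

variable {d l k : ℕ}

/-! ## Interpolating paths with small cost -/

theorem isCadlag_of_continuous {E : Type*} [TopologicalSpace E] {y : ℝ → E} (hy : Continuous y) :
    IsCadlag y :=
  fun s => ⟨hy.continuousWithinAt, y s, hy.continuousWithinAt⟩

namespace D0

variable {a b : ℝ}

theorem measurable_of_eval {Ω : Type*} [MeasurableSpace Ω] {f : Ω → D0 a b d l}
    (h : ∀ s, Measurable fun ω => (f ω).1 s) : Measurable f :=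
  (measurable_pi_lambda _ h).subtype_mk

theorem tendsto_right (y : D0 a b d l) (s : ℝ) : Tendsto y.1 (𝓝[>] s) (𝓝 (y.1 s)) :=
  (y.2.1 s).1.mono_left (nhdsWithin_mono _ Ioi_subset_Ici_self)

/-- A closed condition that holds at the rationals shortly after time `s` holds at time `s`. -/
theorem mem_of_forall_rat {y : D0 a b d l} {C : Set (State d l)} (hC : IsClosed C) {s v : ℝ}
    (hsv : s < v) (h : ∀ q : ℚ, s < q → q < v → y.1 q ∈ C) : y.1 s ∈ C := by
  by_contra hs
  have h1 : ∀ᶠ r in 𝓝[>] s, y.1 r ∈ Cᶜ := y.tendsto_right s (hC.isOpen_compl.mem_nhds hs)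
  obtain ⟨u, hu, hsub⟩ := mem_nhdsGT_iff_exists_Ioo_subset.1 h1
  obtain ⟨q, hq1, hq2⟩ := exists_rat_btwn (lt_min (show s < u from hu) hsv)
  exact hsub ⟨hq1, hq2.trans_le (min_le_left _ _)⟩ (h q hq1 (hq2.trans_le (min_le_right _ _)))

theorem eq_of_forall_rat {y y' : D0 a b d l} (h : ∀ q : ℚ, y.1 q = y'.1 q) : y = y' := by
  refine Subtype.ext (funext fun s => ?_)
  by_contra hne
  have h1 : ∀ᶠ r in 𝓝[>] s, y.1 r ≠ y'.1 r :=
    ((y.tendsto_right s).prodMk_nhds (y'.tendsto_right s)).eventually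
      (isClosed_diagonal.isOpen_compl.eventually_mem hne)
  obtain ⟨u, hu, hsub⟩ := mem_nhdsGT_iff_exists_Ioo_subset.1 h1
  obtain ⟨q, hq1, hq2⟩ := exists_rat_btwn (show s < u from hu)
  exact hsub ⟨hq1, hq2⟩ (h q)

/-- By right-continuity a path is determined by its values at rational times. With measurable
singletons, integrals against a Dirac mass on path space need no measurability of the integrand, so
the cost functional never has to be shown measurable. -/
instance : MeasurableSingletonClass (D0 a b d l) where
  measurableSet_singleton y := by
    have : ({y} : Set (D0 a b d l)) = ⋂ q : ℚ, {y' | y'.1 q = y.1 q} := by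
      ext y'
      simp only [mem_singleton_iff, mem_iInter, mem_ofPred_eq]
      exact ⟨fun h q => by rw [h], fun h => eq_of_forall_rat h⟩
    rw [this]
    exact MeasurableSet.iInter fun q => measurable_eval (q : ℝ) (measurableSet_singleton _)

theorem measurableSet_const : MeasurableSet {y : D0 a b d l | ∀ s, y.1 s = y.1 0} := by
  have : {y : D0 a b d l | ∀ s, y.1 s = y.1 0} = ⋂ q : ℚ, {y | y.1 q = y.1 0} := by
    ext y
    simp only [mem_iInter, mem_ofPred_eq]
    exact ⟨fun h q => h q, fun h s => mem_of_forall_rat (isClosed_singleton (x := y.1 0))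
      (lt_add_one s) fun q _ _ => h q⟩
  rw [this]
  exact MeasurableSet.iInter fun q =>
    measurableSet_eq_fun (measurable_eval (q : ℝ)) (measurable_eval 0)

/-- The constant path. -/
def constPath (a b : ℝ) (z : State d l) : D0 a b d l :=
  ⟨fun _ => z, isCadlag_of_continuous continuous_const, fun _ _ => rfl, fun _ _ => rfl⟩

theorem measurable_constPath : Measurable (constPath a b (d := d) (l := l)) :=
  measurable_of_eval fun _ => measurable_id

/-- The segment from `z` to `z + w`, run through in the time interval `[0,1]`. -/
def segPath (z w : State d l) : D0 0 1 d l :=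
  ⟨fun s => z + max 0 (min s 1) • w, isCadlag_of_continuous (by fun_prop),
    fun s hs => by simp [min_eq_left (hs.le.trans zero_le_one), hs.le],
    fun s hs => by simp [min_eq_right hs]⟩

end D0

theorem stieltjes_const (a : ℝ) : stieltjes (fun _ => a) = 0 := by
  have h : Monotone (fun _ : ℝ => a) := monotone_const
  have h2 : h.stieltjesFunction = StieltjesFunction.const ℝ a := by
    ext x
    rw [Monotone.stieltjesFunction_eq]
    exact (continuousAt_const (y := a)).continuousWithinAt.rightLim_eq
  rw [stieltjes, dif_pos h, h2, StieltjesFunction.measure_const]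

theorem stieltjes_of_continuous {f : ℝ → ℝ} (hf : Monotone f) (hc : Continuous f) (a b : ℝ) :
    stieltjes f (Icc a b) = ENNReal.ofReal (f b - f a) := by
  rw [stieltjes, dif_pos hf, StieltjesFunction.measure_Icc]
  have h : ∀ x, hf.stieltjesFunction x = f x := fun x => by
    rw [Monotone.stieltjesFunction_eq]
    exact hc.continuousWithinAt.rightLim_eq
  have h' : (hf.stieltjesFunction : ℝ → ℝ) = f := funext h
  rw [h', hc.continuousWithinAt.leftLim_eq]

instance (f : ℝ → ℝ) : IsLocallyFiniteMeasure (stieltjes f) := by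
  unfold stieltjes
  split_ifs <;> infer_instance

/-- The law of the path that stays at a point of law `m` with probability `1 - a`, and that runs
through the segment from `z` to `z + w` with probability `a`. -/
noncomputable def segLaw (a : unitInterval) (m : P2 (State d l)) (z w : State d l) : P2D 0 1 d l :=
  ⟨ENNReal.ofReal a • Measure.dirac (D0.segPath z w) +
    ENNReal.ofReal (1 - a) • m.meas.map (D0.constPath 0 1), by
    have h : ENNReal.ofReal a + ENNReal.ofReal (1 - a) = 1 := by
      rw [← ENNReal.ofReal_add a.2.1 (by linarith [a.2.2])]
      simp
    have : IsProbabilityMeasure (m.meas.map (D0.constPath 0 1)) :=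
      Measure.isProbabilityMeasure_map D0.measurable_constPath.aemeasurable
    refine ⟨⟨by simp [h]⟩, ?_⟩
    rw [lintegral_add_measure, lintegral_smul_measure, lintegral_smul_measure]
    refine ENNReal.add_lt_top.2 ⟨ENNReal.mul_lt_top ENNReal.ofReal_lt_top ?_,
      ENNReal.mul_lt_top ENNReal.ofReal_lt_top ?_⟩
    · rw [lintegral_dirac]
      refine ENNReal.pow_lt_top (lt_of_le_of_lt (b := ‖z‖ₑ + ‖w‖ₑ)
        (iSup_le fun s => enorm_add_le_of_le le_rfl ?_) (by finiteness))
      rw [enorm_smul]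
      refine mul_le_of_le_one_left zero_le ?_
      rw [Real.enorm_of_nonneg (by positivity)]
      simp
    · refine (lintegral_map_le _ _).trans_lt (lt_of_eq_of_lt ?_ m.moment_lt_top)
      simp [D0.constPath, P2.moment]⟩

theorem segLaw_marginal (a : unitInterval) (m : P2 (State d l)) (z w : State d l) (s : ℝ) :
    (segLaw a m z w).marginal s = P2.mix a m (P2.dirac (z + max 0 (min s 1) • w)) := by
  refine P2.ext ?_
  change (ENNReal.ofReal a • Measure.dirac (D0.segPath z w) +
    ENNReal.ofReal (1 - a) • m.meas.map (D0.constPath 0 1)).map (fun y => y.1 s) = _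
  rw [Measure.map_add _ _ (D0.measurable_eval s), Measure.map_smul, Measure.map_smul,
    Measure.map_dirac' (D0.measurable_eval s),
    Measure.map_map (D0.measurable_eval s) D0.measurable_constPath, P2.mix_meas, P2.dirac_meas]
  congr 2
  exact Measure.map_id

/-- The law is carried by the constant paths and one segment, and these form a measurable set;
therefore `p` itself may be non-measurable. -/
theorem ae_segLaw {a : unitInterval} {m : P2 (State d l)} {z w : State d l}
    {p : D0 0 1 d l → Prop} (h : ∀ y : D0 0 1 d l, (∀ s, y.1 s = y.1 0) → p y)
    (h' : p (D0.segPath z w)) : ∀ᵐ y ∂(segLaw a m z w).meas, p y := by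
  change ∀ᵐ y ∂(ENNReal.ofReal a • Measure.dirac (D0.segPath z w) +
    ENNReal.ofReal (1 - a) • m.meas.map (D0.constPath 0 1)), p y
  rw [ae_add_measure_iff]
  refine ⟨Measure.ae_smul_measure (by rw [ae_dirac_eq]; exact h') _,
    Measure.ae_smul_measure ?_ _⟩
  have : ∀ᵐ y ∂m.meas.map (D0.constPath 0 1 (d := d) (l := l)), ∀ s, y.1 s = y.1 0 :=
    (ae_map_iff D0.measurable_constPath.aemeasurable D0.measurableSet_const).2
      (Eventually.of_forall fun z s => rfl)
  exact this.mono h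

/-- Only the atom is moved, at the cost `√a · edist x y`, and `a ≤ 1`. -/
theorem wass_mix_right_le (a : unitInterval) (m : P2 (State d l)) (x y : State d l) :
    P2.wass (P2.mix a m (P2.dirac x)) (P2.mix a m (P2.dirac y)) ≤ edist x y := by
  have h : ENNReal.ofReal a + ENNReal.ofReal (1 - a) = 1 := by
    rw [← ENNReal.ofReal_add a.2.1 (by linarith [a.2.2])]
    simp
  refine (P2.wass_le_of_coupling (ENNReal.ofReal a • Measure.dirac (x, y) +
    ENNReal.ofReal (1 - a) • m.meas.map (fun x => (x, x))) ?_ ?_).trans ?_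
  · rw [Measure.map_add _ _ (by fun_prop), Measure.map_smul,
      Measure.map_smul, Measure.map_map (by fun_prop) (by fun_prop), Measure.map_dirac' (by fun_prop),
      P2.mix_meas, P2.dirac_meas]
    simp [Function.comp_def]
  · rw [Measure.map_add _ _ (by fun_prop), Measure.map_smul,
      Measure.map_smul, Measure.map_map (by fun_prop) (by fun_prop), Measure.map_dirac' (by fun_prop),
      P2.mix_meas, P2.dirac_meas]
    simp [Function.comp_def]
  · rw [lintegral_add_measure, lintegral_smul_measure, lintegral_smul_measure,
      lintegral_map (by fun_prop) (by fun_prop), lintegral_dirac' _ (by fun_prop)]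
    simp only [edist_self, smul_eq_mul]
    have h0 : ((0 : ℝ≥0∞) ^ 2) = 0 := by norm_num
    rw [h0, lintegral_zero, mul_zero, add_zero, ENNReal.mul_rpow_of_nonneg _ _ (by norm_num),
      ← ENNReal.rpow_natCast, ← ENNReal.rpow_mul]
    norm_num
    refine mul_le_of_le_one_left zero_le (ENNReal.rpow_le_one ?_ (by norm_num))
    simpa using a.2.2

theorem continuous_segLaw_marginal (a : unitInterval) (m : P2 (State d l)) (z w : State d l) :
    Continuous (segLaw a m z w).marginal := by
  refine continuous_iff_continuousAt.2 fun s => P2.tendsto_of_wass ?_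
  simp only [segLaw_marginal]
  refine tendsto_of_tendsto_of_tendsto_of_le_of_le tendsto_const_nhds ?_ (fun _ => zero_le)
    (fun r => wass_mix_right_le a m _ _)
  have : Continuous fun r : ℝ => edist (z + max 0 (min s 1) • w) (z + max 0 (min r 1) • w) := by
    fun_prop
  simpa using this.tendsto s

/-- The direction `(γ(t), 1) eⱼ`. -/
noncomputable def dir (γ : ℝ → Matrix (Fin d) (Fin l) ℝ) (t : ℝ) (j : Fin l) : State d l :=
  ((γ t).mulVec (Pi.single j 1), Pi.single j 1)

theorem segLaw_mem_interp (γ : ℝ → Matrix (Fin d) (Fin l) ℝ) (t : ℝ) (a : unitInterval)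
    (m : P2 (State d l)) (z : State d l) (j : Fin l) {h : ℝ} (hh : 0 ≤ h) :
    segLaw a m z (h • dir γ t j) ∈ interp γ t (P2.mix a m (P2.dirac z))
      (P2.mix a m (P2.dirac (z + h • dir γ t j))) := by
  refine ⟨by simp [segLaw_marginal], by simp [segLaw_marginal], ae_segLaw ?_ ?_, ae_segLaw ?_ ?_,
    (continuous_segLaw_marginal a m z _).continuousOn, ae_segLaw ?_ ?_⟩
  · exact fun y hy => (hy _).symm
  · simp [D0.segPath, D0.pre]
  · intro y hy r s _
    simp [D0.xi, hy r, hy s]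
  · intro r s hrs
    simp only [D0.xi, D0.segPath, Prod.snd_add, Prod.smul_snd, dir]
    gcongr
    intro i
    by_cases hi : i = j
    · subst hi; simpa using hh
    · simp [hi]
  · intro y hy r _
    simp [D0.X, D0.xi, hy r]
  · intro r hr
    simp only [D0.X, D0.xi, D0.segPath, Prod.snd_add, Prod.smul_snd, Prod.fst_add, Prod.smul_fst,
      dir]
    simp [Matrix.mulVec_smul]

/-- Constant paths cost nothing. The segment has probability `a`; it is continuous, so the jump sum
is empty, and only the `j`-th control component moves, by `h` in total. -/
theorem pathCost_segLaw_le {γ : ℝ → Matrix (Fin d) (Fin l) ℝ}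
    {c : ℝ → P2 (State d l) → State d l → Fin l → ℝ} {t : ℝ}
    (hc : Continuous fun p : P2 (State d l) × State d l => c t p.1 p.2) (a : unitInterval)
    (m : P2 (State d l)) (z : State d l) (j : Fin l) {h : ℝ} (hh : 0 ≤ h) {κ : ℝ}
    (hκ : ∀ s ∈ Icc 0 h, c t (P2.mix a m (P2.dirac (z + s • dir γ t j))) (z + s • dir γ t j) j ≤ κ) :
    pathCost γ c t (segLaw a m z (h • dir γ t j)) ≤ a * (h * κ) := by
  set w := h • dir γ t j with hw
  set F : D0 0 1 d l → ℝ := fun y =>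
    intAgainst {r ∈ Icc 0 1 | Function.leftLim y.xi r = y.xi r}
        (fun r => c t ((segLaw a m z w).marginal r) (y.1 r)) y.xi
    + ∑' r : {r : ℝ // r ∈ Icc 0 1 ∧ Function.leftLim y.xi r ≠ y.xi r},
        CD0 γ c t ((segLaw a m z w).marginal r) (Function.leftLim y.X r)
          (Function.leftLim y.xi r) (y.xi r) with hF
  have hcont : ∀ y : D0 0 1 d l, Continuous y.xi → F y = intAgainst (Icc 0 1)
        (fun r => c t ((segLaw a m z w).marginal r) (y.1 r)) y.xi := by
    intro y hy
    have hl : ∀ r, Function.leftLim y.xi r = y.xi r := fun r => hy.continuousWithinAt.leftLim_eq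
    have : IsEmpty {r : ℝ // r ∈ Icc (0 : ℝ) 1 ∧ Function.leftLim y.xi r ≠ y.xi r} :=
      ⟨fun r => r.2.2 (hl r)⟩
    simp only [hF, tsum_empty, add_zero]
    congr 1
    ext r
    simp [hl r]
  have h0 : ∀ y : D0 0 1 d l, (∀ s, y.1 s = y.1 0) → F y = 0 := by
    intro y hy
    have hxi : y.xi = fun _ => y.xi 0 := funext fun s => by simp [D0.xi, hy s]
    rw [hcont y (by rw [hxi]; exact continuous_const), hxi]
    simp [intAgainst, stieltjes_const]
  have h1 : F (D0.segPath z w) ≤ h * κ := by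
    have hxi : (D0.segPath z w).xi = fun s => z.2 + (max 0 (min s 1) * h) • Pi.single j 1 := by
      funext s
      simp [D0.xi, D0.segPath, hw, dir, smul_smul]
    rw [hcont _ (by rw [hxi]; fun_prop), intAgainst, Finset.sum_eq_single j]
    · have hmono : Monotone fun s => (D0.segPath z w).xi s j := by
        intro r s hrs
        simp only [hxi, Pi.add_apply, Pi.smul_apply, Pi.single_eq_same, smul_eq_mul, mul_one]
        gcongr
      have hco : Continuous fun s => (D0.segPath z w).xi s j := by
        rw [hxi]; fun_prop
      have hm := stieltjes_of_continuous hmono hco 0 1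
      have e1 : (D0.segPath z w).xi 1 j - (D0.segPath z w).xi 0 j = h := by
        simp [hxi]
      rw [e1] at hm
      have hint : Continuous fun r => c t ((segLaw a m z w).marginal r) ((D0.segPath z w).1 r) j := by
        have : Continuous fun r => ((segLaw a m z w).marginal r, (D0.segPath z w).1 r) :=
          (continuous_segLaw_marginal a m z w).prodMk (by simp only [D0.segPath]; fun_prop)
        exact (continuous_apply j).comp (hc.comp this)
      calc ∫ r in Icc 0 1, c t ((segLaw a m z w).marginal r) ((D0.segPath z w).1 r) j
              ∂(stieltjes fun s => (D0.segPath z w).xi s j)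
          ≤ ∫ r in Icc 0 1, κ ∂(stieltjes fun s => (D0.segPath z w).xi s j) := by
            refine setIntegral_mono_on hint.continuousOn.integrableOn_Icc
              continuousOn_const.integrableOn_Icc measurableSet_Icc fun r hr => ?_
            have := hκ (r * h) ⟨mul_nonneg hr.1 hh, mul_le_of_le_one_left hh hr.2⟩
            rw [segLaw_marginal]
            simpa [D0.segPath, min_eq_left hr.2, max_eq_right hr.1, hw, smul_smul] using this
        _ = h * κ := by
            rw [setIntegral_const, Measure.real, hm, ENNReal.toReal_ofReal hh, smul_eq_mul]
    · intro i _ hi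
      have : (fun s => (D0.segPath z w).xi s i) = fun _ => z.2 i := by
        funext s
        simp [hxi, hi]
      rw [this, stieltjes_const]
      simp
    · simp
  have hae : ∀ᵐ y ∂m.meas.map (D0.constPath 0 1 (d := d) (l := l)), F y = 0 := by
    have : ∀ᵐ y ∂m.meas.map (D0.constPath 0 1 (d := d) (l := l)), ∀ s, y.1 s = y.1 0 :=
      (ae_map_iff D0.measurable_constPath.aemeasurable D0.measurableSet_const).2
        (Eventually.of_forall fun z s => rfl)
    exact this.mono h0
  -- Integrability comes from vanishing almost everywhere, since measurability of `F` is not at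
  -- hand.
  have hI : Integrable F (m.meas.map (D0.constPath 0 1)) :=
    (integrable_zero _ _ _).congr (hae.mono fun y hy => hy.symm)
  calc pathCost γ c t (segLaw a m z w)
      = ∫ y, F y ∂(ENNReal.ofReal a • Measure.dirac (D0.segPath z w) +
          ENNReal.ofReal (1 - a) • m.meas.map (D0.constPath 0 1)) := rfl
    _ = a * F (D0.segPath z w) := by
        rw [integral_add_measure ((integrable_dirac (by finiteness)).smul_measure (by simp))
          (hI.smul_measure (by simp)), integral_smul_measure, integral_smul_measure,
          integral_dirac, integral_congr_ae hae]
        simp [ENNReal.toReal_ofReal a.2.1]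
    _ ≤ a * (h * κ) := by
        gcongr
        exact a.2.1

variable {d l k : ℕ}

/-! ## The derivative inequality, given reachability -/

theorem integrable_of_growth {f : State d l → ℝ} (hf : Continuous f) {K : ℝ}
    (hK : ∀ z, |f z| ≤ K * (1 + ‖z‖ ^ 2)) (m : P2 (State d l)) : Integrable f m.meas := by
  have h2 : Integrable (fun z : State d l => ‖z‖ ^ 2) m.meas := by
    refine ⟨by fun_prop, ?_⟩
    rw [hasFiniteIntegral_iff_enorm]
    refine lt_of_eq_of_lt (lintegral_congr fun z => ?_) m.moment_lt_top
    rw [enorm_pow, enorm_norm]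
  refine (((integrable_const 1).add h2).const_mul K).mono' hf.aestronglyMeasurable
    (Eventually.of_forall fun z => ?_)
  simpa using hK z

/-- The two measures differ only in the position of the atom: the contributions of `(1 - a) m`
cancel, and a factor `a` comes out. -/
theorem linearDeriv_increment {u : P2 (State d l) → ℝ} {δ : P2 (State d l) → State d l → ℝ}
    (hδ : IsLinearDeriv u δ) (hc : ∀ m, Continuous (δ m)) {K : ℝ}
    (hK : ∀ m z, |δ m z| ≤ K * (1 + ‖z‖ ^ 2)) (a : unitInterval) (m : P2 (State d l))
    (z z' : State d l) :
    u (P2.mix a m (P2.dirac z')) - u (P2.mix a m (P2.dirac z)) =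
      ∫ lam : unitInterval, a * (δ (P2.mix a m (P2.mix lam (P2.dirac z) (P2.dirac z'))) z' -
        δ (P2.mix a m (P2.mix lam (P2.dirac z) (P2.dirac z'))) z) := by
  rw [hδ]
  refine integral_congr_ae (Eventually.of_forall fun lam => ?_)
  simp only [P2.mix_mix_right]
  set μ := P2.mix a m (P2.mix lam (P2.dirac z) (P2.dirac z'))
  have key : ∀ w, ∫ y, δ μ y ∂(P2.mix a m (P2.dirac w)).meas =
      a * δ μ w + (1 - a) * ∫ y, δ μ y ∂m.meas := by
    intro w
    rw [P2.mix_meas, integral_add_measure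
      ((integrable_of_growth (hc μ) (hK μ) _).smul_measure (by simp))
      ((integrable_of_growth (hc μ) (hK μ) _).smul_measure (by simp)), integral_smul_measure,
      integral_smul_measure, P2.dirac_meas, integral_dirac, ENNReal.toReal_ofReal a.2.1,
      ENNReal.toReal_ofReal (by linarith [a.2.2])]
    simp
  rw [key, key]
  ring

theorem sub_ge_of_fderiv_ge {f : State d l → ℝ} (hf : ContDiff ℝ 2 f) {z v : State d l} {h κ : ℝ}
    (hh : 0 ≤ h) (hκ : ∀ s ∈ Icc 0 h, κ ≤ fderiv ℝ f (z + s • v) v) :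
    h * κ ≤ f (z + h • v) - f z := by
  have hd : ∀ s : ℝ, HasDerivAt (fun s => f (z + s • v)) (fderiv ℝ f (z + s • v) v) s := by
    intro s
    have h1 : HasDerivAt (fun s : ℝ => z + s • v) v s := by
      simpa using ((hasDerivAt_id s).smul_const v).const_add z
    exact ((hf.differentiable (by norm_num) _).hasFDerivAt).comp_hasDerivAt s h1
  have := Convex.mul_sub_le_image_sub_of_le_deriv (convex_Icc 0 h)
    (f := fun s => f (z + s • v)) (fun s _ => (hd s).continuousAt.continuousWithinAt)
    (fun s _ => (hd s).differentiableAt.differentiableWithinAt) (C := κ)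
    (fun s hs => by rw [(hd s).deriv]; exact hκ s (interior_subset hs))
    0 ⟨le_rfl, hh⟩ h ⟨hh, le_rfl⟩ hh
  simpa [mul_comm] using this

/-- By `wass_mix_mix_le` the distance from `m` to the mixture is at most `√(2 a (moment of m +
moment of ν))`. A bound on the moment of `ν` therefore allows `a` to be chosen before `ν`. -/
theorem exists_mix_near {m : P2 (State d l)} {z v : State d l}
    {U : Set (P2 (State d l) × State d l)} (hU : U ∈ 𝓝 (m, z)) :
    ∃ a : unitInterval, 0 < (a : ℝ) ∧ ∃ h : ℝ, 0 < h ∧ ∀ ν : P2 (State d l), ∀ s ∈ Icc 0 h,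
      ν.moment ≤ (‖z‖ₑ + ‖v‖ₑ) ^ 2 → (P2.mix a m ν, z + s • v) ∈ U := by
  rw [nhds_prod_eq, mem_prod_iff] at hU
  obtain ⟨V, hV, W, hW, hVW⟩ := hU
  obtain ⟨ε, hε, hball⟩ := P2.exists_ball_subset hV
  have hW' : ∀ᶠ s : ℝ in 𝓝 0, z + s • v ∈ W := by
    have : Tendsto (fun s : ℝ => z + s • v) (𝓝 0) (𝓝 (z + (0 : ℝ) • v)) :=
      Continuous.tendsto (by fun_prop) 0
    rw [zero_smul, add_zero] at this
    exact this hW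
  obtain ⟨h, hh, hball'⟩ := Metric.eventually_nhds_iff_ball.1 hW'
  set C : ℝ≥0∞ := 2 * (m.moment + (‖z‖ₑ + ‖v‖ₑ) ^ 2) with hC
  have hCfin : C ≠ ∞ :=
    ENNReal.mul_ne_top (by simp) (ENNReal.add_lt_top.2 ⟨m.moment_lt_top, by finiteness⟩).ne
  have hlim : Tendsto (fun a : ℝ => (ENNReal.ofReal |a| * C) ^ (1 / 2 : ℝ)) (𝓝[>] 0) (𝓝 0) := by
    have h1 : Tendsto (fun a : ℝ => ENNReal.ofReal |a|) (𝓝[>] 0) (𝓝 0) := by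
      have : Continuous fun a : ℝ => ENNReal.ofReal |a| :=
        ENNReal.continuous_ofReal.comp (by fun_prop)
      simpa using (this.tendsto 0).mono_left nhdsWithin_le_nhds
    have h2 := ENNReal.Tendsto.mul_const h1 (Or.inr hCfin)
    rw [zero_mul] at h2
    have h3 := (ENNReal.continuous_rpow_const (y := 1 / 2)).tendsto 0 |>.comp h2
    simpa [Function.comp_def] using h3
  have hev : ∀ᶠ a : ℝ in 𝓝[>] 0, (ENNReal.ofReal |a| * C) ^ (1 / 2 : ℝ) < ε ∧ 0 < a ∧ a ≤ 1 := by
    filter_upwards [hlim.eventually_lt_const hε, self_mem_nhdsWithin,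
      Ioc_mem_nhdsGT (zero_lt_one (α := ℝ))] with a h1 _ h2 using ⟨h1, h2⟩
  obtain ⟨a, ha, ha0, ha1⟩ := hev.exists
  -- The radius is halved because `s` ranges over a closed interval while the ball is open.
  refine ⟨⟨a, ha0.le, ha1⟩, ha0, h / 2, by positivity, fun ν s hs hν => hVW ⟨hball _ ?_, ?_⟩⟩
  · have := P2.wass_mix_mix_le 0 ⟨a, ha0.le, ha1⟩ m ν
    rw [P2.mix_zero] at this
    refine (this.trans ?_).trans_lt ha
    rw [Icc.coe_zero, sub_zero]
    gcongr
    rw [hC]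
    gcongr
  · refine hball' s ?_
    rw [Metric.mem_ball, dist_zero_right, Real.norm_eq_abs, abs_of_nonneg hs.1]
    linarith [hs.2]

/-- If the inequality fails, moving a small atom at `z` along `dir γ t j` raises `u` by strictly
more than it costs. -/
theorem fderiv_le_of_reachable {T : ℝ}
    {b : ℝ → P2 (State d l) → State d l → Fin d → ℝ}
    {σ : ℝ → P2 (State d l) → State d l → Matrix (Fin d) (Fin k) ℝ}
    {γ : ℝ → Matrix (Fin d) (Fin l) ℝ}
    {c : ℝ → P2 (State d l) → State d l → Fin l → ℝ}
    (hcoef : Coefficients T b σ γ c) {u : ℝ → P2 (State d l) → ℝ}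
    {δu : ℝ → P2 (State d l) → State d l → ℝ} (hu : IsC122 T u δu) {t : ℝ} (ht : t ∈ Icc 0 T)
    (hopt : ∀ m m' : P2 (State d l), Reachable T b σ γ t m' m →
      (u t m : EReal) + Cm γ c t m m' ≥ (u t m' : EReal)) (j : Fin l)
    (hreach : ∀ (a : unitInterval) (m : P2 (State d l)) (z : State d l) (h : ℝ), 0 ≤ h →
      Reachable T b σ γ t (P2.mix a m (P2.dirac (z + h • dir γ t j))) (P2.mix a m (P2.dirac z)))
    (m : P2 (State d l)) (z : State d l) :
    fderiv ℝ (δu t m) z (dir γ t j) ≤ c t m z j := by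
  by_contra! hlt
  set v := dir γ t j with hv
  have hslice : Continuous fun p : P2 (State d l) × State d l => (t, p) := by fun_prop
  have hcc : Continuous fun p : P2 (State d l) × State d l => c t p.1 p.2 :=
    hcoef.c_cont.comp_continuous hslice fun p => ⟨ht, mem_univ _⟩
  have hcd : Continuous fun p : P2 (State d l) × State d l => δu t p.1 p.2 :=
    hu.cont₀.comp_continuous hslice fun p => ⟨ht, mem_univ _⟩
  have hcf : Continuous fun p : P2 (State d l) × State d l => fderiv ℝ (δu t p.1) p.2 v :=
    (hu.cont₁.comp_continuous hslice fun p => ⟨ht, mem_univ _⟩).clm_apply continuous_const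
  have hcj : Continuous fun p : P2 (State d l) × State d l => c t p.1 p.2 j :=
    (continuous_apply j).comp hcc
  -- Two levels are inserted, `c < κ₁ < κ₂ < ∂δₘu · v`: after passing to a neighbourhood the bounds
  -- for cost and increment are still strictly separated.
  obtain ⟨κ₁, hκ₁, hκ₁'⟩ := exists_between hlt
  obtain ⟨κ₂, hκ₂, hκ₂'⟩ := exists_between hκ₁'
  have hU : {p : P2 (State d l) × State d l | c t p.1 p.2 j < κ₁ ∧
      κ₂ < fderiv ℝ (δu t p.1) p.2 v} ∈ 𝓝 (m, z) :=
    ((isOpen_lt hcj continuous_const).inter (isOpen_lt continuous_const hcf)).mem_nhds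
      ⟨hκ₁, hκ₂'⟩
  obtain ⟨a, ha, h₀, hh₀, hnear⟩ := exists_mix_near (v := v) hU
  -- With `h ≤ 1` the atoms `z + s • v` satisfy the moment bound `(‖z‖ + ‖v‖)²` required by
  -- `exists_mix_near`.
  set h := min h₀ 1 with hh
  have hhpos : 0 < h := by positivity
  have hmom : ∀ s ∈ Icc 0 h, (P2.dirac (z + s • v)).moment ≤ (‖z‖ₑ + ‖v‖ₑ) ^ 2 := by
    intro s hs
    rw [P2.moment_dirac]
    refine pow_le_pow_left' (enorm_add_le_of_le le_rfl ?_) 2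
    rw [enorm_smul]
    refine mul_le_of_le_one_left zero_le ?_
    rw [Real.enorm_of_nonneg hs.1, ENNReal.ofReal_le_one]
    exact hs.2.trans (min_le_right _ _)
  have hmem : ∀ s ∈ Icc 0 h, s ∈ Icc 0 h₀ := fun s hs => ⟨hs.1, hs.2.trans (min_le_left _ _)⟩
  have hcost : Cm γ c t (P2.mix a m (P2.dirac z)) (P2.mix a m (P2.dirac (z + h • v))) ≤
      ((a * (h * κ₁) : ℝ) : EReal) := by
    refine (iInf₂_le _ (segLaw_mem_interp γ t a m z j hhpos.le)).trans ?_
    exact_mod_cast pathCost_segLaw_le hcc a m z j hhpos.le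
      fun s hs => (hnear _ s (hmem s hs) (hmom s hs)).1.le
  obtain ⟨K, hK⟩ := hu.growth
  have hinc : a * (h * κ₂) ≤
      u t (P2.mix a m (P2.dirac (z + h • v))) - u t (P2.mix a m (P2.dirac z)) := by
    rw [linearDeriv_increment (hu.linear_deriv t ht) (fun m => (hu.smooth t ht m).continuous)
      (fun m z => (hK t ht m z).1)]
    have hcont : Continuous fun lam : unitInterval =>
        P2.mix a m (P2.mix lam (P2.dirac z) (P2.dirac (z + h • v))) := by
      have := P2.continuous_mix (P2.mix a m (P2.dirac z)) (P2.mix a m (P2.dirac (z + h • v)))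
      simpa only [P2.mix_mix_right] using this
    have hint : Continuous fun lam : unitInterval =>
        (a : ℝ) * (δu t (P2.mix a m (P2.mix lam (P2.dirac z) (P2.dirac (z + h • v)))) (z + h • v) -
        δu t (P2.mix a m (P2.mix lam (P2.dirac z) (P2.dirac (z + h • v)))) z) :=
      continuous_const.mul ((hcd.comp (hcont.prodMk continuous_const)).sub
        (hcd.comp (hcont.prodMk continuous_const)))
    calc (a : ℝ) * (h * κ₂) = ∫ _ : unitInterval, (a : ℝ) * (h * κ₂) := by simp
      _ ≤ _ := by
        refine integral_mono (integrable_const _)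
          (hint.integrable_of_hasCompactSupport (HasCompactSupport.of_compactSpace _))
          fun lam => ?_
        refine mul_le_mul_of_nonneg_left (sub_ge_of_fderiv_ge (hu.smooth t ht _) hhpos.le
          fun s hs => (hnear _ s (hmem s hs) ?_).2.le) ha.le
        -- The measures on the segment are mixtures with two-point laws, whose moment is a convex
        -- combination of the moments of the end points.
        rw [P2.moment_mix]
        have h1 := hmom h ⟨hhpos.le, le_rfl⟩
        have h2 := hmom 0 ⟨le_rfl, hhpos.le⟩
        rw [zero_smul, add_zero] at h2
        calc _ ≤ ENNReal.ofReal lam * (‖z‖ₑ + ‖v‖ₑ) ^ 2 +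
              ENNReal.ofReal (1 - lam) * (‖z‖ₑ + ‖v‖ₑ) ^ 2 := by gcongr
          _ = (‖z‖ₑ + ‖v‖ₑ) ^ 2 := by
            rw [← add_mul, ← ENNReal.ofReal_add lam.2.1 (by linarith [lam.2.2])]
            simp
  have h1 := hopt _ _ (hreach a m z h hhpos.le)
  have h2 : (u t (P2.mix a m (P2.dirac (z + h • v))) : EReal) ≤
      ((u t (P2.mix a m (P2.dirac z)) + a * (h * κ₁) : ℝ) : EReal) := by
    rw [EReal.coe_add]
    exact (ge_iff_le.1 h1).trans (by gcongr)
  have h3 : u t (P2.mix a m (P2.dirac (z + h • v))) ≤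
      u t (P2.mix a m (P2.dirac z)) + a * (h * κ₁) := by exact_mod_cast h2
  have h4 : (a : ℝ) * (h * κ₁) < a * (h * κ₂) := by gcongr
  linarith

/-! ## The isonormal Gaussian process -/

section Isonormal

variable {Ω : Type*} [MeasurableSpace Ω] {P : Measure Ω} [IsProbabilityMeasure P]

omit [IsProbabilityMeasure P] in
open Complex in
theorem charFun_map_lp (f : Lp ℝ 2 P) (t : ℝ) :
    charFun (P.map f) t = ∫ ω, exp (I * ↑(t * f ω)) ∂P := by
  rw [charFun_apply_real, integral_map (by fun_prop) (by fun_prop)]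
  refine integral_congr_ae (Eventually.of_forall fun ω => ?_)
  simp only
  congr 1
  push_cast
  ring

theorem integral_abs_le_norm (f : Lp ℝ 2 P) : ∫ ω, |f ω| ∂P ≤ ‖f‖ := by
  have h : eLpNorm f 1 P ≤ eLpNorm f 2 P :=
    eLpNorm_le_eLpNorm_of_exponent_le (by norm_num) (Lp.aestronglyMeasurable f)
  simp_rw [← Real.norm_eq_abs]
  rw [integral_norm_eq_lintegral_enorm (Lp.aestronglyMeasurable f), ← eLpNorm_one_eq_lintegral_enorm]
  exact ENNReal.toReal_mono (Lp.eLpNorm_ne_top f) h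

-- As `|exp(ix) - exp(iy)| ≤ |x - y|`, the map is Lipschitz with constant `|t|` in `L¹`, hence in
-- `L²`.
open Complex in
theorem continuous_charFun_map_lp (t : ℝ) :
    Continuous fun f : Lp ℝ 2 P => charFun (P.map f) t := by
  refine (LipschitzWith.of_dist_le_mul (K := ⟨|t|, abs_nonneg t⟩) fun f g => ?_).continuous
  rw [charFun_map_lp, charFun_map_lp, dist_eq_norm]
  have hb : ∀ f : Lp ℝ 2 P, Integrable (fun ω => exp (I * ↑(t * f ω))) P := fun f =>
    (integrable_const (1 : ℝ)).mono' (by fun_prop) (Eventually.of_forall fun ω => by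
      rw [mul_comm, norm_exp_ofReal_mul_I])
  rw [← integral_sub (hb f) (hb g)]
  have hpt : ∀ ω, ‖exp (I * ↑(t * f ω)) - exp (I * ↑(t * g ω))‖ ≤ |t| * |f ω - g ω| := by
    intro ω
    have : exp (I * ↑(t * f ω)) - exp (I * ↑(t * g ω)) =
        exp (↑(t * g ω) * I) * (exp (I * ↑(t * (f ω - g ω))) - 1) := by
      rw [mul_sub, ← exp_add, mul_one]
      congr 2
      · push_cast; ring
      · ring
    rw [this, norm_mul, norm_exp_ofReal_mul_I, one_mul, ← abs_mul]
    exact Real.norm_exp_I_mul_ofReal_sub_one_le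
  have hfg : (fun ω => |f ω - g ω|) =ᵐ[P] fun ω => |(f - g : Lp ℝ 2 P) ω| := by
    filter_upwards [Lp.coeFn_sub f g] with ω hω
    rw [hω, Pi.sub_apply]
  calc ‖∫ ω, (exp (I * ↑(t * f ω)) - exp (I * ↑(t * g ω))) ∂P‖
      ≤ ∫ ω, |t| * |f ω - g ω| ∂P := by
        refine norm_integral_le_of_norm_le ?_ (Eventually.of_forall hpt)
        exact (((Lp.memLp f).integrable (by norm_num)).sub
          ((Lp.memLp g).integrable (by norm_num))).abs.const_mul _
    _ ≤ |t| * dist f g := by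
        rw [integral_const_mul, integral_congr_ae hfg, dist_eq_norm]
        gcongr
        exact integral_abs_le_norm _
    _ = _ := rfl

/-- Laws are compared through characteristic functions, and for each argument both sides depend
continuously on `f`. Gaussianity, with the right variance, thus passes to `L²`-limits. -/
theorem isClosed_gaussian :
    IsClosed {f : Lp ℝ 2 P | P.map f = gaussianReal 0 (‖f‖₊ ^ 2)} := by
  have : {f : Lp ℝ 2 P | P.map f = gaussianReal 0 (‖f‖₊ ^ 2)} =
      ⋂ t : ℝ, {f : Lp ℝ 2 P | charFun (P.map f) t = Complex.exp (-((‖f‖ ^ 2 * t ^ 2 / 2 : ℝ) : ℂ))} := by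
    ext f
    have : IsProbabilityMeasure (P.map f) := Measure.isProbabilityMeasure_map (by fun_prop)
    simp only [mem_ofPred_eq, mem_iInter]
    have e : ∀ t, charFun (gaussianReal 0 (‖f‖₊ ^ 2)) t =
        Complex.exp (-((‖f‖ ^ 2 * t ^ 2 / 2 : ℝ) : ℂ)) := fun t => by
      rw [charFun_gaussianReal]
      congr 1
      push_cast
      ring_nf
    constructor
    · intro h t
      rw [h, e]
    · intro h
      refine Measure.ext_of_charFun (funext fun t => ?_)
      rw [h, e]
  rw [this]
  exact isClosed_iInter fun t => isClosed_eq (continuous_charFun_map_lp t) (by fun_prop)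

/-- **Isonormal Gaussian process**: every Hilbert space embeds isometrically into an `L²`-space in
such a way that the image consists of jointly Gaussian random variables. -/
theorem exists_isonormal (H : Type) [NormedAddCommGroup H] [InnerProductSpace ℝ H]
    [CompleteSpace H] :
    ∃ (Ω : Type) (_ : MeasurableSpace Ω) (P : Measure Ω) (_ : IsProbabilityMeasure P)
      (Φ : H →ₗᵢ[ℝ] Lp ℝ 2 P), (∀ h, P.map (Φ h) = gaussianReal 0 (‖h‖₊ ^ 2)) := by
  -- The vectors of a Hilbert basis are sent to independent standard normal coordinates on a product
  -- space; orthonormality of these in `L²` makes the linear extension an isometry.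
  obtain ⟨w, b, -⟩ := exists_hilbertBasis ℝ H
  set P : Measure (w → ℝ) := Measure.infinitePi fun _ => gaussianReal 0 1 with hP
  have hlaw : ∀ i : w, HasLaw (fun ω : w → ℝ => ω i) (gaussianReal 0 1) P := fun i =>
    (measurePreserving_eval_infinitePi (fun _ : w => gaussianReal 0 1) i).hasLaw
  have hind : iIndepFun (fun (i : w) (ω : w → ℝ) => ω i) P :=
    iIndepFun_infinitePi (X := fun _ => id) (fun _ => measurable_id)
  have hmem : ∀ i : w, MemLp (fun ω : w → ℝ => ω i) 2 P := fun i => (hlaw i).hasGaussianLaw.memLp_two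
  set Z : w → Lp ℝ 2 P := fun i => (hmem i).toLp with hZ
  have hmean : ∀ i : w, ∫ ω, ω i ∂P = 0 := fun i => by
    rw [(hlaw i).integral_eq, integral_id_gaussianReal]
  have hortho : Orthonormal ℝ Z := by
    have hin : ∀ i j, inner ℝ (Z i) (Z j) = ∫ ω, ω i * ω j ∂P := fun i j => by
      rw [L2.inner_def]
      refine integral_congr_ae ?_
      filter_upwards [(hmem i).coeFn_toLp, (hmem j).coeFn_toLp] with ω h1 h2
      simp only [hZ, h1, h2, real_inner_eq_re_inner]
      simp [mul_comm]
    have hself : ∀ i, inner ℝ (Z i) (Z i) = 1 := fun i => by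
      have h1 := (hlaw i).variance_eq
      rw [variance_id_gaussianReal, variance_of_integral_eq_zero (hlaw i).aemeasurable (hmean i)]
        at h1
      rw [hin]
      simpa [pow_two] using h1
    refine ⟨fun i => ?_, fun i j hij => ?_⟩
    · have := hself i
      rw [real_inner_self_eq_norm_sq] at this
      nlinarith [norm_nonneg (Z i)]
    · change inner ℝ (Z i) (Z j) = 0
      rw [hin, ← Pi.mul_def (f := fun ω : w → ℝ => ω i) (g := fun ω : w → ℝ => ω j),
        (hind.indepFun hij).integral_mul_eq_mul_integral
        (hmem i).aestronglyMeasurable (hmem j).aestronglyMeasurable, hmean i, zero_mul]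
  set Ψ := hortho.orthogonalFamily.linearIsometry
  refine ⟨w → ℝ, inferInstance, P, inferInstance,
    Ψ.comp b.repr.toLinearIsometry, fun h => ?_⟩
  have hnorm : ‖(Ψ.comp b.repr.toLinearIsometry) h‖₊ = ‖h‖₊ := LinearIsometry.nnnorm_map _ _
  rw [← hnorm]
  have hsum : HasSum (fun i => (b.repr h) i • Z i) ((Ψ.comp b.repr.toLinearIsometry) h) :=
    hortho.orthogonalFamily.hasSum_linearIsometry (b.repr h)
  -- Finite partial sums of the basis expansion suffice; their law is Gaussian by independence, and
  -- its variance is the squared norm.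
  refine isClosed_gaussian.mem_of_tendsto hsum (Eventually.of_forall fun S => ?_)
  set f : Lp ℝ 2 P := ∑ i ∈ S, (b.repr h) i • Z i with hf
  have hfe : f =ᵐ[P] fun ω => ∑ i ∈ S, (b.repr h) i * ω i := by
    have h1 : ∀ᵐ ω ∂P, ∀ i ∈ S, ((b.repr h) i • Z i : Lp ℝ 2 P) ω = (b.repr h) i * ω i := by
      refine (S.eventually_all).2 fun i _ => ?_
      filter_upwards [Lp.coeFn_smul ((b.repr h) i) (Z i), (hmem i).coeFn_toLp] with ω h1 h2
      rw [h1, Pi.smul_apply, h2, smul_eq_mul]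
    filter_upwards [Lp.coeFn_finsetSum S (fun i => (b.repr h) i • Z i), h1] with ω h2 h3
    rw [hf, h2, Finset.sum_apply]
    exact Finset.sum_congr rfl h3
  have hG : HasGaussianLaw f P := by
    have h1 : HasGaussianLaw (fun ω : w → ℝ => ∑ i : S, (b.repr h) i * ω i) P := by
      refine iIndepFun.hasGaussianLaw_fun_sum (X := fun (i : S) (ω : w → ℝ) => (b.repr h) i * ω i)
        (fun i => ?_) ?_
      · exact (hlaw i).hasGaussianLaw.fun_smul ((b.repr h) i)
      · exact (hind.precomp (g := fun i : S => (i : w)) Subtype.val_injective).comp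
          (fun i x => (b.repr h) i * x) (fun i => by fun_prop)
    refine h1.congr ?_
    filter_upwards [hfe] with ω hω
    rw [hω, Finset.sum_coe_sort S (fun i => (b.repr h) i * ω i)]
  have hmf : ∫ ω, f ω ∂P = 0 := by
    rw [integral_congr_ae hfe, integral_finsetSum _ fun i _ =>
      ((hmem i).integrable (by norm_num)).const_mul _]
    simp [integral_const_mul, hmean]
  have hv : Var[f; P] = ‖f‖ ^ 2 := by
    rw [variance_of_integral_eq_zero (by fun_prop) hmf, ← real_inner_self_eq_norm_sq, L2.inner_def]
    refine integral_congr_ae (Eventually.of_forall fun ω => ?_)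
    simp [pow_two]
  change P.map f = gaussianReal 0 (‖f‖₊ ^ 2)
  rw [hG.map_eq_gaussianReal, hmf, hv]
  congr 1
  ext
  simp

end Isonormal

/-! ## Continuous modifications -/

section Dyadic

/-- The left end point of the dyadic interval of level `n` that contains `u`. -/
noncomputable def dyadicFloor (n : ℕ) (u : ℝ) : ℝ := (⌊2 ^ n * u⌋₊ : ℝ) / 2 ^ n

theorem abs_sub_dyadicFloor_le {u : ℝ} (hu : 0 ≤ u) (n : ℕ) :
    |u - dyadicFloor n u| ≤ (1 / 2) ^ n := by
  have h1 : (⌊2 ^ n * u⌋₊ : ℝ) ≤ 2 ^ n * u := Nat.floor_le (by positivity)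
  have h2 := Nat.lt_floor_add_one (2 ^ n * u)
  have h3 : u - dyadicFloor n u = (2 ^ n * u - ⌊2 ^ n * u⌋₊) / 2 ^ n := by
    unfold dyadicFloor
    field_simp
  rw [h3, abs_of_nonneg (div_nonneg (by linarith) (by positivity)), div_le_iff₀ (by positivity),
    one_div, inv_pow, inv_mul_cancel₀ (by positivity)]
  linarith

variable {f : ℝ → ℝ} {D : ℕ → ℝ}

/-- If `k` is the index at level `n`, then the index at level `n + 1` is `2k` or `2k + 1`: the point
stays or moves by one dyadic step of the finer level. -/
theorem dist_dyadicFloor_succ_le (hD : ∀ n (k : ℕ), k < 2 ^ n →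
      |f ((k + 1 : ℕ) / 2 ^ n) - f (k / 2 ^ n)| ≤ D n) {u : ℝ} (hu : u ∈ Icc (0 : ℝ) 1) (n : ℕ) :
    dist (f (dyadicFloor n u)) (f (dyadicFloor (n + 1) u)) ≤ D (n + 1) := by
  set k := ⌊2 ^ n * u⌋₊ with hk
  have h0 : (0 : ℝ) ≤ 2 ^ n * u := by have := hu.1; positivity
  have h1 : (k : ℝ) ≤ 2 ^ n * u := Nat.floor_le h0
  have h2 : 2 ^ n * u < k + 1 := Nat.lt_floor_add_one _
  have hl : 2 * k ≤ ⌊2 ^ (n + 1) * u⌋₊ := Nat.le_floor (by push_cast; rw [pow_succ]; linarith)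
  have hr : ⌊2 ^ (n + 1) * u⌋₊ < 2 * k + 2 := by
    rw [Nat.floor_lt (by rw [pow_succ]; linarith)]
    push_cast; rw [pow_succ]; linarith
  have hle : ⌊2 ^ (n + 1) * u⌋₊ ≤ 2 ^ (n + 1) := by
    refine Nat.floor_le_of_le ?_
    push_cast
    exact mul_le_of_le_one_right (by positivity) hu.2
  have e1 : dyadicFloor n u = ((2 * k : ℕ) : ℝ) / 2 ^ (n + 1) := by
    unfold dyadicFloor
    rw [← hk, pow_succ]
    push_cast
    field_simp
  have hDnn : 0 ≤ D (n + 1) := (abs_nonneg _).trans (hD (n + 1) 0 (by positivity))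
  rw [e1]
  unfold dyadicFloor
  rcases (show ⌊2 ^ (n + 1) * u⌋₊ = 2 * k ∨ ⌊2 ^ (n + 1) * u⌋₊ = 2 * k + 1 by lia) with h | h
  · rw [h, dist_self]
    exact hDnn
  · rw [h, dist_comm, Real.dist_eq]
    exact hD (n + 1) (2 * k) (by lia)

/-- Points at distance less than `2⁻ⁿ` lie in the same or in adjacent dyadic intervals of level `n`.
-/
theorem abs_sub_dyadicFloor_le_of_near (hD : ∀ n (k : ℕ), k < 2 ^ n →
      |f ((k + 1 : ℕ) / 2 ^ n) - f (k / 2 ^ n)| ≤ D n) {u v : ℝ} (hu : u ∈ Icc (0 : ℝ) 1)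
    (hv : v ∈ Icc (0 : ℝ) 1) (huv : u ≤ v) (n : ℕ) (h : v - u < (1 / 2) ^ n) :
    |f (dyadicFloor n v) - f (dyadicFloor n u)| ≤ D n := by
  have hDnn : 0 ≤ D n := (abs_nonneg _).trans (hD n 0 (by positivity))
  have h0 : (0 : ℝ) ≤ 2 ^ n * u := by have := hu.1; positivity
  have h0' : (0 : ℝ) ≤ 2 ^ n * v := by have := hv.1; positivity
  have hl : ⌊2 ^ n * u⌋₊ ≤ ⌊2 ^ n * v⌋₊ := Nat.floor_mono (by gcongr)
  have hr : ⌊2 ^ n * v⌋₊ < ⌊2 ^ n * u⌋₊ + 2 := by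
    rw [Nat.floor_lt h0']
    have := Nat.lt_floor_add_one (2 ^ n * u)
    have h4 : (2 : ℝ) ^ n * (v - u) < 1 := by
      rw [one_div, inv_pow] at h
      calc (2 : ℝ) ^ n * (v - u) < 2 ^ n * (2 ^ n)⁻¹ := by gcongr
        _ = 1 := mul_inv_cancel₀ (by positivity)
    push_cast
    linarith
  have hle : ⌊2 ^ n * v⌋₊ ≤ 2 ^ n := by
    refine Nat.floor_le_of_le ?_
    push_cast
    exact mul_le_of_le_one_right (by positivity) hv.2
  unfold dyadicFloor
  rcases (show ⌊2 ^ n * v⌋₊ = ⌊2 ^ n * u⌋₊ ∨ ⌊2 ^ n * v⌋₊ = ⌊2 ^ n * u⌋₊ + 1 by lia) with h | h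
  · simpa [h] using hDnn
  · rw [h]
    exact hD n _ (by lia)

/-- If the dyadic increments of `f` are summable, the values of `f` at the dyadic points extend
continuously to the unit interval. -/
theorem exists_continuous_dyadic_limit (hD : ∀ n (k : ℕ), k < 2 ^ n →
      |f ((k + 1 : ℕ) / 2 ^ n) - f (k / 2 ^ n)| ≤ D n) (hs : Summable D) :
    ∃ g : ℝ → ℝ, ContinuousOn g (Icc 0 1) ∧
      ∀ u ∈ Icc (0 : ℝ) 1, Tendsto (fun n => f (dyadicFloor n u)) atTop (𝓝 (g u)) := by
  have hs' : Summable fun n => D (n + 1) := (summable_nat_add_iff 1).2 hs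
  have hex : ∀ u : ℝ, ∃ y, u ∈ Icc (0 : ℝ) 1 →
      Tendsto (fun n => f (dyadicFloor n u)) atTop (𝓝 y) := by
    intro u
    by_cases hu : u ∈ Icc (0 : ℝ) 1
    · obtain ⟨y, hy⟩ := cauchySeq_tendsto_of_complete
        (cauchySeq_of_dist_le_of_summable _ (dist_dyadicFloor_succ_le hD hu) hs')
      exact ⟨y, fun _ => hy⟩
    · exact ⟨0, fun h => absurd h hu⟩
  choose g hg using hex
  have hdist : ∀ u ∈ Icc (0 : ℝ) 1, ∀ n, dist (f (dyadicFloor n u)) (g u) ≤ ∑' m, D (n + m + 1) :=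
    fun u hu n => dist_le_tsum_of_dist_le_of_tendsto _ (dist_dyadicFloor_succ_le hD hu) hs'
      (hg u hu) n
  have htail : Tendsto (fun n => ∑' m, D (n + m + 1)) atTop (𝓝 0) := by
    have := tendsto_sum_nat_add fun n => D (n + 1)
    refine this.congr fun n => tsum_congr fun m => ?_
    congr 1
    ring
  have htot : Tendsto (fun n => (∑' m, D (n + m + 1)) + D n + ∑' m, D (n + m + 1)) atTop (𝓝 0) := by
    simpa using (htail.add hs.tendsto_atTop_zero).add htail
  refine ⟨g, ?_, hg⟩
  -- From `g u` to the dyadic point below `u`, one step of level `n`, and back up to `g v`: two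
  -- tails of the series and one increment.
  have hosc : ∀ n, ∀ u ∈ Icc (0 : ℝ) 1, ∀ v ∈ Icc (0 : ℝ) 1, u ≤ v → v - u < (1 / 2) ^ n →
      dist (g u) (g v) ≤ (∑' m, D (n + m + 1)) + D n + ∑' m, D (n + m + 1) := by
    intro n u hu v hv huv h
    have h1 := hdist u hu n
    have h2 := hdist v hv n
    have h3 := abs_sub_dyadicFloor_le_of_near hD hu hv huv n h
    rw [← Real.dist_eq, dist_comm] at h3
    rw [dist_comm] at h1
    exact (dist_triangle4 _ _ _ _).trans (by linarith)
  rw [Metric.continuousOn_iff]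
  intro v hv ε hε
  obtain ⟨n, hn⟩ := (htot.eventually_lt_const hε).exists
  refine ⟨(1 / 2) ^ n, by positivity, fun u hu huv => ?_⟩
  rw [Real.dist_eq] at huv
  rcases le_total u v with h | h
  · rw [abs_sub_comm, abs_of_nonneg (by linarith)] at huv
    exact (hosc n u hu v hv h huv).trans_lt hn
  · rw [abs_of_nonneg (by linarith)] at huv
    rw [dist_comm]
    exact (hosc n v hv u hu h huv).trans_lt hn

end Dyadic

/-! ### Kolmogorov's continuity criterion -/

section Modification

variable {Ω : Type*} [MeasurableSpace Ω] {P : Measure Ω}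

/-- The fourth powers of the `2ⁿ` increments of level `n` have total expectation at most `C 2ⁿ 4⁻ⁿ =
C 2⁻ⁿ`. Weighted by `(4/3)ⁿ` this is still summable, with ratio `2/3`, so the weighted sums are
almost surely summable, and they control the increments themselves. -/
theorem ae_summable_dyadic_increments {X : ℝ → Ω → ℝ} (hX : ∀ s, Measurable (X s)) {C : ℝ≥0∞}
    (hC : C ≠ ∞) (hmom : ∀ u v, ∫⁻ ω, ‖X u ω - X v ω‖ₑ ^ 4 ∂P ≤ C * ENNReal.ofReal ((u - v) ^ 2)) :
    ∀ᵐ ω ∂P, ∃ D : ℕ → ℝ, Summable D ∧ ∀ n (k : ℕ), k < 2 ^ n →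
      |X ((k + 1 : ℕ) / 2 ^ n) ω - X (k / 2 ^ n) ω| ≤ D n := by
  set S : ℕ → Ω → ℝ≥0∞ := fun n ω => ∑ k ∈ Finset.range (2 ^ n),
    ‖X ((k + 1 : ℕ) / 2 ^ n) ω - X (k / 2 ^ n) ω‖ₑ ^ 4 with hS
  have hSm : ∀ n, Measurable (S n) := fun n => by
    refine Finset.measurable_fun_sum _ fun k _ => ?_
    exact (((hX _).sub (hX _)).enorm).pow_const 4
  have hES : ∀ n, ∫⁻ ω, S n ω ∂P ≤ C * ENNReal.ofReal ((1 / 2) ^ n) := by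
    intro n
    simp only [hS]
    have hm : ∀ k : ℕ, Measurable fun ω => ‖X ((k + 1 : ℕ) / 2 ^ n) ω - X (k / 2 ^ n) ω‖ₑ ^ 4 :=
      fun k => (((hX _).sub (hX _)).enorm).pow_const 4
    rw [lintegral_finsetSum _ fun k _ => hm k]
    calc _ ≤ ∑ k ∈ Finset.range (2 ^ n), C * ENNReal.ofReal ((1 / 4) ^ n) := by
          refine Finset.sum_le_sum fun k _ => (hmom _ _).trans_eq ?_
          congr 2
          push_cast
          rw [← sub_div, add_sub_cancel_left, div_pow, div_pow, one_pow, ← pow_mul, mul_comm n 2,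
            pow_mul, one_pow]
          norm_num
      _ = C * ENNReal.ofReal ((1 / 2) ^ n) := by
          rw [Finset.sum_const, Finset.card_range, nsmul_eq_mul, mul_left_comm]
          congr 1
          rw [← ENNReal.ofReal_natCast, ← ENNReal.ofReal_mul (by positivity)]
          congr 1
          push_cast
          rw [← mul_pow]
          norm_num
  have hsum : ∫⁻ ω, ∑' n, ENNReal.ofReal ((4 / 3) ^ n) * S n ω ∂P ≠ ∞ := by
    rw [lintegral_tsum fun n => ((hSm n).const_mul _).aemeasurable]
    have hle : ∑' n, ∫⁻ ω, ENNReal.ofReal ((4 / 3) ^ n) * S n ω ∂P ≤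
        ∑' n : ℕ, C * ENNReal.ofReal ((2 / 3) ^ n) := by
      refine ENNReal.tsum_le_tsum fun n => ?_
      rw [lintegral_const_mul _ (hSm n)]
      calc _ ≤ ENNReal.ofReal ((4 / 3) ^ n) * (C * ENNReal.ofReal ((1 / 2) ^ n)) := by
            gcongr
            exact hES n
        _ = C * ENNReal.ofReal ((2 / 3) ^ n) := by
            rw [mul_left_comm, ← ENNReal.ofReal_mul (by positivity), ← mul_pow]
            norm_num
    refine ne_top_of_le_ne_top ?_ hle
    rw [ENNReal.tsum_mul_left, ← ENNReal.ofReal_tsum_of_nonneg (fun n => by positivity)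
      (summable_geometric_of_lt_one (by norm_num) (by norm_num))]
    exact ENNReal.mul_ne_top hC ENNReal.ofReal_ne_top
  have hmeas : Measurable fun ω => ∑' n, ENNReal.ofReal ((4 / 3) ^ n) * S n ω :=
    Measurable.tsum fun n => (hSm n).const_mul _
  filter_upwards [ae_lt_top hmeas hsum] with ω hω
  have hsumm := ENNReal.summable_toReal hω.ne
  -- An increment `x` is either at most `(10/11)ⁿ`, or else `(4/3)ⁿ x³ ≥ 1`, because `4/3 · (10/11)³
  -- = 4000/3993 ≥ 1`, and then `x ≤ (4/3)ⁿ x⁴`. In both cases it is below the sum of the two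
  -- summable terms.
  refine ⟨fun n => (10 / 11) ^ n + (ENNReal.ofReal ((4 / 3) ^ n) * S n ω).toReal,
    (summable_geometric_of_lt_one (by norm_num) (by norm_num)).add hsumm, fun n k hk => ?_⟩
  have hfin : ENNReal.ofReal ((4 / 3) ^ n) * S n ω ≠ ∞ :=
    ne_top_of_le_ne_top hω.ne (ENNReal.le_tsum n)
  set x := |X ((k + 1 : ℕ) / 2 ^ n) ω - X (k / 2 ^ n) ω| with hx
  have hx4 : (4 / 3) ^ n * x ^ 4 ≤ (ENNReal.ofReal ((4 / 3) ^ n) * S n ω).toReal := by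
    rw [← ENNReal.ofReal_le_iff_le_toReal hfin, ENNReal.ofReal_mul (by positivity)]
    gcongr
    have : ENNReal.ofReal (x ^ 4) = ‖X ((k + 1 : ℕ) / 2 ^ n) ω - X (k / 2 ^ n) ω‖ₑ ^ 4 := by
      rw [Real.enorm_eq_ofReal_abs, ENNReal.ofReal_pow (abs_nonneg _)]
    rw [this]
    exact Finset.single_le_sum (f := fun k : ℕ => ‖X ((k + 1 : ℕ) / 2 ^ n) ω - X (k / 2 ^ n) ω‖ₑ ^ 4)
      (fun _ _ => zero_le) (Finset.mem_range.2 hk)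
  have hxnn : 0 ≤ x := abs_nonneg _
  rcases le_total x ((10 / 11) ^ n) with h | h
  · have : 0 ≤ (ENNReal.ofReal ((4 / 3) ^ n) * S n ω).toReal := ENNReal.toReal_nonneg
    linarith
  · have h3 : 1 ≤ (4 / 3 : ℝ) ^ n * x ^ 3 := by
      calc (1 : ℝ) ≤ (4 / 3 * (10 / 11) ^ 3) ^ n := one_le_pow₀ (by norm_num)
        _ = (4 / 3) ^ n * ((10 / 11) ^ n) ^ 3 := by rw [mul_pow, ← pow_mul, ← pow_mul, mul_comm 3 n]
        _ ≤ _ := by gcongr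
    have h4 : x ≤ (4 / 3) ^ n * x ^ 4 := by
      calc x = 1 * x := (one_mul x).symm
        _ ≤ ((4 / 3 : ℝ) ^ n * x ^ 3) * x := by gcongr
        _ = _ := by ring
    have : (0 : ℝ) ≤ (10 / 11) ^ n := by positivity
    linarith

/-- **Kolmogorov's continuity criterion**, for exponents `4` and `2`, on the unit interval. -/
theorem exists_continuous_modification {X : ℝ → Ω → ℝ} (hX : ∀ s, Measurable (X s)) {C : ℝ≥0∞}
    (hC : C ≠ ∞) (hmom : ∀ u v, ∫⁻ ω, ‖X u ω - X v ω‖ₑ ^ 4 ∂P ≤ C * ENNReal.ofReal ((u - v) ^ 2)) :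
    ∃ Y : ℝ → Ω → ℝ, (∀ u, Measurable (Y u)) ∧ (∀ ω, ContinuousOn (fun u => Y u ω) (Icc 0 1)) ∧
      ∀ u ∈ Icc (0 : ℝ) 1, Y u =ᵐ[P] X u := by
  have hae := ae_summable_dyadic_increments hX hC hmom
  -- The exceptional set is enlarged to a measurable null set, on which the modification is put
  -- equal to `0`; this keeps it measurable.
  obtain ⟨A, hA, hAm, hAnull⟩ := exists_measurable_superset_of_null (ae_iff.1 hae)
  have hgood : ∀ ω ∉ A, ∃ g : ℝ → ℝ, ContinuousOn g (Icc 0 1) ∧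
      ∀ u ∈ Icc (0 : ℝ) 1, Tendsto (fun n => X (dyadicFloor n u) ω) atTop (𝓝 (g u)) := by
    intro ω hω
    have : ∃ D : ℕ → ℝ, Summable D ∧ ∀ n (k : ℕ), k < 2 ^ n →
      |X ((k + 1 : ℕ) / 2 ^ n) ω - X (k / 2 ^ n) ω| ≤ D n := by
        by_contra hcon
        exact hω (hA hcon)
    obtain ⟨D, hs, hD⟩ := this
    exact exists_continuous_dyadic_limit (f := fun u => X u ω) hD hs
  choose! g hgc hgt using hgood
  classical
  set Y : ℝ → Ω → ℝ := fun u ω => if u ∈ Icc (0 : ℝ) 1 then Aᶜ.indicator (fun ω => g ω u) ω else 0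
    with hY
  have hYt : ∀ u ∈ Icc (0 : ℝ) 1, ∀ ω, Tendsto (fun n => Aᶜ.indicator (X (dyadicFloor n u)) ω) atTop
      (𝓝 (Y u ω)) := by
    intro u hu ω
    simp only [hY, if_pos hu]
    by_cases hω : ω ∈ A
    · simp [hω]
    · simpa [hω] using hgt ω hω u hu
  refine ⟨Y, fun u => ?_, fun ω => ?_, fun u hu => ?_⟩
  · by_cases hu : u ∈ Icc (0 : ℝ) 1
    · exact measurable_of_tendsto_metrizable (fun n => (hX (dyadicFloor n u)).indicator hAm.compl)
        (tendsto_pi_nhds.2 (hYt u hu))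
    · simp only [hY, if_neg hu]
      exact measurable_const
  · by_cases hω : ω ∈ A
    · refine continuousOn_const (c := (0 : ℝ)) |>.congr fun u hu => ?_
      simp [hY, hω]
    · refine (hgc ω hω).congr fun u hu => ?_
      simp only [hY, if_pos hu]
      simp [hω]
  -- The moment bound gives `X (dyadicFloor n u) → X u` in `L⁴`, while the same sequence converges
  -- pointwise to `Y u` off `A`; Fatou's lemma identifies the limits.
  · have hlim : Tendsto (fun n => ∫⁻ ω, ‖X (dyadicFloor n u) ω - X u ω‖ₑ ^ 4 ∂P) atTop (𝓝 0) := by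
      refine tendsto_of_tendsto_of_tendsto_of_le_of_le tendsto_const_nhds ?_ (fun _ => zero_le)
        (fun n => hmom _ _)
      have h1 : Tendsto (fun n => (dyadicFloor n u - u) ^ 2) atTop (𝓝 0) := by
        have : Tendsto (fun n => |u - dyadicFloor n u|) atTop (𝓝 0) :=
          squeeze_zero (fun _ => abs_nonneg _) (abs_sub_dyadicFloor_le hu.1)
            (tendsto_pow_atTop_nhds_zero_of_lt_one (by norm_num) (by norm_num))
        simpa [abs_sub_comm u] using this.pow 2
      have h2 := ENNReal.Tendsto.const_mul (a := C) (ENNReal.tendsto_ofReal h1) (Or.inr hC)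
      simpa using h2
    have hmeas : ∀ n, Measurable fun ω => ‖X (dyadicFloor n u) ω - X u ω‖ₑ ^ 4 := fun n =>
      (((hX _).sub (hX _)).enorm).pow_const 4
    have hfatou : ∫⁻ ω, liminf (fun n => ‖X (dyadicFloor n u) ω - X u ω‖ₑ ^ 4) atTop ∂P = 0 := by
      refine le_antisymm ((lintegral_liminf_le hmeas).trans_eq hlim.liminf_eq) zero_le
    rw [lintegral_eq_zero_iff (.liminf hmeas)] at hfatou
    filter_upwards [hfatou, measure_eq_zero_iff_ae_notMem.1 hAnull] with ω h1 hω
    have h2 : Tendsto (fun n => ‖X (dyadicFloor n u) ω - X u ω‖ₑ ^ 4) atTop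
        (𝓝 (‖Y u ω - X u ω‖ₑ ^ 4)) := by
      have h3 := hYt u hu ω
      simp only [indicator_of_mem (mem_compl hω)] at h3
      exact (ENNReal.continuous_pow 4).tendsto _ |>.comp
        ((continuous_enorm.tendsto _).comp (h3.sub_const (X u ω)))
    rw [h2.liminf_eq] at h1
    simpa [sub_eq_zero] using h1

end Modification

/-! ## Existence of Brownian motion -/

section Gaussian

variable {Ω : Type*} [MeasurableSpace Ω] {P : Measure Ω}
  {H : Type*} [NormedAddCommGroup H] [InnerProductSpace ℝ H] {Φ : H →ₗᵢ[ℝ] Lp ℝ 2 P}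

/-- A linear functional of finitely many `Φ hᵢ` is almost surely `Φ` of a linear combination of the
`hᵢ`, hence Gaussian. -/
theorem isGaussianProcess_isonormal (hΦ : ∀ h, P.map (Φ h) = gaussianReal 0 (‖h‖₊ ^ 2)) :
    IsGaussianProcess (fun h ω => Φ h ω) P where
  hasGaussianLaw I := by
    classical
    refine ⟨isGaussian_of_map_eq_gaussianReal fun L => ?_⟩
    set g : H := ∑ i : I, L (Pi.single i 1) • (i : H) with hg
    refine ⟨0, ‖g‖₊ ^ 2, ?_⟩
    rw [← hΦ, Measure.map_map (by fun_prop) (measurable_pi_lambda _ fun i => by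
      exact (Lp.stronglyMeasurable (Φ i)).measurable)]
    refine Measure.map_congr ?_
    have h1 : Φ g = ∑ i : I, L (Pi.single i 1) • Φ i := by
      rw [hg, map_sum]
      simp
    rw [h1]
    have h2 : ∀ᵐ ω ∂P, ∀ i : I, (L (Pi.single i 1) • Φ i : Lp ℝ 2 P) ω = L (Pi.single i 1) * Φ i ω :=
      ae_all_iff.2 fun i => by
        filter_upwards [Lp.coeFn_smul (L (Pi.single i 1)) (Φ i)] with ω hω
        rw [hω, Pi.smul_apply, smul_eq_mul]
    filter_upwards [Lp.coeFn_finsetSum Finset.univ (fun i : I => L (Pi.single i 1) • Φ i), h2]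
      with ω h3 h4
    rw [h3, Finset.sum_apply, Function.comp_apply]
    refine (LinearMap.pi_apply_eq_sum_univ (L : (I → ℝ) →ₗ[ℝ] ℝ) _).trans
      (Finset.sum_congr rfl fun i _ => ?_)
    rw [h4, smul_eq_mul, mul_comm]
    congr 1
    simp only [ContinuousLinearMap.coe_coe]
    congr 1
    ext j
    simp [Pi.single_apply, eq_comm]

theorem integral_isonormal (hΦ : ∀ h, P.map (Φ h) = gaussianReal 0 (‖h‖₊ ^ 2)) (h : H) :
    ∫ ω, Φ h ω ∂P = 0 := by
  have := integral_map (μ := P) (φ := Φ h) (f := id) (by fun_prop) (by fun_prop)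
  simp only [id] at this
  rw [hΦ, integral_id_gaussianReal] at this
  exact this.symm

theorem covariance_congr_ae {X X' Y Y' : Ω → ℝ} (hX : X =ᵐ[P] X') (hY : Y =ᵐ[P] Y') :
    cov[X, Y; P] = cov[X', Y'; P] := by
  unfold covariance
  rw [integral_congr_ae hX, integral_congr_ae hY]
  refine integral_congr_ae ?_
  filter_upwards [hX, hY] with ω h1 h2
  rw [h1, h2]

theorem covariance_isonormal [IsProbabilityMeasure P]
    (hΦ : ∀ h, P.map (Φ h) = gaussianReal 0 (‖h‖₊ ^ 2)) (h g : H) :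
    cov[Φ h, Φ g; P] = inner ℝ h g := by
  rw [covariance_eq_sub (Lp.memLp _) (Lp.memLp _), integral_isonormal hΦ, zero_mul, sub_zero,
    ← Φ.inner_map_map, L2.inner_def]
  refine integral_congr_ae (Eventually.of_forall fun ω => ?_)
  simp [mul_comm]

/-- `Φ h` has the law of `‖h‖` times a standard normal variable. -/
theorem lintegral_pow_four_isonormal (hΦ : ∀ h, P.map (Φ h) = gaussianReal 0 (‖h‖₊ ^ 2)) (h : H) :
    ∫⁻ ω, ‖Φ h ω‖ₑ ^ 4 ∂P = (∫⁻ x, ‖x‖ₑ ^ 4 ∂gaussianReal 0 1) * ‖h‖ₑ ^ 4 := by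
  have h1 := lintegral_map' (μ := P) (g := Φ h) (f := fun x => ‖x‖ₑ ^ 4) (by fun_prop) (by fun_prop)
  have h2 : gaussianReal 0 (‖h‖₊ ^ 2) = (gaussianReal 0 1).map (‖h‖ * ·) := by
    rw [gaussianReal_map_const_mul]
    congr 1
    · simp
    · ext; simp
  rw [← h1, hΦ, h2, lintegral_map (by fun_prop) (by fun_prop),
    ← lintegral_mul_const _ (by fun_prop)]
  refine lintegral_congr fun x => ?_
  rw [enorm_mul, mul_pow, mul_comm, enorm_norm]

end Gaussian

/-! ### Indicators of time intervals and the Brownian covariance -/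

section Intervals

variable {k : ℕ}

theorem measure_interval_ne_top (t : ℝ) (j : Fin k) (s : ℝ) :
    ((Measure.count : Measure (Fin k)).prod (volume : Measure ℝ)) ({j} ×ˢ Ioc t s) ≠ ∞ := by
  rw [Measure.prod_prod]
  simp

/-- The function `1` on `{j} × (t, s]`, as an element of an `L²`-space. -/
noncomputable def intervalVec (t : ℝ) (j : Fin k) (s : ℝ) :
    Lp ℝ 2 ((Measure.count : Measure (Fin k)).prod (volume : Measure ℝ)) :=
  indicatorConstLp 2 (s := {j} ×ˢ Ioc t s) (by measurability)
    (measure_interval_ne_top t j s) 1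

/-- For `s, r ≥ t` these are the covariances of `k` independent Brownian motions that start at time
`t`. -/
theorem inner_intervalVec (t : ℝ) (i j : Fin k) (s r : ℝ) :
    inner ℝ (intervalVec t i s) (intervalVec t j r) =
      if i = j then max 0 (min s r - t) else 0 := by
  unfold intervalVec
  rw [L2.real_inner_indicatorConstLp_one_indicatorConstLp_one _ _ (measure_interval_ne_top t i s)
    (measure_interval_ne_top t j r), prod_inter_prod, Ioc_inter_Ioc,
    Measure.real, Measure.prod_prod]
  split_ifs with h
  · subst h
    simp [ENNReal.toReal_ofReal', max_comm]
  · rw [singleton_inter_eq_empty.2 (by simpa using h)]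
    simp

theorem norm_sq_intervalVec_sub_le (t : ℝ) (j : Fin k) (s r : ℝ) :
    ‖intervalVec t j s - intervalVec t j r‖ ^ 2 ≤ |s - r| := by
  rw [← real_inner_self_eq_norm_sq, real_inner_sub_sub_self, inner_intervalVec, inner_intervalVec,
    inner_intervalVec, if_pos rfl, if_pos rfl, if_pos rfl, min_self, min_self]
  rcases le_total s r with h | h
  · rw [min_eq_left h, abs_of_nonpos (by linarith)]
    rcases le_total 0 (s - t) with h1 | h1 <;> rcases le_total 0 (r - t) with h2 | h2 <;>
      simp only [max_eq_left, max_eq_right, h1, h2] <;> linarith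
  · rw [min_eq_right h, abs_of_nonneg (by linarith)]
    rcases le_total 0 (s - t) with h1 | h1 <;> rcases le_total 0 (r - t) with h2 | h2 <;>
      simp only [max_eq_left, max_eq_right, h1, h2] <;> linarith

end Intervals

/-- A `k`-dimensional Brownian motion on `[t,T]`, extended by constants. -/
structure IsBrownianOn {Ω : Type*} [MeasurableSpace Ω] (P : Measure Ω) (t T : ℝ) {k : ℕ}
    (W : ℝ → Ω → Fin k → ℝ) : Prop where
  measurable : ∀ s, Measurable (W s)
  continuous : ∀ ω, Continuous fun s => W s ω
  const_left : ∀ ω, ∀ s ≤ t, W s ω = W t ω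
  const_right : ∀ ω, ∀ s ≥ T, W s ω = W T ω
  zero : ∀ᵐ ω ∂P, W t ω = 0
  law : ∀ s r, t ≤ s → s ≤ r → r ≤ T → P.map (fun ω => W r ω - W s ω) =
    Measure.pi (fun _ : Fin k => gaussianReal 0 (r - s).toNNReal)
  indep : ∀ s r, t ≤ s → s ≤ r → r ≤ T →
    IndepFun (fun ω => W r ω - W s ω) (fun ω (q : Iic s) => W q ω) P

/-- The coordinates are continuous modifications of `Φ` applied to `intervalVec`. Gaussianity bounds
the fourth moment of an increment by a multiple of the squared time difference, as Kolmogorov's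
criterion asks; `τ` carries `[0,1]` to `[t,T]`. The isonormal map is kept in the statement, since
joint laws are computed through it. -/
theorem exists_brownian_coordinates (k : ℕ) {t T : ℝ} (htT : t ≤ T) :
    ∃ (Ω : Type) (_ : MeasurableSpace Ω) (P : Measure Ω) (_ : IsProbabilityMeasure P)
      (Φ : Lp ℝ 2 ((Measure.count : Measure (Fin k)).prod (volume : Measure ℝ)) →ₗᵢ[ℝ] Lp ℝ 2 P)
      (W : ℝ → Ω → Fin k → ℝ), (∀ h, P.map (Φ h) = gaussianReal 0 (‖h‖₊ ^ 2)) ∧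
      (∀ s, Measurable (W s)) ∧ (∀ ω, Continuous fun s => W s ω) ∧
      (∀ ω, ∀ s ≤ t, W s ω = W t ω) ∧ (∀ ω, ∀ s ≥ T, W s ω = W T ω) ∧
      ∀ s ∈ Icc t T, ∀ j, (fun ω => W s ω j) =ᵐ[P] Φ (intervalVec t j s) := by
  obtain ⟨Ω, mΩ, P, hP, Φ, hΦ⟩ := exists_isonormal
    (Lp ℝ 2 ((Measure.count : Measure (Fin k)).prod (volume : Measure ℝ)))
  set τ : ℝ → ℝ := fun u => t + u * (T - t) with hτ
  have hC : (∫⁻ x, ‖x‖ₑ ^ 4 ∂gaussianReal 0 1) * ENNReal.ofReal ((T - t) ^ 2) ≠ ∞ := by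
    refine ENNReal.mul_ne_top ?_ ENNReal.ofReal_ne_top
    have := (memLp_id_gaussianReal (μ := 0) (v := 1) 4).2
    have h4 := lintegral_rpow_enorm_lt_top_of_eLpNorm_lt_top (by norm_num) (by norm_num) this
    simpa using h4.ne
  have hmod : ∀ j : Fin k, ∃ Y : ℝ → Ω → ℝ, (∀ u, Measurable (Y u)) ∧
      (∀ ω, ContinuousOn (fun u => Y u ω) (Icc 0 1)) ∧
      ∀ u ∈ Icc (0 : ℝ) 1, Y u =ᵐ[P] Φ (intervalVec t j (τ u)) := by
    intro j
    refine exists_continuous_modification (X := fun u => Φ (intervalVec t j (τ u)))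
      (fun u => (Lp.stronglyMeasurable _).measurable) hC fun u v => ?_
    have h1 : ∫⁻ ω, ‖Φ (intervalVec t j (τ u)) ω - Φ (intervalVec t j (τ v)) ω‖ₑ ^ 4 ∂P =
        ∫⁻ ω, ‖Φ (intervalVec t j (τ u) - intervalVec t j (τ v)) ω‖ₑ ^ 4 ∂P := by
      refine lintegral_congr_ae ?_
      rw [map_sub]
      filter_upwards [Lp.coeFn_sub (Φ (intervalVec t j (τ u))) (Φ (intervalVec t j (τ v)))]
        with ω hω
      rw [hω, Pi.sub_apply]
    rw [h1, lintegral_pow_four_isonormal hΦ, mul_assoc, ← ENNReal.ofReal_mul (by positivity)]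
    gcongr
    rw [← ofReal_norm, ← ENNReal.ofReal_pow (norm_nonneg _)]
    refine ENNReal.ofReal_le_ofReal ?_
    have h2 := norm_sq_intervalVec_sub_le t j (τ u) (τ v)
    have h3 : |τ u - τ v| = (T - t) * |u - v| := by
      rw [hτ]
      simp only
      rw [show t + u * (T - t) - (t + v * (T - t)) = (T - t) * (u - v) by ring, abs_mul,
        abs_of_nonneg (sub_nonneg.2 htT)]
    rw [h3] at h2
    calc _ = (‖intervalVec t j (τ u) - intervalVec t j (τ v)‖ ^ 2) ^ 2 := by ring
      _ ≤ ((T - t) * |u - v|) ^ 2 := by gcongr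
      _ = _ := by rw [mul_pow, sq_abs]
  choose Y hYm hYc hYe using hmod
  -- The inverse of `τ`, frozen outside `[t,T]`. If `t = T` the quotient is `0` by the convention
  -- for division, so `ρ` vanishes and `τ (ρ t) = t` persists.
  set ρ : ℝ → ℝ := fun s => max 0 (min ((s - t) / (T - t)) 1) with hρ
  have hρmem : ∀ s, ρ s ∈ Icc (0 : ℝ) 1 := fun s =>
    ⟨le_max_left _ _, max_le zero_le_one (min_le_right _ _)⟩
  have hρc : Continuous ρ := by fun_prop
  refine ⟨Ω, mΩ, P, hP, Φ, fun s ω j => Y j (ρ s) ω, hΦ, fun s => ?_, fun ω => ?_, fun ω s hs => ?_,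
    fun ω s hs => ?_, fun s hs j => ?_⟩
  · exact measurable_pi_lambda _ fun j => hYm j _
  · exact continuous_pi fun j => (hYc j ω).comp_continuous hρc hρmem
  · have : ρ s = ρ t := by
      simp only [hρ, sub_self, zero_div]
      rw [min_eq_left, max_eq_left] <;>
        first
          | simp
          | exact div_nonpos_of_nonpos_of_nonneg (by linarith) (by linarith)
          | exact (div_nonpos_of_nonpos_of_nonneg (by linarith) (by linarith)).trans zero_le_one
    simp only [this]
  · have : ρ s = ρ T := by
      rcases htT.eq_or_lt with h | h
      · subst h; simp [hρ]
      · have h1 : 1 ≤ (s - t) / (T - t) := by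
          rw [one_le_div (by linarith)]; linarith
        simp only [hρ]
        rw [min_eq_right h1, div_self (by linarith), min_self]
    simp only [this]
  · refine (hYe j (ρ s) (hρmem s)).trans (Eventually.of_forall fun ω => ?_)
    have : τ (ρ s) = s := by
      rcases htT.eq_or_lt with h | h
      · subst h
        simp only [hτ]
        linarith [hs.1, hs.2, mul_comm (ρ s) (t - t), sub_self t, zero_mul (ρ s),
          show ρ s * (t - t) = 0 by rw [sub_self, mul_zero]]
      · have h1 : (s - t) / (T - t) ≤ 1 := by rw [div_le_one (by linarith)]; linarith [hs.2]
        have h2 : 0 ≤ (s - t) / (T - t) := div_nonneg (by linarith [hs.1]) (by linarith)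
        simp only [hτ, hρ, min_eq_left h1, max_eq_right h2]
        rw [div_mul_cancel₀ _ (by linarith)]
        ring
    simp only [this]

/-- **Existence of Brownian motion.** -/
theorem exists_isBrownianOn (k : ℕ) {t T : ℝ} (htT : t ≤ T) :
    ∃ (Ω : Type) (_ : MeasurableSpace Ω) (P : Measure Ω) (_ : IsProbabilityMeasure P)
      (W : ℝ → Ω → Fin k → ℝ), IsBrownianOn P t T W := by
  obtain ⟨Ω, mΩ, P, hP, Φ, W, hΦ, hm, hc, hl, hr, hW⟩ := exists_brownian_coordinates k htT
  have hG := isGaussianProcess_isonormal hΦ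
  have hinc : ∀ s ∈ Icc t T, ∀ r ∈ Icc t T, ∀ j, (fun ω => W r ω j - W s ω j) =ᵐ[P]
      Φ (intervalVec t j r - intervalVec t j s) := by
    intro s hs r hr' j
    rw [map_sub]
    filter_upwards [hW s hs j, hW r hr' j,
      Lp.coeFn_sub (Φ (intervalVec t j r)) (Φ (intervalVec t j s))] with ω h1 h2 h3
    rw [h3, Pi.sub_apply, ← h1, ← h2]
  have hz : ∀ j : Fin k, intervalVec t j t = 0 := fun j => by
    rw [← norm_eq_zero, ← sq_eq_zero_iff, ← real_inner_self_eq_norm_sq, inner_intervalVec]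
    simp
  refine ⟨Ω, mΩ, P, hP, W, hm, hc, hl, hr, ?_, fun s r hts hsr hrT => ?_, fun s r hts hsr hrT => ?_⟩
  · have : ∀ᵐ ω ∂P, ∀ j, W t ω j = 0 := ae_all_iff.2 fun j => by
      have h1 := hW t ⟨le_rfl, htT⟩ j
      rw [hz, map_zero] at h1
      filter_upwards [h1, Lp.coeFn_zero ℝ 2 P] with ω h2 h3
      rw [h2, h3, Pi.zero_apply]
    filter_upwards [this] with ω hω using funext hω
  · have hs : s ∈ Icc t T := ⟨hts, hsr.trans hrT⟩
    have hr' : r ∈ Icc t T := ⟨hts.trans hsr, hrT⟩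
    -- For jointly Gaussian coordinates zero covariance gives independence, so the law of the
    -- increment is a product measure.
    have hjoint : HasGaussianLaw (fun ω j => (fun (j : Fin k) ω => W r ω j - W s ω j) j ω) P := by
      have h1 : IsGaussianProcess (fun (j : Fin k) ω => W r ω j - W s ω j) P :=
        (hG.comp_right fun j => intervalVec t j r - intervalVec t j s).congr
          fun j => (hinc s hs r hr' j).symm
      have h2 := (h1.hasGaussianLaw Finset.univ).map
        (ContinuousLinearMap.pi fun j : Fin k => ContinuousLinearMap.proj
          (R := ℝ) (φ := fun _ : (Finset.univ : Finset (Fin k)) => ℝ) ⟨j, Finset.mem_univ j⟩)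
      exact h2
    have hindep := hjoint.iIndepFun_of_covariance_eq_zero fun i j hij => by
      rw [covariance_congr_ae (hinc s hs r hr' i) (hinc s hs r hr' j), covariance_isonormal hΦ]
      simp [inner_sub_left, inner_sub_right, inner_intervalVec, hij]
    have hmeas : ∀ j : Fin k, Measurable fun ω => W r ω j - W s ω j := fun j =>
      ((measurable_pi_apply j).comp (hm r)).sub ((measurable_pi_apply j).comp (hm s))
    have := (iIndepFun_iff_map_fun_eq_pi_map fun j => (hmeas j).aemeasurable).1 hindep
    refine Eq.trans this ?_
    congr 1
    funext j
    rw [Measure.map_congr (hinc s hs r hr' j), hΦ]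
    congr 1
    ext
    push_cast
    rw [← real_inner_self_eq_norm_sq, real_inner_sub_sub_self, inner_intervalVec, inner_intervalVec,
      inner_intervalVec, if_pos rfl, if_pos rfl, if_pos rfl, min_self, min_self, min_eq_right hsr,
      max_eq_right (by linarith), max_eq_right (by linarith), Real.coe_toNNReal _ (by linarith)]
    ring
  · have hs : s ∈ Icc t T := ⟨hts, hsr.trans hrT⟩
    have hr' : r ∈ Icc t T := ⟨hts.trans hsr, hrT⟩
    -- The past also contains times before `t`, where the path is frozen; such a time is replaced by
    -- `max t q`.
    have hq : ∀ q : Iic s, max t q ∈ Icc t T := fun q =>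
      ⟨le_max_left _ _, max_le htT (q.2.trans hs.2)⟩
    have hWq : ∀ (q : Iic s) ω, W q ω = W (max t q) ω := by
      intro q ω
      rcases le_total t (q : ℝ) with h | h
      · rw [max_eq_right h]
      · rw [max_eq_left h]; exact hl ω q h
    -- The increment and the whole past form one Gaussian process. For a past time `p ≤ s` the
    -- covariance is proportional to `(p - t) - (p - t) = 0`, whence independence.
    have h1 : IsGaussianProcess (Sum.elim (fun (j : Fin k) ω => W r ω j - W s ω j)
        (fun (p : Iic s × Fin k) ω => W p.1 ω p.2)) P := by
      refine (hG.comp_right (Sum.elim (fun j => intervalVec t j r - intervalVec t j s)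
        (fun p : Iic s × Fin k => intervalVec t p.2 (max t p.1)))).congr ?_
      rintro (j | p)
      · exact (hinc s hs r hr' j).symm
      · refine (hW _ (hq p.1) p.2).symm.trans (Eventually.of_forall fun ω => ?_)
        simp only [Sum.elim_inr]
        rw [hWq]
    have hmW : ∀ (s : ℝ) (j : Fin k), Measurable fun ω => W s ω j := fun s j =>
      (measurable_pi_apply j).comp (hm s)
    have h2 := h1.indepFun_of_covariance_eq_zero (fun j => ((hmW r j).sub (hmW s j)).aemeasurable)
      (fun p => (hmW _ _).aemeasurable) fun j p => by
        have e : (fun ω => W p.1 ω p.2) =ᵐ[P] Φ (intervalVec t p.2 (max t p.1)) :=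
          EventuallyEq.trans (Eventually.of_forall fun ω => by simp only [hWq])
            (hW _ (hq p.1) p.2)
        rw [covariance_congr_ae (hinc s hs r hr' j) e, covariance_isonormal hΦ, inner_sub_left,
          inner_intervalVec, inner_intervalVec]
        have hps : max t (p.1 : ℝ) ≤ s := max_le hts p.1.2
        rw [min_eq_right hps, min_eq_right (hps.trans hsr), sub_self]
    exact h2.comp (φ := id) (ψ := fun f (q : Iic s) (j : Fin k) => f (q, j)) measurable_id
      (by fun_prop)

/-! ## Doob's maximal inequality in `L²` -/

section Doob

/-- The running maximum of a sequence, and of `0`. -/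
noncomputable def runMax (x : ℕ → ℝ) : ℕ → ℝ
  | 0 => max 0 (x 0)
  | n + 1 => max (runMax x n) (x (n + 1))

theorem runMax_nonneg (x : ℕ → ℝ) (n : ℕ) : 0 ≤ runMax x n := by
  induction n with
  | zero => exact le_max_left _ _
  | succ n ih => exact ih.trans (le_max_left _ _)

theorem le_runMax (x : ℕ → ℝ) {k n : ℕ} (h : k ≤ n) : x k ≤ runMax x n := by
  induction n with
  | zero => obtain rfl : k = 0 := by lia
            exact le_max_right _ _
  | succ n ih =>
    rcases h.eq_or_lt with rfl | h
    · exact le_max_right _ _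
    · exact (ih (by lia)).trans (le_max_left _ _)

/-- The pathwise form of Doob's `L²`-inequality. -/
theorem runMax_sq_le (x : ℕ → ℝ) (n : ℕ) : runMax x n ^ 2 ≤
    2 * (runMax x n * x n - ∑ k ∈ Finset.range n, runMax x k * (x (k + 1) - x k)) := by
  induction n with
  | zero =>
    simp only [runMax, Finset.range_zero, Finset.sum_empty, sub_zero]
    rcases le_total 0 (x 0) with h | h
    · rw [max_eq_right h]; nlinarith
    · rw [max_eq_left h]; simp
  | succ n ih =>
    rw [Finset.sum_range_succ]
    simp only [runMax]
    rcases le_total (x (n + 1)) (runMax x n) with h | h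
    · rw [max_eq_left h]; nlinarith
    · rw [max_eq_right h]; nlinarith [sq_nonneg (x (n + 1) - runMax x n)]

theorem measurable_runMax {Ω : Type*} {F : ℕ → MeasurableSpace Ω} (hF : Monotone F) {X : ℕ → Ω → ℝ}
    (hX : ∀ k, StronglyMeasurable[F k] (X k)) (n : ℕ) :
    StronglyMeasurable[F n] fun ω => runMax (fun k => X k ω) n := by
  induction n with
  | zero =>
    exact (Measurable.max (mδ := F 0) measurable_const (hX 0).measurable).stronglyMeasurable
  | succ n ih =>
    exact (Measurable.max (mδ := F (n + 1)) (ih.mono (hF n.le_succ)).measurable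
      (hX (n + 1)).measurable).stronglyMeasurable

variable {Ω : Type*} {mΩ : MeasurableSpace Ω} {P : Measure Ω}

theorem memLp_runMax {X : ℕ → Ω → ℝ} [IsFiniteMeasure P]
    (hX : ∀ k, MemLp (X k) 2 P) (n : ℕ) : MemLp (fun ω => runMax (fun k => X k ω) n) 2 P := by
  induction n with
  | zero => exact (memLp_const (0 : ℝ)).sup (hX 0)
  | succ n ih => exact ih.sup (hX (n + 1))

/-- On integrating the pathwise inequality the sum disappears, since the running maximum is
measurable with respect to the past. Then `2 A X ≤ A² / 2 + 2 X²` absorbs the mixed term. -/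
theorem integral_runMax_sq_le [IsFiniteMeasure P] {F : ℕ → MeasurableSpace Ω} (hF : Monotone F)
    {X : ℕ → Ω → ℝ} (hXm : ∀ k, StronglyMeasurable[F k] (X k)) (hX : ∀ k, MemLp (X k) 2 P)
    (horth : ∀ k, ∀ Y : Ω → ℝ, StronglyMeasurable[F k] Y → MemLp Y 2 P →
      ∫ ω, Y ω * (X (k + 1) ω - X k ω) ∂P = 0) (n : ℕ) :
    ∫ ω, runMax (fun k => X k ω) n ^ 2 ∂P ≤ 4 * ∫ ω, X n ω ^ 2 ∂P := by
  set A : ℕ → Ω → ℝ := fun n ω => runMax (fun k => X k ω) n with hA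
  have hAL : ∀ n, MemLp (A n) 2 P := memLp_runMax hX
  have hAX : Integrable (fun ω => A n ω * X n ω) P := (hAL n).integrable_mul (hX n)
  have hinc : ∀ k, Integrable (fun ω => A k ω * (X (k + 1) ω - X k ω)) P := fun k =>
    (hAL k).integrable_mul ((hX (k + 1)).sub (hX k))
  have h1 : ∫ ω, A n ω ^ 2 ∂P ≤ 2 * ∫ ω, A n ω * X n ω ∂P := by
    calc ∫ ω, A n ω ^ 2 ∂P ≤ ∫ ω, 2 * (A n ω * X n ω -
          ∑ k ∈ Finset.range n, A k ω * (X (k + 1) ω - X k ω)) ∂P :=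
          integral_mono (hAL n).integrable_sq
            ((hAX.sub (integrable_finsetSum _ fun k _ => hinc k)).const_mul 2)
            fun ω => runMax_sq_le (fun k => X k ω) n
      _ = 2 * ∫ ω, A n ω * X n ω ∂P := by
          rw [integral_const_mul, integral_sub hAX (integrable_finsetSum _ fun k _ => hinc k),
            integral_finsetSum _ fun k _ => hinc k]
          have : ∀ k ∈ Finset.range n, ∫ ω, A k ω * (X (k + 1) ω - X k ω) ∂P = 0 := fun k _ =>
            horth k _ (measurable_runMax hF hXm k) (hAL k)
          rw [Finset.sum_eq_zero this, sub_zero]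
  have h2 : 2 * ∫ ω, A n ω * X n ω ∂P ≤ 1 / 2 * ∫ ω, A n ω ^ 2 ∂P + 2 * ∫ ω, X n ω ^ 2 ∂P := by
    rw [← integral_const_mul, ← integral_const_mul, ← integral_const_mul,
      ← integral_add ((hAL n).integrable_sq.const_mul _) ((hX n).integrable_sq.const_mul _)]
    refine integral_mono (hAX.const_mul _)
      (((hAL n).integrable_sq.const_mul _).add ((hX n).integrable_sq.const_mul _)) fun ω => ?_
    simp only
    nlinarith [sq_nonneg (A n ω - 2 * X n ω)]
  linarith

theorem lintegral_sq_eq {X : Ω → ℝ} (hX : MemLp X 2 P) :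
    ∫⁻ ω, ‖X ω‖ₑ ^ 2 ∂P = ENNReal.ofReal (∫ ω, X ω ^ 2 ∂P) := by
  rw [ofReal_integral_eq_lintegral_ofReal hX.integrable_sq
    (Eventually.of_forall fun ω => sq_nonneg _)]
  refine lintegral_congr fun ω => ?_
  rw [Real.enorm_eq_ofReal_abs, ← ENNReal.ofReal_pow (abs_nonneg _), sq_abs]

/-- The one-sided bound, with constant `4`, is applied to `X` and to `-X`; the constants add up to
`8`. -/
theorem lintegral_iSup_sq_le_nat [IsFiniteMeasure P] {F : ℕ → MeasurableSpace Ω} (hF : Monotone F)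
    {X : ℕ → Ω → ℝ} (hXm : ∀ k, StronglyMeasurable[F k] (X k)) (hX : ∀ k, MemLp (X k) 2 P)
    (horth : ∀ k, ∀ Y : Ω → ℝ, StronglyMeasurable[F k] Y → MemLp Y 2 P →
      ∫ ω, Y ω * (X (k + 1) ω - X k ω) ∂P = 0) (n : ℕ) :
    ∫⁻ ω, (⨆ k ≤ n, ‖X k ω‖ₑ) ^ 2 ∂P ≤ 8 * ∫⁻ ω, ‖X n ω‖ₑ ^ 2 ∂P := by
  have h1 := integral_runMax_sq_le hF hXm hX horth n
  have h2 := integral_runMax_sq_le (X := fun k ω => -X k ω) hF (fun k => (hXm k).neg)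
    (fun k => (hX k).neg) (fun k Y hY hY' => by
      have := horth k Y hY hY'
      simp only [sub_neg_eq_add]
      rw [← neg_zero, ← this, ← integral_neg]
      exact integral_congr_ae (Eventually.of_forall fun ω => by ring)) n
  simp only [neg_sq] at h2
  have hm1 := memLp_runMax hX n
  have hm2 := memLp_runMax (X := fun k ω => -X k ω) (fun k => (hX k).neg) n
  rw [lintegral_sq_eq (hX n)]
  calc ∫⁻ ω, (⨆ k ≤ n, ‖X k ω‖ₑ) ^ 2 ∂P
      ≤ ∫⁻ ω, ENNReal.ofReal (runMax (fun k => X k ω) n ^ 2 + runMax (fun k => -X k ω) n ^ 2) ∂P := by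
        refine lintegral_mono fun ω => ?_
        set a := runMax (fun k => X k ω) n
        set b := runMax (fun k => -X k ω) n
        have ha : 0 ≤ a := runMax_nonneg _ _
        have hb : 0 ≤ b := runMax_nonneg _ _
        have : (⨆ k ≤ n, ‖X k ω‖ₑ) ≤ ENNReal.ofReal (max a b) := by
          refine iSup₂_le fun k hk => ?_
          rw [Real.enorm_eq_ofReal_abs]
          refine ENNReal.ofReal_le_ofReal (abs_le'.2 ⟨?_, ?_⟩)
          · exact (le_runMax (fun k => X k ω) hk).trans (le_max_left _ _)
          · exact (le_runMax (fun k => -X k ω) hk).trans (le_max_right _ _)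
        refine (pow_le_pow_left' this 2).trans ?_
        rw [← ENNReal.ofReal_pow (le_max_of_le_left ha)]
        refine ENNReal.ofReal_le_ofReal ?_
        rcases le_total a b with h | h
        · rw [max_eq_right h]; nlinarith
        · rw [max_eq_left h]; nlinarith
    _ = ENNReal.ofReal (∫ ω, (runMax (fun k => X k ω) n ^ 2 + runMax (fun k => -X k ω) n ^ 2) ∂P) := by
        exact (ofReal_integral_eq_lintegral_ofReal
          (f := fun ω => runMax (fun k => X k ω) n ^ 2 + runMax (fun k => -X k ω) n ^ 2)
          (hm1.integrable_sq.add hm2.integrable_sq)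
          (Eventually.of_forall fun ω => by positivity)).symm
    _ ≤ 8 * ENNReal.ofReal (∫ ω, X n ω ^ 2 ∂P) := by
        rw [show (8 : ℝ≥0∞) = ENNReal.ofReal 8 by norm_num, ← ENNReal.ofReal_mul (by norm_num),
          integral_add hm1.integrable_sq hm2.integrable_sq]
        exact ENNReal.ofReal_le_ofReal (by linarith)

/-- **Doob's `L²`-inequality** for a process with continuous paths on `[t,s]` whose increments are
orthogonal to the past. -/
theorem lintegral_iSup_sq_le [IsFiniteMeasure P] {F : Filtration ℝ mΩ} {t s : ℝ} (hts : t ≤ s)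
    {M : ℝ → Ω → ℝ} (hMc : ∀ ω, Continuous fun r => M r ω)
    (hMm : ∀ r ∈ Icc t s, StronglyMeasurable[F r] (M r)) (hM : ∀ r ∈ Icc t s, MemLp (M r) 2 P)
    (horth : ∀ q r, t ≤ q → q ≤ r → r ≤ s → ∀ Y : Ω → ℝ, StronglyMeasurable[F q] Y → MemLp Y 2 P →
      ∫ ω, Y ω * (M r ω - M q ω) ∂P = 0) :
    ∫⁻ ω, (⨆ r ∈ Icc t s, ‖M r ω‖ₑ) ^ 2 ∂P ≤ 8 * ∫⁻ ω, ‖M s ω‖ₑ ^ 2 ∂P := by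
  -- The grid with `n + 1` steps, stopped at `s` so that it is defined for every index; taking `n +
  -- 1` avoids division by zero.
  set x : ℕ → ℕ → ℝ := fun n i => t + (min i (n + 1) : ℕ) * ((s - t) / (n + 1 : ℕ)) with hx
  have hx0 : ∀ n i, t ≤ x n i := fun n i => by
    have : 0 ≤ ((min i (n + 1) : ℕ) : ℝ) * ((s - t) / (n + 1 : ℕ)) :=
      mul_nonneg (by positivity) (div_nonneg (by linarith) (by positivity))
    simp only [hx]; linarith
  have hxmono : ∀ n, Monotone (x n) := fun n i j hij => by
    have : 0 ≤ (s - t) / (n + 1 : ℕ) := div_nonneg (by linarith) (by positivity)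
    simp only [hx]
    gcongr
  have hxlast : ∀ n, x n (n + 1) = s := fun n => by
    simp only [hx, min_self]
    rw [mul_div_cancel₀ _ (by positivity)]
    ring
  have hx1 : ∀ n i, x n i ≤ s := fun n i => by
    rcases le_total i (n + 1) with h | h
    · exact (hxmono n h).trans_eq (hxlast n)
    · have : x n i = x n (n + 1) := by
        simp only [hx]
        rw [min_eq_right h, min_self]
      exact (this.trans (hxlast n)).le
  have hdisc : ∀ n, ∫⁻ ω, (⨆ i ≤ n + 1, ‖M (x n i) ω‖ₑ) ^ 2 ∂P ≤ 8 * ∫⁻ ω, ‖M s ω‖ₑ ^ 2 ∂P := by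
    intro n
    have := lintegral_iSup_sq_le_nat (P := P) (F := fun i => F (x n i)) (X := fun i => M (x n i))
      (fun i j hij => F.mono (hxmono n hij)) (fun i => hMm _ ⟨hx0 n i, hx1 n i⟩)
      (fun i => hM _ ⟨hx0 n i, hx1 n i⟩)
      (fun i Y hY hY' => horth _ _ (hx0 n i) (hxmono n i.le_succ) (hx1 n _) Y hY hY') (n + 1)
    rwa [hxlast] at this
  -- By continuity of the path each value is a limit of grid values, so the full supremum is below
  -- the lower limit of the grid suprema and Fatou's lemma applies.
  have hle : ∀ ω, (⨆ r ∈ Icc t s, ‖M r ω‖ₑ) ^ 2 ≤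
      liminf (fun n => (⨆ i ≤ n + 1, ‖M (x n i) ω‖ₑ) ^ 2) atTop := by
    intro ω
    have hone : ∀ r ∈ Icc t s, ‖M r ω‖ₑ ^ 2 ≤
        liminf (fun n => (⨆ i ≤ n + 1, ‖M (x n i) ω‖ₑ) ^ 2) atTop := by
      intro r hr
      rcases hts.eq_or_lt with h | h
      · have hrs : r = s := le_antisymm hr.2 (h ▸ hr.1)
        refine le_liminf_of_le (by isBoundedDefault) (Eventually.of_forall fun n => ?_)
        gcongr
        exact le_iSup₂_of_le (n + 1) le_rfl (by rw [hxlast, hrs])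
      set i : ℕ → ℕ := fun n => ⌊(r - t) / ((s - t) / (n + 1 : ℕ))⌋₊ with hi
      have hstep : ∀ n : ℕ, 0 < (s - t) / (n + 1 : ℕ) := fun n => div_pos (by linarith) (by positivity)
      have hin : ∀ n, i n ≤ n + 1 := fun n => by
        refine Nat.floor_le_of_le ?_
        rw [div_le_iff₀ (hstep n), mul_div_cancel₀ _ (by positivity)]
        linarith [hr.2]
      have hdist : ∀ n, |x n (i n) - r| ≤ (s - t) / (n + 1 : ℕ) := fun n => by
        have h1 : (i n : ℝ) ≤ (r - t) / ((s - t) / (n + 1 : ℕ)) :=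
          Nat.floor_le (div_nonneg (by linarith [hr.1]) (hstep n).le)
        have h2 : (r - t) / ((s - t) / (n + 1 : ℕ)) < i n + 1 := Nat.lt_floor_add_one _
        rw [le_div_iff₀ (hstep n)] at h1
        rw [div_lt_iff₀ (hstep n)] at h2
        simp only [hx, min_eq_left (hin n)]
        rw [abs_le]
        constructor <;> linarith
      have hlim : Tendsto (fun n => x n (i n)) atTop (𝓝 r) := by
        rw [tendsto_iff_dist_tendsto_zero]
        refine squeeze_zero (fun _ => dist_nonneg) hdist ?_
        have := tendsto_const_div_atTop_nhds_zero_nat (s - t)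
        exact this.comp (tendsto_add_atTop_nat 1)
      have hlim2 : Tendsto (fun n => ‖M (x n (i n)) ω‖ₑ ^ 2) atTop (𝓝 (‖M r ω‖ₑ ^ 2)) :=
        (ENNReal.continuous_pow 2).tendsto _ |>.comp
          ((continuous_enorm.tendsto _).comp (((hMc ω).tendsto r).comp hlim))
      rw [← hlim2.liminf_eq]
      refine liminf_le_liminf (Eventually.of_forall fun n => ?_)
      gcongr
      exact le_iSup₂_of_le (i n) (hin n) le_rfl
    have hsq : ∀ (c : ℝ≥0∞), (∀ r ∈ Icc t s, ‖M r ω‖ₑ ^ 2 ≤ c) → (⨆ r ∈ Icc t s, ‖M r ω‖ₑ) ^ 2 ≤ c := by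
      intro c hc
      have : (⨆ r ∈ Icc t s, ‖M r ω‖ₑ) ≤ c ^ (1 / 2 : ℝ) := iSup₂_le fun r hr => by
        have := ENNReal.rpow_le_rpow (hc r hr) (show (0 : ℝ) ≤ 1 / 2 by norm_num)
        rwa [← ENNReal.rpow_natCast, ← ENNReal.rpow_mul, Nat.cast_ofNat,
          mul_one_div_cancel two_ne_zero, ENNReal.rpow_one] at this
      refine (pow_le_pow_left' this 2).trans_eq ?_
      rw [← ENNReal.rpow_natCast, ← ENNReal.rpow_mul, Nat.cast_ofNat,
        one_div_mul_cancel two_ne_zero, ENNReal.rpow_one]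
    exact hsq _ hone
  calc ∫⁻ ω, (⨆ r ∈ Icc t s, ‖M r ω‖ₑ) ^ 2 ∂P
      ≤ ∫⁻ ω, liminf (fun n => (⨆ i ≤ n + 1, ‖M (x n i) ω‖ₑ) ^ 2) atTop ∂P := lintegral_mono hle
    _ ≤ liminf (fun n => ∫⁻ ω, (⨆ i ≤ n + 1, ‖M (x n i) ω‖ₑ) ^ 2 ∂P) atTop :=
        lintegral_liminf_le fun n => by
          refine Measurable.pow_const (Measurable.iSup fun i => Measurable.iSup fun _ => ?_) 2
          exact ((hMm _ ⟨hx0 n i, hx1 n i⟩).mono (F.le _)).measurable.enorm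
    _ ≤ 8 * ∫⁻ ω, ‖M s ω‖ₑ ^ 2 ∂P := by
        refine (liminf_le_liminf (Eventually.of_forall hdisc)).trans ?_
        simp

end Doob

/-! ## Elementary stochastic integrals -/

section Elementary

variable {Ω : Type*} {mΩ : MeasurableSpace Ω} (P : Measure Ω) (F : Filtration ℝ mΩ)
  (V : ℝ → Ω → ℝ) (t T : ℝ)

/-- The point of `[a,b]` next to `s`. -/
def clamp (a b s : ℝ) : ℝ := max a (min b s)

/-- The integral over `(a,s]` of the integrand `ξ` on `(a,b]` against `V`. -/
def elemPath (V : ℝ → Ω → ℝ) (a b : ℝ) (ξ : Ω → ℝ) (s : ℝ) (ω : Ω) : ℝ :=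
  ξ ω * (V (clamp a b s) ω - V a ω)

/-- The span of the pairs consisting of an elementary integral and its integrand. -/
def elementary : Submodule ℝ ((ℝ → Ω → ℝ) × (ℝ → Lp ℝ 2 P)) :=
  Submodule.span ℝ {p | ∃ (a b : ℝ) (ξ : Ω → ℝ) (hξ : MemLp ξ 2 P), t ≤ a ∧ a ≤ b ∧ b ≤ T ∧
    StronglyMeasurable[F a] ξ ∧ p = (elemPath V a b ξ, (Ioc a b).indicator fun _ => hξ.toLp ξ)}

/-- A continuous adapted process against which elementary processes can be integrated with
`L²`-control of the maximal function. -/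
structure IsIntegrator (C : ℝ≥0) : Prop where
  continuous : ∀ ω, Continuous fun s => V s ω
  adapted : ∀ s ∈ Icc t T, StronglyMeasurable[F s] (V s)
  bound : ∀ p ∈ elementary P F V t T, ∀ s ∈ Icc t T,
    ∫⁻ ω, (⨆ r ∈ Icc t s, ‖p.1 r ω‖ₑ) ^ 2 ∂P ≤ C * ∫⁻ r in Ioc t s, ‖p.2 r‖ₑ ^ 2

/-- A one-dimensional Brownian motion with respect to `F`. -/
structure IsBMWith : Prop where
  continuous : ∀ ω, Continuous fun s => V s ω
  adapted : ∀ s ∈ Icc t T, StronglyMeasurable[F s] (V s)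
  memLp : ∀ s r, t ≤ s → s ≤ r → r ≤ T → MemLp (fun ω => V r ω - V s ω) 2 P
  mean : ∀ s r, t ≤ s → s ≤ r → r ≤ T → ∫ ω, (V r ω - V s ω) ∂P = 0
  var : ∀ s r, t ≤ s → s ≤ r → r ≤ T → ∫ ω, (V r ω - V s ω) ^ 2 ∂P = r - s
  indep : ∀ s r, t ≤ s → s ≤ r → r ≤ T → ∀ Y : Ω → ℝ, StronglyMeasurable[F s] Y →
    IndepFun Y (fun ω => V r ω - V s ω) P

variable {P F V t T}

theorem le_clamp (a b s : ℝ) : a ≤ clamp a b s := le_max_left _ _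

theorem clamp_le {a b : ℝ} (h : a ≤ b) (s : ℝ) : clamp a b s ≤ b := max_le h (min_le_left _ _)

theorem clamp_mono (a b : ℝ) : Monotone (clamp a b) := fun _ _ h =>
  max_le_max le_rfl (min_le_min le_rfl h)

theorem continuous_clamp (a b : ℝ) : Continuous (clamp a b) := by unfold clamp; fun_prop

theorem clamp_of_le {a b s : ℝ} (h : s ≤ a) : clamp a b s = a :=
  max_eq_left ((min_le_right _ _).trans h)

theorem clamp_of_ge {a b s : ℝ} (hab : a ≤ b) (h : b ≤ s) : clamp a b s = b := by
  rw [clamp, min_eq_left h, max_eq_right hab]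

theorem clamp_le_self {a b s : ℝ} (h : a ≤ s) : clamp a b s ≤ s := max_le h (min_le_right _ _)

theorem le_clamp_self {a b s : ℝ} (h : s ≤ b) : s ≤ clamp a b s := by
  rw [clamp, min_eq_right h]; exact le_max_right _ _

theorem Ioc_inter_Ioc_clamp {a b s : ℝ} (h : t ≤ a) : Ioc t s ∩ Ioc a b = Ioc a (clamp a b s) := by
  ext r
  simp only [mem_inter_iff, mem_Ioc, clamp, le_max_iff, le_min_iff]
  constructor
  · rintro ⟨⟨-, h1⟩, h2, h3⟩; exact ⟨h2, Or.inr ⟨h3, h1⟩⟩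
  · rintro ⟨h1, h2 | ⟨h2, h3⟩⟩
    · exact absurd h1 (not_lt.2 h2)
    · exact ⟨⟨h.trans_lt h1, h3⟩, h1, h2⟩

-- Integrals and integrands are handled as pairs: linear statements are proved on generators, and no
-- map from integrands to integrals has to be shown well defined.
@[elab_as_elim]
theorem elementary_induction
    {C : (p : (ℝ → Ω → ℝ) × (ℝ → Lp ℝ 2 P)) → p ∈ elementary P F V t T → Prop}
    (gen : ∀ (a b : ℝ) (ξ : Ω → ℝ) (hξ : MemLp ξ 2 P) (h1 : t ≤ a) (h2 : a ≤ b) (h3 : b ≤ T)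
      (h4 : StronglyMeasurable[F a] ξ),
      C (elemPath V a b ξ, (Ioc a b).indicator fun _ => hξ.toLp ξ)
        (Submodule.subset_span ⟨a, b, ξ, hξ, h1, h2, h3, h4, rfl⟩))
    (zero : C 0 (zero_mem _)) (add : ∀ p q hp hq, C p hp → C q hq → C (p + q) (add_mem hp hq))
    (smul : ∀ (c : ℝ) p hp, C p hp → C (c • p) (Submodule.smul_mem _ c hp))
    {p : (ℝ → Ω → ℝ) × (ℝ → Lp ℝ 2 P)} (hp : p ∈ elementary P F V t T) : C p hp := by
  induction hp using Submodule.span_induction with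
  | mem p h =>
    obtain ⟨a, b, ξ, hξ, h1, h2, h3, h4, rfl⟩ := h
    exact gen a b ξ hξ h1 h2 h3 h4
  | zero => exact zero
  | add p q hp hq h1 h2 => exact add p q hp hq h1 h2
  | smul c p hp h => exact smul c p hp h

theorem elementary_continuous (hV : ∀ ω, Continuous fun s => V s ω)
    {p : (ℝ → Ω → ℝ) × (ℝ → Lp ℝ 2 P)} (hp : p ∈ elementary P F V t T) (ω : Ω) :
    Continuous fun s => p.1 s ω := by
  induction hp using elementary_induction with
  | gen a b ξ hξ h1 h2 h3 h4 =>
    exact continuous_const.mul (((hV ω).comp (continuous_clamp a b)).sub continuous_const)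
  | zero => exact continuous_const
  | add p q _ _ h1 h2 => exact h1.add h2
  | smul c p _ h => exact h.const_smul c

theorem elementary_adapted (hV : ∀ s ∈ Icc t T, StronglyMeasurable[F s] (V s))
    {p : (ℝ → Ω → ℝ) × (ℝ → Lp ℝ 2 P)} (hp : p ∈ elementary P F V t T) {s : ℝ} (hs : s ∈ Icc t T) :
    StronglyMeasurable[F s] (p.1 s) := by
  induction hp using elementary_induction with
  | gen a b ξ hξ h1 h2 h3 h4 =>
    rcases le_total s a with h | h
    · have : elemPath V a b ξ s = fun _ => 0 := by
        funext ω; simp [elemPath, clamp_of_le h]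
      simp only [this]
      exact stronglyMeasurable_const
    · have h5 := clamp_le_self (b := b) h
      exact (h4.mono (F.mono h)).mul
        (((hV _ ⟨h1.trans (le_clamp _ _ _), h5.trans hs.2⟩).mono (F.mono h5)).sub
          ((hV a ⟨h1, h2.trans h3⟩).mono (F.mono h)))
  | zero => exact stronglyMeasurable_const
  | add p q _ _ h1 h2 => exact h1.add h2
  | smul c p _ h => exact h.const_smul c

theorem elementary_integrand {p : (ℝ → Ω → ℝ) × (ℝ → Lp ℝ 2 P)}
    (hp : p ∈ elementary P F V t T) :
    StronglyMeasurable p.2 ∧ ∃ C, ∀ r, ‖p.2 r‖ ≤ C := by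
  induction hp using elementary_induction with
  | gen a b ξ hξ h1 h2 h3 h4 =>
    refine ⟨stronglyMeasurable_const.indicator measurableSet_Ioc, ‖hξ.toLp ξ‖, fun r => ?_⟩
    exact norm_indicator_le_norm_self (fun _ => hξ.toLp ξ) r
  | zero => exact ⟨stronglyMeasurable_const, 0, fun r => by simp⟩
  | add p q _ _ h1 h2 =>
    obtain ⟨h1, C, hC⟩ := h1
    obtain ⟨h2, D, hD⟩ := h2
    exact ⟨h1.add h2, C + D, fun r => norm_add_le_of_le (hC r) (hD r)⟩
  | smul c p _ h =>
    obtain ⟨h1, C, hC⟩ := h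
    refine ⟨h1.const_smul c, ‖c‖ * C, fun r => ?_⟩
    exact (norm_smul_le c (p.2 r)).trans (mul_le_mul_of_nonneg_left (hC r) (norm_nonneg c))

theorem elementary_memLp_integrand {p : (ℝ → Ω → ℝ) × (ℝ → Lp ℝ 2 P)}
    (hp : p ∈ elementary P F V t T) (s : ℝ) : MemLp p.2 2 (volume.restrict (Ioc t s)) := by
  obtain ⟨h1, C, hC⟩ := elementary_integrand hp
  exact MemLp.of_bound h1.aestronglyMeasurable C (Eventually.of_forall hC)

theorem elementary_integrable_inner {p q : (ℝ → Ω → ℝ) × (ℝ → Lp ℝ 2 P)}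
    (hp : p ∈ elementary P F V t T) (hq : q ∈ elementary P F V t T) (s : ℝ) :
    Integrable (fun r => inner ℝ (p.2 r) (q.2 r)) (volume.restrict (Ioc t s)) := by
  obtain ⟨h1, C, hC⟩ := elementary_integrand hp
  obtain ⟨h2, D, hD⟩ := elementary_integrand hq
  refine Integrable.of_bound (h1.inner h2).aestronglyMeasurable (C * D)
    (Eventually.of_forall fun r => (norm_inner_le_norm _ _).trans ?_)
  exact mul_le_mul (hC r) (hD r) (norm_nonneg _) ((norm_nonneg _).trans (hC r))

end Elementary

/-! ## Brownian motion as an integrator -/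

namespace IsBMWith

variable {Ω : Type*} {mΩ : MeasurableSpace Ω} {P : Measure Ω}
  {F : Filtration ℝ mΩ} {V : ℝ → Ω → ℝ} {t T : ℝ}

/-- Independence factors the expectation into `E[Y] · 0`; the product formula for independent
variables needs no integrability of `Y`. -/
theorem integral_mul (h : IsBMWith P F V t T) {s r : ℝ} (hs : t ≤ s) (hsr : s ≤ r) (hr : r ≤ T)
    {Y : Ω → ℝ} (hY : StronglyMeasurable[F s] Y) : ∫ ω, Y ω * (V r ω - V s ω) ∂P = 0 := by
  rw [(h.indep s r hs hsr hr Y hY).integral_fun_mul_eq_mul_integral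
    (hY.mono (F.le s)).aestronglyMeasurable (h.memLp s r hs hsr hr).1, h.mean s r hs hsr hr,
    mul_zero]

theorem integral_mul_sq (h : IsBMWith P F V t T) {s r : ℝ} (hs : t ≤ s) (hsr : s ≤ r) (hr : r ≤ T)
    {Y : Ω → ℝ} (hY : StronglyMeasurable[F s] Y) :
    ∫ ω, Y ω * (V r ω - V s ω) ^ 2 ∂P = (r - s) * ∫ ω, Y ω ∂P := by
  have hi : IndepFun Y (fun ω => (V r ω - V s ω) ^ 2) P :=
    (h.indep s r hs hsr hr Y hY).comp measurable_id (measurable_id.pow_const 2)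
  rw [hi.integral_fun_mul_eq_mul_integral (hY.mono (F.le s)).aestronglyMeasurable
    ((h.memLp s r hs hsr hr).1.pow 2), h.var s r hs hsr hr, mul_comm]

theorem memLp_mul (h : IsBMWith P F V t T) {s r : ℝ} (hs : t ≤ s) (hsr : s ≤ r) (hr : r ≤ T)
    {Y : Ω → ℝ} (hY : StronglyMeasurable[F s] Y) (hY2 : MemLp Y 2 P) :
    MemLp (fun ω => Y ω * (V r ω - V s ω)) 2 P := by
  have hm := (h.memLp s r hs hsr hr)
  refine (memLp_two_iff_integrable_sq (hY2.1.mul hm.1)).2 ?_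
  have hi : IndepFun (fun ω => Y ω ^ 2) (fun ω => (V r ω - V s ω) ^ 2) P :=
    (h.indep s r hs hsr hr Y hY).comp (measurable_id.pow_const 2) (measurable_id.pow_const 2)
  refine (hi.integrable_mul hY2.integrable_sq hm.integrable_sq).congr
    (Eventually.of_forall fun ω => ?_)
  simp only [Pi.mul_apply, mul_pow]

/-- The interval `(a,b]` is cut at `c`, and then the longer of the two remaining intervals at the
smaller of `b` and `d`. Only the common part `(c, min b d]` contributes, through the variance; in
every other product the later increment is centred and independent of the remaining factors. -/
theorem integral_generators (h : IsBMWith P F V t T) {a b c d : ℝ} (ha : t ≤ a) (hab : a ≤ b)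
    (hb : b ≤ T) (hcd : c ≤ d) (hd : d ≤ T) (hac : a ≤ c) {ξ η : Ω → ℝ}
    (hξ : StronglyMeasurable[F a] ξ) (hξ2 : MemLp ξ 2 P)
    (hη : StronglyMeasurable[F c] η) (hη2 : MemLp η 2 P) :
    ∫ ω, (ξ ω * (V b ω - V a ω)) * (η ω * (V d ω - V c ω)) ∂P =
      max 0 (min b d - c) * ∫ ω, ξ ω * η ω ∂P := by
  have hc : t ≤ c := ha.trans hac
  have hadp : ∀ {u v : ℝ}, t ≤ u → u ≤ v → v ≤ T → StronglyMeasurable[F v] (V u) :=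
    fun h1 h2 h3 => (h.adapted _ ⟨h1, h2.trans h3⟩).mono (F.mono h2)
  have hξ' := hξ.mono (F.mono hac)
  rcases le_total b c with hbc | hcb
  · rw [max_eq_left (by linarith [min_le_left b d]), zero_mul,
      ← h.integral_mul hc hcd hd (Y := fun ω => ξ ω * (V b ω - V a ω) * η ω)
        ((hξ'.mul ((hadp (ha.trans hab) hbc (hcd.trans hd)).sub
          (hadp ha hac (hcd.trans hd)))).mul hη)]
    exact integral_congr_ae (Eventually.of_forall fun ω => by ring)
  have hcT : c ≤ T := hcd.trans hd
  have e1 : ∫ ω, (ξ ω * (V c ω - V a ω)) * (η ω * (V d ω - V c ω)) ∂P = 0 := by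
    rw [← h.integral_mul hc hcd hd (Y := fun ω => ξ ω * (V c ω - V a ω) * η ω)
      ((hξ'.mul ((hadp hc le_rfl hcT).sub (hadp ha hac hcT))).mul hη)]
    exact integral_congr_ae (Eventually.of_forall fun ω => by ring)
  have i1 : Integrable (fun ω => (ξ ω * (V c ω - V a ω)) * (η ω * (V d ω - V c ω))) P :=
    (h.memLp_mul ha hac hcT hξ hξ2).integrable_mul (h.memLp_mul hc hcd hd hη hη2)
  rcases le_total b d with hbd | hdb
  · have hbT := hbd.trans hd
    have i2 : Integrable (fun ω => (ξ ω * (V b ω - V c ω)) * (η ω * (V b ω - V c ω))) P :=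
      (h.memLp_mul hc hcb hbT hξ' hξ2).integrable_mul (h.memLp_mul hc hcb hbT hη hη2)
    have i3 : Integrable (fun ω => (ξ ω * (V b ω - V c ω)) * (η ω * (V d ω - V b ω))) P :=
      (h.memLp_mul hc hcb hbT hξ' hξ2).integrable_mul
        (h.memLp_mul (hc.trans hcb) hbd hd (hη.mono (F.mono hcb)) hη2)
    have e2 : ∫ ω, (ξ ω * (V b ω - V c ω)) * (η ω * (V b ω - V c ω)) ∂P =
        (b - c) * ∫ ω, ξ ω * η ω ∂P := by
      rw [← h.integral_mul_sq hc hcb hbT (Y := fun ω => ξ ω * η ω) (hξ'.mul hη)]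
      exact integral_congr_ae (Eventually.of_forall fun ω => by ring)
    have e3 : ∫ ω, (ξ ω * (V b ω - V c ω)) * (η ω * (V d ω - V b ω)) ∂P = 0 := by
      rw [← h.integral_mul (hc.trans hcb) hbd hd (Y := fun ω => ξ ω * (V b ω - V c ω) * η ω)
        (((hξ'.mono (F.mono hcb)).mul ((hadp (hc.trans hcb) le_rfl hbT).sub
          (hadp hc hcb hbT))).mul (hη.mono (F.mono hcb)))]
      exact integral_congr_ae (Eventually.of_forall fun ω => by ring)
    rw [min_eq_left hbd, max_eq_right (by linarith), ← e2]
    calc ∫ ω, (ξ ω * (V b ω - V a ω)) * (η ω * (V d ω - V c ω)) ∂P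
        = ∫ ω, ((ξ ω * (V c ω - V a ω)) * (η ω * (V d ω - V c ω)) +
            ((ξ ω * (V b ω - V c ω)) * (η ω * (V b ω - V c ω)) + (ξ ω * (V b ω - V c ω)) * (η ω * (V d ω - V b ω)))) ∂P :=
          integral_congr_ae (Eventually.of_forall fun ω => by simp only; ring)
      _ = ∫ ω, (ξ ω * (V b ω - V c ω)) * (η ω * (V b ω - V c ω)) ∂P := by
          refine (integral_add i1 (i2.add i3)).trans ?_
          rw [e1, zero_add]
          exact (integral_add i2 i3).trans (by rw [e3, add_zero])
  · have i2 : Integrable (fun ω => (ξ ω * (V d ω - V c ω)) * (η ω * (V d ω - V c ω))) P :=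
      (h.memLp_mul hc hcd hd hξ' hξ2).integrable_mul (h.memLp_mul hc hcd hd hη hη2)
    have i3 : Integrable (fun ω => (ξ ω * (V b ω - V d ω)) * (η ω * (V d ω - V c ω))) P :=
      (h.memLp_mul (hc.trans hcd) hdb hb (hξ'.mono (F.mono hcd)) hξ2).integrable_mul
        (h.memLp_mul hc hcd hd hη hη2)
    have e2 : ∫ ω, (ξ ω * (V d ω - V c ω)) * (η ω * (V d ω - V c ω)) ∂P =
        (d - c) * ∫ ω, ξ ω * η ω ∂P := by
      rw [← h.integral_mul_sq hc hcd hd (Y := fun ω => ξ ω * η ω) (hξ'.mul hη)]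
      exact integral_congr_ae (Eventually.of_forall fun ω => by ring)
    have e3 : ∫ ω, (ξ ω * (V b ω - V d ω)) * (η ω * (V d ω - V c ω)) ∂P = 0 := by
      rw [← h.integral_mul (hc.trans hcd) hdb hb (Y := fun ω => ξ ω * (V d ω - V c ω) * η ω)
        (((hξ'.mono (F.mono hcd)).mul ((hadp (hc.trans hcd) le_rfl hd).sub
          (hadp hc hcd hd))).mul (hη.mono (F.mono hcd)))]
      exact integral_congr_ae (Eventually.of_forall fun ω => by ring)
    rw [min_eq_right hdb, max_eq_right (by linarith), ← e2]
    calc ∫ ω, (ξ ω * (V b ω - V a ω)) * (η ω * (V d ω - V c ω)) ∂P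
        = ∫ ω, ((ξ ω * (V c ω - V a ω)) * (η ω * (V d ω - V c ω)) +
            ((ξ ω * (V d ω - V c ω)) * (η ω * (V d ω - V c ω)) + (ξ ω * (V b ω - V d ω)) * (η ω * (V d ω - V c ω)))) ∂P :=
          integral_congr_ae (Eventually.of_forall fun ω => by simp only; ring)
      _ = ∫ ω, (ξ ω * (V d ω - V c ω)) * (η ω * (V d ω - V c ω)) ∂P := by
          refine (integral_add i1 (i2.add i3)).trans ?_
          rw [e1, zero_add]
          exact (integral_add i2 i3).trans (by rw [e3, add_zero])

theorem elementary_memLp (h : IsBMWith P F V t T) {p : (ℝ → Ω → ℝ) × (ℝ → Lp ℝ 2 P)}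
    (hp : p ∈ elementary P F V t T) (s : ℝ) : MemLp (p.1 s) 2 P := by
  induction hp using elementary_induction with
  | gen a b ξ hξ h1 h2 h3 h4 =>
    exact h.memLp_mul h1 (le_clamp _ _ _) ((clamp_le h2 _).trans h3) h4 hξ
  | zero => exact MemLp.zero
  | add p q _ _ h1 h2 => exact h1.add h2
  | smul c p _ h => exact h.const_smul c

/-- For a generator with `q ≤ b` the increment starts at `clamp a b q ≥ q`, where `Y ξ` is already
measurable; for `q ≥ b` it is zero. -/
theorem elementary_orthogonal (h : IsBMWith P F V t T) {p : (ℝ → Ω → ℝ) × (ℝ → Lp ℝ 2 P)}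
    (hp : p ∈ elementary P F V t T) {q r : ℝ} (hqr : q ≤ r)
    {Y : Ω → ℝ} (hY : StronglyMeasurable[F q] Y) (hY2 : MemLp Y 2 P) :
    ∫ ω, Y ω * (p.1 r ω - p.1 q ω) ∂P = 0 := by
  have hint : ∀ p ∈ elementary P F V t T, Integrable (fun ω => Y ω * (p.1 r ω - p.1 q ω)) P :=
    fun p hp => hY2.integrable_mul ((h.elementary_memLp hp r).sub (h.elementary_memLp hp q))
  induction hp using elementary_induction with
  | gen a b ξ hξ h1 h2 h3 h4 =>
    simp only [elemPath]
    rcases le_total q b with hq | hq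
    · have hc := le_clamp_self (a := a) hq
      rw [← h.integral_mul (h1.trans (le_clamp a b q)) (clamp_mono a b hqr)
        ((clamp_le h2 _).trans h3) (Y := fun ω => Y ω * ξ ω)
        ((hY.mono (F.mono hc)).mul (h4.mono (F.mono (le_clamp _ _ _))))]
      exact integral_congr_ae (Eventually.of_forall fun ω => by ring)
    · simp [clamp_of_ge h2 hq, clamp_of_ge h2 (hq.trans hqr)]
  | zero => simp
  | add p q hp hq h1 h2 =>
    rw [← add_zero (0 : ℝ)]
    nth_rewrite 1 [← h1]
    rw [← h2, ← integral_add (hint p hp) (hint q hq)]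
    exact integral_congr_ae (Eventually.of_forall fun ω => by
      simp only [Prod.fst_add, Pi.add_apply]; ring)
  | smul c p hp h =>
    rw [← mul_zero c, ← h, ← integral_const_mul]
    exact integral_congr_ae (Eventually.of_forall fun ω => by
      simp only [Prod.smul_fst, Pi.smul_apply, smul_eq_mul]; ring)

/-- The Itô isometry, in polarized form so that it can be proved by linearity in each argument. -/
theorem elementary_inner (h : IsBMWith P F V t T) {p q : (ℝ → Ω → ℝ) × (ℝ → Lp ℝ 2 P)}
    (hp : p ∈ elementary P F V t T) (hq : q ∈ elementary P F V t T) (s : ℝ) :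
    ∫ ω, p.1 s ω * q.1 s ω ∂P = ∫ r in Ioc t s, inner ℝ (p.2 r) (q.2 r) := by
  have hint : ∀ p ∈ elementary P F V t T, ∀ q ∈ elementary P F V t T,
      Integrable (fun ω => p.1 s ω * q.1 s ω) P :=
    fun p hp q hq => (h.elementary_memLp hp s).integrable_mul (h.elementary_memLp hq s)
  induction hp using elementary_induction with
  | gen a b ξ hξ h1 h2 h3 h4 =>
    induction hq using elementary_induction with
    | gen c d η hη g1 g2 g3 g4 =>
      -- The statement is symmetric in the two generators, so the one that starts earlier may come
      -- first.
      have key : ∀ (a b c d : ℝ), t ≤ a → a ≤ b → b ≤ T → t ≤ c → c ≤ d → d ≤ T → a ≤ c →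
          ∀ (ξ η : Ω → ℝ) (hξ : MemLp ξ 2 P) (hη : MemLp η 2 P), StronglyMeasurable[F a] ξ →
          StronglyMeasurable[F c] η →
          ∫ ω, elemPath V a b ξ s ω * elemPath V c d η s ω ∂P = ∫ r in Ioc t s,
            inner ℝ ((Ioc a b).indicator (fun _ => hξ.toLp ξ) r)
              ((Ioc c d).indicator (fun _ => hη.toLp η) r) := by
        intro a b c d h1 h2 h3 g1 g2 g3 hac ξ η hξ hη h4 g4
        have hin : inner ℝ (hξ.toLp ξ) (hη.toLp η) = ∫ ω, ξ ω * η ω ∂P := by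
          rw [L2.inner_def]
          refine integral_congr_ae ?_
          filter_upwards [hξ.coeFn_toLp, hη.coeFn_toLp] with ω e1 e2
          rw [e1, e2]
          simp [mul_comm]
        have e1 : ∀ r, inner ℝ ((Ioc a b).indicator (fun _ => hξ.toLp ξ) r)
              ((Ioc c d).indicator (fun _ => hη.toLp η) r) =
            (Ioc a b ∩ Ioc c d).indicator (fun _ => ∫ ω, ξ ω * η ω ∂P) r := by
          intro r
          by_cases hr1 : r ∈ Ioc a b <;> by_cases hr2 : r ∈ Ioc c d <;> simp [hr1, hr2, hin]
        simp only [elemPath]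
        rw [h.integral_generators h1 (le_clamp a b s) ((clamp_le h2 _).trans h3)
          (le_clamp c d s) ((clamp_le g2 _).trans g3) hac h4 hξ g4 hη]
        simp only [e1]
        rw [setIntegral_indicator (measurableSet_Ioc.inter measurableSet_Ioc), setIntegral_const,
          smul_eq_mul]
        congr 1
        have e2 : Ioc t s ∩ (Ioc a b ∩ Ioc c d) = Ioc c (min (clamp a b s) (clamp c d s)) := by
          rw [inter_inter_distrib_left, Ioc_inter_Ioc_clamp h1, Ioc_inter_Ioc_clamp g1,
            Ioc_inter_Ioc, max_eq_right hac]
        rw [e2, Real.volume_real_Ioc, max_comm]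
      rcases le_total a c with hac | hca
      · exact key a b c d h1 h2 h3 g1 g2 g3 hac ξ η hξ hη h4 g4
      · have := key c d a b g1 g2 g3 h1 h2 h3 hca η ξ hη hξ g4 h4
        simp_rw [mul_comm (elemPath V c d η s _), real_inner_comm] at this
        exact this
    | zero => simp
    | add q q' hq hq' e1 e2 =>
      have hp : (elemPath V a b ξ, (Ioc a b).indicator fun _ => hξ.toLp ξ) ∈
          elementary P F V t T := Submodule.subset_span ⟨a, b, ξ, hξ, h1, h2, h3, h4, rfl⟩
      simp only [Prod.fst_add, Prod.snd_add, Pi.add_apply, mul_add, inner_add_right] at *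
      rw [integral_add (hint _ hp q hq) (hint _ hp q' hq'), e1, e2, integral_add
        (elementary_integrable_inner hp hq s) (elementary_integrable_inner hp hq' s)]
    | smul c q hq e =>
      simp only [Prod.smul_fst, Prod.smul_snd, Pi.smul_apply, smul_eq_mul, mul_left_comm _ c,
        real_inner_smul_right, integral_const_mul] at *
      rw [e]
  | zero => simp
  | add p p' hp hp' e1 e2 =>
    simp only [Prod.fst_add, Prod.snd_add, Pi.add_apply, add_mul, inner_add_left] at *
    rw [integral_add (hint p hp q hq) (hint p' hp' q hq), e1, e2, integral_add
      (elementary_integrable_inner hp hq s) (elementary_integrable_inner hp' hq s)]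
  | smul c p hp e =>
    simp only [Prod.smul_fst, Prod.smul_snd, Pi.smul_apply, smul_eq_mul, mul_assoc,
      real_inner_smul_left, integral_const_mul] at *
    rw [e]

/-- Doob's inequality gives the constant `8`, and the Itô isometry evaluates the terminal second
moment. -/
theorem isIntegrator [IsFiniteMeasure P] (h : IsBMWith P F V t T) : IsIntegrator P F V t T 8 where
  continuous := h.continuous
  adapted := h.adapted
  bound p hp s hs := by
    refine (lintegral_iSup_sq_le (F := F) hs.1 (elementary_continuous h.continuous hp)
      (fun r hr => elementary_adapted h.adapted hp ⟨hr.1, hr.2.trans hs.2⟩)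
      (fun r _ => h.elementary_memLp hp r)
      (fun q r _ hqr _ Y hY hY2 => h.elementary_orthogonal hp hqr hY hY2)).trans ?_
    refine mul_le_mul_right (le_of_eq ?_) _
    rw [lintegral_sq_eq (h.elementary_memLp hp s)]
    have := h.elementary_inner hp hp s
    simp only [← pow_two, real_inner_self_eq_norm_sq] at this
    rw [this, ofReal_integral_eq_lintegral_ofReal
      ((elementary_memLp_integrand hp s).integrable_norm_pow two_ne_zero)
      (Eventually.of_forall fun _ => by positivity)]
    refine lintegral_congr fun r => ?_
    rw [ENNReal.ofReal_pow (norm_nonneg _), ofReal_norm]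

end IsBMWith

/-! ## Time as an integrator -/

section Time

variable {Ω : Type*} {mΩ : MeasurableSpace Ω} {P : Measure Ω} {F : Filtration ℝ mΩ} {t T : ℝ}

theorem lp_enorm_sq (x : Lp ℝ 2 P) : ‖x‖ₑ ^ 2 = ∫⁻ ω, ‖x ω‖ₑ ^ 2 ∂P := by
  rw [Lp.enorm_def, eLpNorm_eq_lintegral_rpow_enorm_toReal two_ne_zero ENNReal.ofNat_ne_top,
    ← ENNReal.rpow_natCast, ← ENNReal.rpow_mul]
  simp

theorem lintegral_sq_le_measure_mul {α : Type*} {mα : MeasurableSpace α} {μ : Measure α}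
    {f : α → ℝ≥0∞} (hf : AEMeasurable f μ) :
    (∫⁻ x, f x ∂μ) ^ 2 ≤ μ univ * ∫⁻ x, f x ^ 2 ∂μ := by
  have h := ENNReal.lintegral_mul_le_Lp_mul_Lq μ (Real.HolderConjugate.two_two) hf
    (aemeasurable_const (b := (1 : ℝ≥0∞)))
  have := pow_le_pow_left' h 2
  rw [mul_pow] at this
  simp only [← ENNReal.rpow_natCast, ← ENNReal.rpow_mul] at this ⊢
  simpa [mul_comm] using this

/-- The integrand assigns to each time only a class in `L²`. Exchanging the integrals over time and
`Ω` requires a jointly measurable representative, which is explicit for generators. -/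
theorem exists_jointly_measurable_integrand {p : (ℝ → Ω → ℝ) × (ℝ → Lp ℝ 2 P)}
    (hp : p ∈ elementary P F (fun s _ => s) t T) :
    ∃ G : ℝ → Ω → ℝ, Measurable (Function.uncurry G) ∧ (∀ r, G r =ᵐ[P] p.2 r) ∧
      ∀ ω, (∃ C, ∀ r, |G r ω| ≤ C) ∧ ∀ s, p.1 s ω = ∫ r in Ioc t s, G r ω := by
  induction hp using elementary_induction with
  | gen a b ξ hξ h1 h2 h3 h4 =>
    refine ⟨fun r ω => (Ioc a b ×ˢ univ).indicator (fun q => ξ q.2) (r, ω), ?_, ?_, ?_⟩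
    · exact ((h4.mono (F.le a)).measurable.comp measurable_snd).indicator
        (measurableSet_Ioc.prod MeasurableSet.univ)
    · intro r
      by_cases hr : r ∈ Ioc a b
      · simpa [indicator, hr] using hξ.coeFn_toLp.symm
      · simp only [indicator, hr, mem_prod, mem_univ, and_true, if_false]
        exact (Lp.coeFn_zero ℝ 2 P).symm
    · intro ω
      refine ⟨⟨|ξ ω|, fun r => ?_⟩, fun s => ?_⟩
      · by_cases hr : r ∈ Ioc a b <;> simp [indicator, hr]
      · have : ∀ r, (Ioc a b ×ˢ univ).indicator (fun q : ℝ × Ω => ξ q.2) (r, ω) =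
            (Ioc a b).indicator (fun _ => ξ ω) r := fun r => by simp [indicator]
        simp only [this]
        rw [setIntegral_indicator measurableSet_Ioc, Ioc_inter_Ioc_clamp h1, setIntegral_const,
          Real.volume_real_Ioc_of_le (le_clamp a b s), elemPath, smul_eq_mul, mul_comm]
  | zero =>
    exact ⟨fun _ _ => 0, measurable_const, fun r => (Lp.coeFn_zero ℝ 2 P).symm,
      fun ω => ⟨⟨0, by simp⟩, by simp⟩⟩
  | add p q _ _ e1 e2 =>
    obtain ⟨G, hG, hGp, hG'⟩ := e1
    obtain ⟨H, hH, hHq, hH'⟩ := e2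
    have hi : ∀ {G : ℝ → Ω → ℝ}, Measurable (Function.uncurry G) → ∀ ω, (∃ C, ∀ r, |G r ω| ≤ C) →
        ∀ s, IntegrableOn (fun r => G r ω) (Ioc t s) := fun hG ω ⟨C, hC⟩ s =>
      Measure.integrableOn_of_bounded measure_Ioc_lt_top.ne
        (hG.comp (measurable_id.prodMk measurable_const)).aestronglyMeasurable
        (Eventually.of_forall hC)
    refine ⟨fun r ω => G r ω + H r ω, hG.add hH, fun r => ?_, fun ω => ⟨?_, fun s => ?_⟩⟩
    · filter_upwards [hGp r, hHq r, Lp.coeFn_add (p.2 r) (q.2 r)] with ω g1 g2 g3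
      simp only [Prod.snd_add, Pi.add_apply] at *
      rw [g3, g1, g2]
    · obtain ⟨C, hC⟩ := (hG' ω).1
      obtain ⟨D, hD⟩ := (hH' ω).1
      exact ⟨C + D, fun r => (abs_add_le _ _).trans (add_le_add (hC r) (hD r))⟩
    · rw [integral_add (hi hG ω (hG' ω).1 s) (hi hH ω (hH' ω).1 s), ← (hG' ω).2, ← (hH' ω).2]
      rfl
  | smul c p _ e =>
    obtain ⟨G, hG, hGp, hG'⟩ := e
    refine ⟨fun r ω => c * G r ω, hG.const_mul c, fun r => ?_, fun ω => ⟨?_, fun s => ?_⟩⟩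
    · filter_upwards [hGp r, Lp.coeFn_smul c (p.2 r)] with ω g1 g3
      simp only [Prod.smul_snd, Pi.smul_apply, smul_eq_mul] at *
      rw [g3, g1]
    · obtain ⟨C, hC⟩ := (hG' ω).1
      exact ⟨|c| * C, fun r => by rw [abs_mul]; gcongr; exact hC r⟩
    · rw [integral_const_mul, ← (hG' ω).2]
      rfl

/-- The path is bounded by the time integral of `|G|`; the Cauchy-Schwarz inequality in time and
Tonelli's theorem do the rest. -/
theorem isIntegrator_time [SFinite P] :
    IsIntegrator P F (fun s _ => s) t T (T - t).toNNReal where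
  continuous _ := continuous_id
  adapted _ _ := stronglyMeasurable_const
  bound p hp s hs := by
    obtain ⟨G, hG, hGp, hG'⟩ := exists_jointly_measurable_integrand hp
    have hm : ∀ ω, Measurable fun r => ‖G r ω‖ₑ := fun ω =>
      (hG.comp (measurable_id.prodMk measurable_const)).enorm
    calc ∫⁻ ω, (⨆ r ∈ Icc t s, ‖p.1 r ω‖ₑ) ^ 2 ∂P
        ≤ ∫⁻ ω, (ENNReal.ofReal (s - t) * ∫⁻ r in Ioc t s, ‖G r ω‖ₑ ^ 2) ∂P := by
          refine lintegral_mono fun ω => ?_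
          have h1 : (⨆ r ∈ Icc t s, ‖p.1 r ω‖ₑ) ≤ ∫⁻ r in Ioc t s, ‖G r ω‖ₑ :=
            iSup₂_le fun r hr => by
              rw [(hG' ω).2]
              exact (enorm_integral_le_lintegral_enorm _).trans
                (lintegral_mono_set (Ioc_subset_Ioc_right hr.2))
          refine (pow_le_pow_left' h1 2).trans
            ((lintegral_sq_le_measure_mul (hm ω).aemeasurable).trans_eq ?_)
          rw [Measure.restrict_apply_univ, Real.volume_Ioc]
      _ = ENNReal.ofReal (s - t) * ∫⁻ r in Ioc t s, (∫⁻ ω, ‖G r ω‖ₑ ^ 2 ∂P) := by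
          rw [lintegral_const_mul', lintegral_lintegral_swap]
          · exact (hG.comp measurable_swap).enorm.pow_const 2 |>.aemeasurable
          · exact ENNReal.ofReal_ne_top
      _ ≤ (T - t).toNNReal * ∫⁻ r in Ioc t s, ‖p.2 r‖ₑ ^ 2 := by
          refine mul_le_mul' (ENNReal.ofReal_le_ofReal (by linarith [hs.2])) (le_of_eq ?_)
          refine lintegral_congr fun r => ?_
          rw [lp_enorm_sq]
          refine lintegral_congr_ae ?_
          filter_upwards [hGp r] with ω h
          rw [h]

end Time

/-! ## Measurability of random continuous functions -/

/-- A continuous function on the unit interval is the uniform limit of its Bernstein approximations,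
each of which depends on finitely many values; `g` and `h` transport this to `[a,b]`. -/
theorem stronglyMeasurable_continuousMap {Ω : Type*} {mΩ : MeasurableSpace Ω} {a b : ℝ}
    (hab : a ≤ b) {f : Ω → C(Icc a b, ℝ)} (hf : ∀ r, Measurable fun ω => f ω r) :
    StronglyMeasurable f := by
  let g : C(unitInterval, Icc a b) := ⟨fun u => ⟨a + u * (b - a),
    by have := mul_nonneg u.2.1 (sub_nonneg.2 hab); linarith,
    by have := mul_le_mul_of_nonneg_right u.2.2 (sub_nonneg.2 hab); linarith⟩, by fun_prop⟩
  let h : C(Icc a b, unitInterval) :=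
    ⟨fun r => projIcc 0 1 zero_le_one ((r - a) / (b - a)), by fun_prop⟩
  have hgh : ∀ r, g (h r) = r := fun r => by
    refine Subtype.ext ?_
    simp only [g, h, ContinuousMap.coe_mk]
    rcases hab.eq_or_lt with e | e
    · have : (r : ℝ) = a := le_antisymm (r.2.2.trans e.ge) r.2.1
      rw [this, sub_eq_zero.2 e.symm]; simp
    · have h0 : 0 < b - a := sub_pos.2 e
      rw [projIcc_of_mem zero_le_one ⟨div_nonneg (sub_nonneg.2 r.2.1) h0.le,
        (div_le_one h0).2 (by linarith [r.2.2])⟩]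
      simp only
      rw [div_mul_cancel₀ _ h0.ne']
      ring
  have h1 : StronglyMeasurable fun ω => (f ω).comp g := by
    refine stronglyMeasurable_of_tendsto atTop
      (f := fun n ω => bernsteinApproximation n ((f ω).comp g)) (fun n => ?_)
      (tendsto_pi_nhds.2 fun ω => bernsteinApproximation_uniform _)
    unfold bernsteinApproximation
    refine Finset.stronglyMeasurable_fun_sum _ fun i _ => ?_
    exact (ContinuousMap.continuous_const'.const_smul (bernstein n i)).comp_stronglyMeasurable
      (hf (g (bernstein.z i))).stronglyMeasurable
  have h2 := (ContinuousMap.continuous_precomp (Z := ℝ) h).comp_stronglyMeasurable h1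
  convert h2 using 1
  funext ω
  ext r
  simp [hgh]

/-! ## Step approximation of continuous integrands -/

theorem exists_step_eq {E : Type*} [AddCommMonoid E] {t s : ℝ} (n : ℕ) {r : ℝ} (hr : r ∈ Ioc t s)
    (hn : n ≠ 0) (f : ℕ → E) : ∃ i < n, |t + i * ((s - t) / n) - r| ≤ (s - t) / n ∧
    ∑ j ∈ Finset.range n, (Ioc (t + j * ((s - t) / n)) (t + (j + 1) * ((s - t) / n))).indicator
      (fun _ => f j) r = f i := by
  have hn' : (0 : ℝ) < n := by positivity
  set h := (s - t) / n with hh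
  have h0 : 0 < h := div_pos (by linarith [hr.1, hr.2]) hn'
  have hnh : n * h = s - t := mul_div_cancel₀ _ hn'.ne'
  have hpos : 0 < (r - t) / h := div_pos (by linarith [hr.1]) h0
  -- The index is the ceiling minus one, because the steps are open on the left and closed on the
  -- right.
  obtain ⟨i, hi⟩ : ∃ i, ⌈(r - t) / h⌉₊ = i + 1 :=
    Nat.exists_eq_succ_of_ne_zero (Nat.ceil_pos.2 hpos).ne'
  have e1 : r ≤ t + (i + 1) * h := by
    have := Nat.le_ceil ((r - t) / h)
    rw [hi, div_le_iff₀ h0] at this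
    push_cast at this
    linarith
  have e2 : t + i * h < r := by
    have := Nat.ceil_lt_add_one hpos.le
    rw [hi] at this
    push_cast at this
    have : (i : ℝ) < (r - t) / h := by linarith
    rw [lt_div_iff₀ h0] at this
    linarith
  have hin : i < n := by
    have : (i : ℝ) * h < n * h := by rw [hnh]; linarith [hr.2]
    exact_mod_cast lt_of_mul_lt_mul_right this h0.le
  refine ⟨i, hin, ?_, ?_⟩
  · rw [abs_le]; constructor <;> linarith
  · rw [Finset.sum_eq_single i]
    · exact indicator_of_mem (show r ∈ Ioc (t + i * h) (t + (i + 1) * h) from ⟨e2, e1⟩) _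
    · intro j _ hji
      refine indicator_of_notMem (fun hj => hji ?_) _
      have f1 : (j : ℝ) < i + 1 := lt_of_mul_lt_mul_right (by linarith [hj.1]) h0.le
      have f2 : (i : ℝ) < j + 1 := lt_of_mul_lt_mul_right (by linarith [hj.2]) h0.le
      have f1' : j < i + 1 := by exact_mod_cast f1
      have f2' : i < j + 1 := by exact_mod_cast f2
      lia
    · intro h; exact absurd (Finset.mem_range.2 hin) h

theorem tendsto_eLpNorm_step {E : Type*} [NormedAddCommGroup E] {t s : ℝ} {G : ℝ → E}
    (hG : ContinuousOn G (Icc t s)) (p : ℝ≥0∞) :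
    Tendsto (fun n : ℕ => eLpNorm (fun r => G r - ∑ j ∈ Finset.range n,
      (Ioc (t + j * ((s - t) / n)) (t + (j + 1) * ((s - t) / n))).indicator
        (fun _ => G (t + j * ((s - t) / n))) r) p (volume.restrict (Ioc t s))) atTop (𝓝 0) := by
  rw [ENNReal.tendsto_nhds_zero]
  intro ε hε
  -- A uniform error `δ` costs `κ δ` in the `Lᵖ`-norm; uniform continuity on the compact interval
  -- makes `δ` small.
  set κ : ℝ≥0∞ := (volume.restrict (Ioc t s)) univ ^ p.toReal⁻¹ with hκ
  have hκ' : κ ≠ ∞ := by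
    rw [hκ, Measure.restrict_apply_univ]
    exact ENNReal.rpow_ne_top_of_nonneg (by simp) measure_Ioc_lt_top.ne
  obtain ⟨δ, hδ, hδε⟩ : ∃ δ : ℝ, 0 < δ ∧ κ * ENNReal.ofReal δ ≤ ε := by
    have : Tendsto (fun δ : ℝ => κ * ENNReal.ofReal δ) (𝓝[>] 0) (𝓝 0) := by
      have := (ENNReal.Tendsto.const_mul (ENNReal.continuous_ofReal.tendsto 0)
        (Or.inr hκ') : Tendsto (fun δ : ℝ => κ * ENNReal.ofReal δ) (𝓝 0) _)
      rw [ENNReal.ofReal_zero, mul_zero] at this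
      exact this.mono_left nhdsWithin_le_nhds
    obtain ⟨δ, h1, h2⟩ := ((ENNReal.tendsto_nhds_zero.1 this ε hε).and
      self_mem_nhdsWithin).exists
    exact ⟨δ, h2, h1⟩
  have huc := isCompact_Icc.uniformContinuousOn_of_continuous hG
  obtain ⟨η, hη, hηδ⟩ := Metric.uniformContinuousOn_iff.1 huc δ hδ
  have hlim := tendsto_const_div_atTop_nhds_zero_nat (s - t)
  filter_upwards [hlim.eventually (gt_mem_nhds hη), eventually_ne_atTop 0] with n hn hn0
  refine (eLpNorm_le_of_ae_bound (C := δ) ?_).trans hδε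
  refine (ae_restrict_iff' measurableSet_Ioc).2 (Eventually.of_forall fun r hr => ?_)
  obtain ⟨i, hin, hi, he⟩ := exists_step_eq n hr hn0 (fun j => G (t + j * ((s - t) / n)))
  rw [he, ← dist_eq_norm]
  have hst : 0 ≤ (s - t) / n := div_nonneg (by linarith [hr.1, hr.2]) (by positivity)
  refine (hηδ r ⟨hr.1.le, hr.2⟩ _ ⟨?_, ?_⟩ ?_).le
  · have := mul_nonneg (Nat.cast_nonneg (α := ℝ) i) hst; linarith
  · have h1 : (i : ℝ) * ((s - t) / n) ≤ n * ((s - t) / n) := by gcongr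
    rw [mul_div_cancel₀ _ (by positivity)] at h1
    linarith
  · rw [dist_comm, Real.dist_eq]; exact hi.trans_lt hn

/-! ## The integral of continuous adapted processes -/

section Integral

variable {Ω : Type*} {mΩ : MeasurableSpace Ω} (P : Measure Ω) (F : Filtration ℝ mΩ)
  (V : ℝ → Ω → ℝ) (t T : ℝ)

/-- The defining estimate of the indefinite integral `M` of `G` against `V`. -/
def IsIntegral (D : ℝ≥0) (G : ℝ → Lp ℝ 2 P) (M : Lp C(Icc t T, ℝ) 2 P) : Prop :=
  ∀ p ∈ elementary P F V t T, ∀ s : Icc t T, eLpNorm (fun ω => M ω s - p.1 s ω) 2 P ≤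
    D * eLpNorm (fun r => G r - p.2 r) 2 (volume.restrict (Ioc t s))

variable {P F V t T}

theorem eLpNorm_two_sq {α E : Type*} {mα : MeasurableSpace α} [NormedAddCommGroup E]
    (f : α → E) (μ : Measure α) : eLpNorm f 2 μ ^ 2 = ∫⁻ x, ‖f x‖ₑ ^ 2 ∂μ := by
  rw [eLpNorm_eq_lintegral_rpow_enorm_toReal two_ne_zero ENNReal.ofNat_ne_top,
    ← ENNReal.rpow_natCast, ← ENNReal.rpow_mul]
  simp

/-- Values at left end points keep the step process adapted. Since `G r` is only almost everywhere
equal to an adapted variable, such a version is used in the generator. -/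
theorem exists_elementary_step {G : ℝ → Lp ℝ 2 P}
    (hGm : ∀ s ∈ Icc t T, AEStronglyMeasurable[F s] (G s) P) {s : ℝ} (hs : s ∈ Icc t T) (n : ℕ) :
    ∃ p ∈ elementary P F V t T,
      (p.2 = fun r => ∑ j ∈ Finset.range n,
        (Ioc (t + j * ((s - t) / n)) (t + (j + 1) * ((s - t) / n))).indicator
          (fun _ => G (t + j * ((s - t) / n))) r) ∧
      p.1 s =ᵐ[P] fun ω => ∑ j ∈ Finset.range n, G (t + j * ((s - t) / n)) ω *
        (V (t + (j + 1) * ((s - t) / n)) ω - V (t + j * ((s - t) / n)) ω) := by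
  have h0 : 0 ≤ (s - t) / n := div_nonneg (by linarith [hs.1]) (by positivity)
  have hle : ∀ j : ℕ, t ≤ t + j * ((s - t) / n) := fun j => by
    have := mul_nonneg (Nat.cast_nonneg (α := ℝ) j) h0; linarith
  have hles : ∀ j < n, t + (j + 1) * ((s - t) / n) ≤ s := fun j hj => by
    have h1 : ((j + 1 : ℕ) : ℝ) ≤ n := by exact_mod_cast hj
    have h2 := mul_le_mul_of_nonneg_right h1 h0
    rw [mul_div_cancel₀ _ (by have : 0 < n := by lia
                              positivity)] at h2
    push_cast at h2
    linarith
  have hstep : ∀ j : ℕ, t + j * ((s - t) / n) ≤ t + (j + 1) * ((s - t) / n) := fun j => by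
    nlinarith
  have hgen : ∀ j : ℕ, ∃ p : (ℝ → Ω → ℝ) × (ℝ → Lp ℝ 2 P), j < n → p ∈ elementary P F V t T ∧
      (p.2 = (Ioc (t + j * ((s - t) / n)) (t + (j + 1) * ((s - t) / n))).indicator
          (fun _ => G (t + j * ((s - t) / n)))) ∧
      p.1 s =ᵐ[P] fun ω => G (t + j * ((s - t) / n)) ω *
        (V (t + (j + 1) * ((s - t) / n)) ω - V (t + j * ((s - t) / n)) ω) := by
    intro j
    by_cases hj : j < n
    · obtain ⟨ξ, hξm, hξ⟩ := hGm (t + j * ((s - t) / n))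
        ⟨hle j, (hstep j).trans ((hles j hj).trans hs.2)⟩
      have hξ2 : MemLp ξ 2 P := (memLp_congr_ae hξ).1 (Lp.memLp _)
      have hξG : hξ2.toLp ξ = G (t + j * ((s - t) / n)) := by
        rw [← Lp.toLp_coeFn (G (t + j * ((s - t) / n))) (Lp.memLp _)]
        exact (MemLp.toLp_eq_toLp_iff _ _).2 hξ.symm
      refine ⟨(elemPath V _ _ ξ, (Ioc _ _).indicator fun _ => hξ2.toLp ξ), fun _ =>
        ⟨Submodule.subset_span ⟨t + j * ((s - t) / n), t + (j + 1) * ((s - t) / n), ξ, hξ2, hle j,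
          hstep j, (hles j hj).trans hs.2, hξm, rfl⟩, by rw [hξG], ?_⟩⟩
      filter_upwards [hξ] with ω h
      simp only [elemPath]
      rw [clamp_of_ge (hstep j) (hles j hj), h]
    · exact ⟨0, fun h => absurd h hj⟩
  choose p hp using hgen
  refine ⟨∑ j ∈ Finset.range n, p j, Submodule.sum_mem _ fun j hj =>
    (hp j (Finset.mem_range.1 hj)).1, ?_, ?_⟩
  · funext r
    rw [Prod.snd_sum, Finset.sum_apply]
    exact Finset.sum_congr rfl fun j hj => by rw [(hp j (Finset.mem_range.1 hj)).2.1]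
  · have : ∀ᵐ ω ∂P, ∀ j ∈ Finset.range n, (p j).1 s ω = G (t + j * ((s - t) / n)) ω *
        (V (t + (j + 1) * ((s - t) / n)) ω - V (t + j * ((s - t) / n)) ω) :=
      (Finset.eventually_all _).2 fun j hj => (hp j (Finset.mem_range.1 hj)).2.2
    filter_upwards [this] with ω h
    rw [Prod.fst_sum, Finset.sum_apply, Finset.sum_apply]
    exact Finset.sum_congr rfl h

/-- Elementary integrals that approximate the integral of `G` up to time `s`. -/
theorem exists_elementary_seq {G : ℝ → Lp ℝ 2 P} (hG : ContinuousOn G (Icc t T))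
    (hGm : ∀ s ∈ Icc t T, AEStronglyMeasurable[F s] (G s) P) {s : ℝ} (hs : s ∈ Icc t T) :
    ∃ p : ℕ → (ℝ → Ω → ℝ) × (ℝ → Lp ℝ 2 P), (∀ n, p n ∈ elementary P F V t T) ∧
      Tendsto (fun n => eLpNorm (fun r => G r - (p n).2 r) 2 (volume.restrict (Ioc t s)))
        atTop (𝓝 0) ∧
      ∀ n, (p n).1 s =ᵐ[P] fun ω => ∑ j ∈ Finset.range n, G (t + j * ((s - t) / n)) ω *
        (V (t + (j + 1) * ((s - t) / n)) ω - V (t + j * ((s - t) / n)) ω) := by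
  choose p hp hp2 hp1 using fun n => exists_elementary_step (V := V) hGm hs n
  refine ⟨p, hp, ?_, hp1⟩
  simp only [hp2]
  exact tendsto_eLpNorm_step (hG.mono (Icc_subset_Icc_right hs.2)) 2

/-- The path of an elementary integral. -/
def elemC (hV : ∀ ω, Continuous fun s => V s ω) {p : (ℝ → Ω → ℝ) × (ℝ → Lp ℝ 2 P)}
    (hp : p ∈ elementary P F V t T) (ω : Ω) : C(Icc t T, ℝ) :=
  ⟨fun r => p.1 r ω, (elementary_continuous hV hp ω).comp continuous_subtype_val⟩

theorem IsIntegrator.eLpNorm_elemC_le {C : ℝ≥0} (h : IsIntegrator P F V t T C)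
    (htT : t ≤ T) {p : (ℝ → Ω → ℝ) × (ℝ → Lp ℝ 2 P)} (hp : p ∈ elementary P F V t T) :
    eLpNorm (elemC h.continuous hp) 2 P ≤
      NNReal.sqrt C * eLpNorm p.2 2 (volume.restrict (Ioc t T)) := by
  rw [← ENNReal.pow_le_pow_left_iff two_ne_zero, mul_pow, eLpNorm_two_sq, eLpNorm_two_sq,
    ← ENNReal.coe_pow, NNReal.sq_sqrt]
  refine le_trans (lintegral_mono fun ω => ?_) (h.bound p hp T (right_mem_Icc.2 htT))
  gcongr
  have : (⨆ r ∈ Icc t T, ‖p.1 r ω‖ₑ) = ⨆ r : Icc t T, ‖elemC h.continuous hp ω r‖ₑ := by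
    rw [iSup_subtype']; rfl
  rw [this]
  exact ContinuousMap.enorm_eq_iSup_enorm _ |>.le

end Integral

section Integral

variable {Ω : Type*} {mΩ : MeasurableSpace Ω} {P : Measure Ω} {F : Filtration ℝ mΩ}
  {V : ℝ → Ω → ℝ} {t T : ℝ}

theorem IsIntegrator.eLpNorm_le {C : ℝ≥0} (h : IsIntegrator P F V t T C)
    {p : (ℝ → Ω → ℝ) × (ℝ → Lp ℝ 2 P)} (hp : p ∈ elementary P F V t T) {s : ℝ}
    (hs : s ∈ Icc t T) :
    eLpNorm (p.1 s) 2 P ≤ NNReal.sqrt C * eLpNorm p.2 2 (volume.restrict (Ioc t s)) := by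
  rw [← ENNReal.pow_le_pow_left_iff two_ne_zero, mul_pow, eLpNorm_two_sq, eLpNorm_two_sq,
    ← ENNReal.coe_pow, NNReal.sq_sqrt]
  refine le_trans (lintegral_mono fun ω => ?_) (h.bound p hp s hs)
  gcongr
  exact le_iSup₂_of_le s (right_mem_Icc.2 hs.1) le_rfl

theorem IsIntegrator.memLp_elemC [IsFiniteMeasure P] {C : ℝ≥0} (h : IsIntegrator P F V t T C)
    (htT : t ≤ T) {p : (ℝ → Ω → ℝ) × (ℝ → Lp ℝ 2 P)} (hp : p ∈ elementary P F V t T) :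
    MemLp (elemC h.continuous hp) 2 P := by
  refine ⟨(stronglyMeasurable_continuousMap htT fun r => ?_).aestronglyMeasurable,
    (h.eLpNorm_elemC_le htT hp).trans_lt ?_⟩
  · exact ((elementary_adapted h.adapted hp r.2).mono (F.le _)).measurable
  · exact ENNReal.mul_lt_top ENNReal.coe_lt_top (elementary_memLp_integrand hp T).2

theorem aestronglyMeasurable_eval {a b : ℝ} {M : Ω → C(Icc a b, ℝ)}
    (hM : AEStronglyMeasurable M P) (s : Icc a b) :
    AEStronglyMeasurable (fun ω => M ω s) P :=
  (continuous_eval_const s).comp_aestronglyMeasurable hM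

theorem enorm_apply_le {a b : ℝ} (f : C(Icc a b, ℝ)) (s : Icc a b) : ‖f s‖ₑ ≤ ‖f‖ₑ := by
  rw [ContinuousMap.enorm_eq_iSup_enorm]
  exact le_iSup (fun s => ‖f s‖ₑ) s

theorem eLpNorm_eval_le {a b : ℝ} (f : Ω → C(Icc a b, ℝ)) (s : Icc a b) :
    eLpNorm (fun ω => f ω s) 2 P ≤ eLpNorm f 2 P :=
  eLpNorm_mono fun ω => (f ω).norm_coe_le_norm s

/-- Existence of the indefinite integral of a continuous adapted process. -/
theorem IsIntegrator.exists_isIntegral [IsFiniteMeasure P] {C : ℝ≥0}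
    (h : IsIntegrator P F V t T C) (htT : t ≤ T) {G : ℝ → Lp ℝ 2 P}
    (hG : ContinuousOn G (Icc t T)) (hGm : ∀ s ∈ Icc t T, AEStronglyMeasurable[F s] (G s) P) :
    ∃ M, IsIntegral P F V t T (NNReal.sqrt C) G M := by
  set D := NNReal.sqrt C
  obtain ⟨p, hp, hlim, -⟩ := exists_elementary_seq (V := V) hG hGm (right_mem_Icc.2 htT)
  have hGs : ∀ s ∈ Icc t T, AEStronglyMeasurable G (volume.restrict (Ioc t s)) := fun s hs =>
    (hG.mono (Ioc_subset_Icc_self.trans (Icc_subset_Icc_right hs.2))).aestronglyMeasurable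
      measurableSet_Ioc
  have hps : ∀ (q : (ℝ → Ω → ℝ) × (ℝ → Lp ℝ 2 P)), q ∈ elementary P F V t T → ∀ s,
      AEStronglyMeasurable q.2 (volume.restrict (Ioc t s)) := fun q hq s =>
    (elementary_integrand hq).1.aestronglyMeasurable
  -- The elementary integrals as random continuous paths. The maximal estimate makes them a Cauchy
  -- sequence in the sup norm, so the limit has continuous paths at once.
  set N : ℕ → Lp C(Icc t T, ℝ) 2 P := fun n => (h.memLp_elemC htT (hp n)).toLp _ with hN
  have hNcoe : ∀ n, N n =ᵐ[P] elemC h.continuous (hp n) := fun n => MemLp.coeFn_toLp _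
  set e : ℕ → ℝ≥0∞ := fun n => eLpNorm (fun r => G r - (p n).2 r) 2 (volume.restrict (Ioc t T))
    with he
  have hdist : ∀ n m, edist (N n) (N m) ≤ D * (e n + e m) := by
    intro n m
    rw [Lp.edist_def]
    have h1 : eLpNorm (⇑(N n) - ⇑(N m)) 2 P =
        eLpNorm (elemC h.continuous (sub_mem (hp n) (hp m))) 2 P := by
      refine eLpNorm_congr_ae ?_
      filter_upwards [hNcoe n, hNcoe m] with ω h1 h2
      rw [Pi.sub_apply, h1, h2]
      rfl
    rw [h1]
    refine (h.eLpNorm_elemC_le htT _).trans ?_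
    gcongr
    have h2 : (p n - p m).2 = (fun r => G r - (p m).2 r) - fun r => G r - (p n).2 r := by
      funext r; simp
    rw [h2, add_comm]
    exact eLpNorm_sub_le ((hGs T (right_mem_Icc.2 htT)).sub (hps _ (hp m) T))
      ((hGs T (right_mem_Icc.2 htT)).sub (hps _ (hp n) T)) one_le_two
  have hcauchy : CauchySeq N := by
    rw [EMetric.cauchySeq_iff]
    intro ε hε
    have h1 : Tendsto (fun n => (D : ℝ≥0∞) * e n) atTop (𝓝 0) := by
      have := ENNReal.Tendsto.const_mul (a := (D : ℝ≥0∞)) hlim (Or.inr ENNReal.coe_ne_top)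
      rwa [mul_zero] at this
    obtain ⟨n₀, hn₀⟩ := eventually_atTop.1 (h1.eventually_lt_const (ENNReal.half_pos hε.ne'))
    refine ⟨n₀, fun m hm n hn => (hdist m n).trans_lt ?_⟩
    rw [mul_add, ← ENNReal.add_halves ε]
    exact ENNReal.add_lt_add (hn₀ m hm) (hn₀ n hn)
  obtain ⟨M, hM⟩ := cauchySeq_tendsto_of_complete hcauchy
  refine ⟨M, fun q hq s => ?_⟩
  have hMN : Tendsto (fun n => edist M (N n)) atTop (𝓝 0) := by
    have := tendsto_iff_edist_tendsto_0.1 hM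
    simpa only [edist_comm] using this
  set c := eLpNorm (fun r => G r - q.2 r) 2 (volume.restrict (Ioc t s)) with hc
  -- The splitting `M - q = (M - N n) + (p n - q)` bounds the left-hand side by this expression for
  -- every `n`.
  have hlim2 : Tendsto (fun n => edist M (N n) + D * (e n + c)) atTop (𝓝 (0 + D * (0 + c))) :=
    hMN.add (ENNReal.Tendsto.const_mul (hlim.add tendsto_const_nhds) (Or.inr ENNReal.coe_ne_top))
  rw [zero_add, zero_add] at hlim2
  refine ge_of_tendsto' hlim2 fun n => ?_
  have h1 : (fun ω => M ω s - q.1 s ω) =ᵐ[P]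
      (fun ω => (M - N n : Lp C(Icc t T, ℝ) 2 P) ω s) + (p n - q).1 s := by
    filter_upwards [hNcoe n, Lp.coeFn_sub M (N n)] with ω h1 h2
    simp only [Pi.add_apply]
    rw [h2, Pi.sub_apply, h1]
    simp [elemC]
  rw [eLpNorm_congr_ae h1]
  refine (eLpNorm_add_le (aestronglyMeasurable_eval (Lp.aestronglyMeasurable _) s)
    ((elementary_adapted h.adapted (sub_mem (hp n) hq) s.2).mono (F.le _)).aestronglyMeasurable
    one_le_two).trans (add_le_add ?_ ?_)
  · refine (eLpNorm_eval_le _ s).trans_eq ?_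
    rw [Lp.edist_def]
    exact eLpNorm_congr_ae (Lp.coeFn_sub _ _)
  · refine (h.eLpNorm_le (sub_mem (hp n) hq) s.2).trans ?_
    gcongr
    have h2 : (p n - q).2 = (fun r => G r - q.2 r) - fun r => G r - (p n).2 r := by
      funext r; simp
    rw [h2, add_comm]
    refine (eLpNorm_sub_le ((hGs s s.2).sub (hps _ hq s))
      ((hGs s s.2).sub (hps _ (hp n) s)) one_le_two).trans (add_le_add le_rfl ?_)
    exact eLpNorm_mono_measure _ (Measure.restrict_mono (Ioc_subset_Ioc_right s.2.2) le_rfl)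

variable {D : ℝ≥0} {G G' : ℝ → Lp ℝ 2 P} {M M' : Lp C(Icc t T, ℝ) 2 P}

theorem IsIntegral.tendsto_elementary (h : IsIntegral P F V t T D G M) (s : Icc t T)
    {p : ℕ → (ℝ → Ω → ℝ) × (ℝ → Lp ℝ 2 P)} (hp : ∀ n, p n ∈ elementary P F V t T)
    (hlim : Tendsto (fun n => eLpNorm (fun r => G r - (p n).2 r) 2 (volume.restrict (Ioc t s)))
      atTop (𝓝 0)) :
    Tendsto (fun n => eLpNorm (fun ω => M ω s - (p n).1 s ω) 2 P) atTop (𝓝 0) := by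
  have h1 := ENNReal.Tendsto.const_mul (a := (D : ℝ≥0∞)) hlim (Or.inr ENNReal.coe_ne_top)
  rw [mul_zero] at h1
  exact tendsto_of_tendsto_of_tendsto_of_le_of_le tendsto_const_nhds h1 (fun _ => zero_le)
    fun n => h (p n) (hp n) s

/-- The integral is the `L²`-limit of left-endpoint Riemann sums. -/
theorem IsIntegral.tendsto_riemann (h : IsIntegral P F V t T D G M)
    (hG : ContinuousOn G (Icc t T)) (hGm : ∀ s ∈ Icc t T, AEStronglyMeasurable[F s] (G s) P)
    (s : Icc t T) :
    Tendsto (fun n : ℕ => eLpNorm (fun ω => M ω s - ∑ j ∈ Finset.range n,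
      G (t + j * ((s - t) / n)) ω *
        (V (t + (j + 1) * ((s - t) / n)) ω - V (t + j * ((s - t) / n)) ω)) 2 P) atTop (𝓝 0) := by
  obtain ⟨p, hp, hlim, hp1⟩ := exists_elementary_seq (V := V) hG hGm s.2
  refine (h.tendsto_elementary s hp hlim).congr fun n => eLpNorm_congr_ae ?_
  filter_upwards [hp1 n] with ω h1
  rw [h1]

/-- Both integrals are compared with the same elementary approximations of `G`; in the limit only
the distance of the integrands remains. This also determines the integral uniquely. -/
theorem IsIntegral.eLpNorm_sub_le (hV : ∀ s ∈ Icc t T, StronglyMeasurable[F s] (V s))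
    (h : IsIntegral P F V t T D G M)
    (h' : IsIntegral P F V t T D G' M') (hG : ContinuousOn G (Icc t T))
    (hG' : ContinuousOn G' (Icc t T)) (hGm : ∀ s ∈ Icc t T, AEStronglyMeasurable[F s] (G s) P)
    (s : Icc t T) :
    eLpNorm (fun ω => M ω s - M' ω s) 2 P ≤
      D * eLpNorm (fun r => G r - G' r) 2 (volume.restrict (Ioc t s)) := by
  obtain ⟨p, hp, hlim, -⟩ := exists_elementary_seq (V := V) hG hGm s.2
  have hmeas : ∀ {H : ℝ → Lp ℝ 2 P}, ContinuousOn H (Icc t T) →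
      AEStronglyMeasurable H (volume.restrict (Ioc t s)) := fun hH =>
    (hH.mono (Ioc_subset_Icc_self.trans (Icc_subset_Icc_right s.2.2))).aestronglyMeasurable
      measurableSet_Ioc
  set c := eLpNorm (fun r => G r - G' r) 2 (volume.restrict (Ioc t s)) with hc
  have hlim2 : Tendsto (fun n => eLpNorm (fun ω => M ω s - (p n).1 s ω) 2 P +
      D * (eLpNorm (fun r => G r - (p n).2 r) 2 (volume.restrict (Ioc t s)) + c)) atTop
      (𝓝 (0 + D * (0 + c))) :=
    (h.tendsto_elementary s hp hlim).add (ENNReal.Tendsto.const_mul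
      (hlim.add tendsto_const_nhds) (Or.inr ENNReal.coe_ne_top))
  rw [zero_add, zero_add] at hlim2
  refine ge_of_tendsto' hlim2 fun n => ?_
  have hpm : AEStronglyMeasurable ((p n).1 s) P :=
    ((elementary_adapted hV (hp n) s.2).mono (F.le _)).aestronglyMeasurable
  have h1 : (fun ω => M ω s - M' ω s) =
      (fun ω => M ω s - (p n).1 s ω) - fun ω => M' ω s - (p n).1 s ω := by
    funext ω; simp
  rw [h1]
  refine (MeasureTheory.eLpNorm_sub_le
    ((aestronglyMeasurable_eval (Lp.aestronglyMeasurable _) s).sub hpm)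
    ((aestronglyMeasurable_eval (Lp.aestronglyMeasurable _) s).sub hpm) one_le_two).trans
    (add_le_add le_rfl ((h' (p n) (hp n) s).trans ?_))
  gcongr
  have h2 : (fun r => G' r - (p n).2 r) = (fun r => G r - (p n).2 r) - fun r => G r - G' r := by
    funext r; simp
  rw [h2]
  exact MeasureTheory.eLpNorm_sub_le ((hmeas hG).sub
    (elementary_integrand (hp n)).1.aestronglyMeasurable) ((hmeas hG).sub (hmeas hG')) one_le_two

/-- The value of a random path at time `s`, extended by constants. -/
noncomputable def evalLp (htT : t ≤ T) (M : Lp C(Icc t T, ℝ) 2 P) (s : ℝ) : Lp ℝ 2 P :=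
  (ContinuousMap.evalCLM ℝ (projIcc t T htT s)).compLp M

theorem coeFn_evalLp (htT : t ≤ T) (M : Lp C(Icc t T, ℝ) 2 P) (s : ℝ) :
    evalLp htT M s =ᵐ[P] fun ω => M ω (projIcc t T htT s) :=
  ContinuousLinearMap.coeFn_compLp' _ _

/-- Elementary integrals are adapted, and almost everywhere measurability with respect to `F s` is a
closed condition in `L²`. -/
theorem IsIntegral.aestronglyMeasurable {C : ℝ≥0} (h0 : IsIntegrator P F V t T C)
    (h : IsIntegral P F V t T D G M) (hG : ContinuousOn G (Icc t T))
    (hGm : ∀ s ∈ Icc t T, AEStronglyMeasurable[F s] (G s) P) (s : Icc t T) :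
    AEStronglyMeasurable[F s] (fun ω => M ω s) P := by
  obtain ⟨p, hp, hlim, -⟩ := exists_elementary_seq (V := V) hG hGm s.2
  have hpm : ∀ n, MemLp ((p n).1 s) 2 P := fun n =>
    ⟨((elementary_adapted h0.adapted (hp n) s.2).mono (F.le _)).aestronglyMeasurable,
      (h0.eLpNorm_le (hp n) s.2).trans_lt
        (ENNReal.mul_lt_top ENNReal.coe_lt_top (elementary_memLp_integrand (hp n) s).2)⟩
  have htT : t ≤ T := s.2.1.trans s.2.2
  have hev : evalLp htT M s =ᵐ[P] fun ω => M ω s := by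
    have := coeFn_evalLp htT M s
    rwa [projIcc_val] at this
  have h1 : Tendsto (fun n => (hpm n).toLp _) atTop (𝓝 (evalLp htT M s)) := by
    refine tendsto_iff_edist_tendsto_0.2 ((h.tendsto_elementary s hp hlim).congr fun n => ?_)
    rw [edist_comm, Lp.edist_def]
    refine eLpNorm_congr_ae ?_
    filter_upwards [hev, (hpm n).coeFn_toLp] with ω e1 e2
    rw [Pi.sub_apply, e1, e2]
  have h2 := (isClosed_aestronglyMeasurable (F := ℝ) (p := 2) (μ := P) (F.le s)).mem_of_tendsto h1
    (Eventually.of_forall fun n => ((elementary_adapted h0.adapted (hp n)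
      s.2).aestronglyMeasurable).congr (hpm n).coeFn_toLp.symm)
  exact AEStronglyMeasurable.congr h2 hev

/-- The defining estimate at `s = t`, against the zero elementary integral, involves an empty time
interval. -/
theorem IsIntegral.start (h : IsIntegral P F V t T D G M) (htT : t ≤ T) :
    (fun ω => M ω ⟨t, left_mem_Icc.2 htT⟩) =ᵐ[P] 0 := by
  have h1 := h 0 (zero_mem _) ⟨t, left_mem_Icc.2 htT⟩
  simp only [Ioc_self, Measure.restrict_empty, eLpNorm_measure_zero, mul_zero, Prod.fst_zero,
    Pi.zero_apply, sub_zero, nonpos_iff_eq_zero] at h1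
  exact (eLpNorm_eq_zero_iff (aestronglyMeasurable_eval (Lp.aestronglyMeasurable _) _)
    two_ne_zero).1 h1

theorem continuous_toLp_of_dominated {f : ℝ → Ω → ℝ} (hf : ∀ r, MemLp (f r) 2 P) {g : Ω → ℝ}
    (hg : MemLp g 2 P) (hfg : ∀ r ω, ‖f r ω‖ₑ ≤ ‖g ω‖ₑ) (hc : ∀ ω, Continuous fun r => f r ω) :
    Continuous fun r => (hf r).toLp (f r) := by
  refine continuous_iff_continuousAt.2 fun s => ?_
  refine tendsto_iff_edist_tendsto_0.2 ?_
  have key : Tendsto (fun r => ∫⁻ ω, ‖f r ω - f s ω‖ₑ ^ 2 ∂P) (𝓝 s) (𝓝 (∫⁻ _, 0 ∂P)) := by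
    refine tendsto_lintegral_filter_of_dominated_convergence' (fun ω => (2 * ‖g ω‖ₑ) ^ 2)
      (Eventually.of_forall fun r => ((hf r).1.sub (hf s).1).enorm.pow_const 2)
      (Eventually.of_forall fun r => Eventually.of_forall fun ω => ?_) ?_
      (Eventually.of_forall fun ω => ?_)
    · gcongr
      rw [two_mul]
      exact enorm_sub_le.trans (add_le_add (hfg r ω) (hfg s ω))
    · simp only [mul_pow]
      rw [lintegral_const_mul' _ _ (by simp), ← eLpNorm_two_sq]
      exact (ENNReal.mul_lt_top (by simp) (ENNReal.pow_lt_top hg.2)).ne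
    · have h2 := (continuous_enorm.tendsto _).comp (((hc ω).tendsto s).sub_const (f s ω))
      have h3 := (ENNReal.continuous_pow 2).tendsto _ |>.comp h2
      simp only [sub_self, enorm_zero, zero_pow two_ne_zero] at h3
      exact h3
  rw [lintegral_zero] at key
  have h2 := (ENNReal.continuous_rpow_const (y := (1 / 2 : ℝ))).tendsto _ |>.comp key
  rw [ENNReal.zero_rpow_of_pos (by norm_num)] at h2
  refine h2.congr fun r => ?_
  rw [Lp.edist_toLp_toLp, Function.comp_apply]
  have h3 := eLpNorm_two_sq (f r - f s) P
  simp only [Pi.sub_apply] at h3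
  rw [← h3, ← ENNReal.rpow_natCast, ← ENNReal.rpow_mul]
  simp

theorem memLp_eval {M : Ω → C(Icc t T, ℝ)} (hM : MemLp M 2 P) (s : Icc t T) :
    MemLp (fun ω => M ω s) 2 P :=
  ⟨aestronglyMeasurable_eval hM.1 s, (eLpNorm_eval_le M s).trans_lt hM.2⟩

theorem continuous_evalLp (htT : t ≤ T) (M : Lp C(Icc t T, ℝ) 2 P) :
    Continuous (evalLp htT M) := by
  have h1 : evalLp htT M = fun s => (memLp_eval (Lp.memLp M) (projIcc t T htT s)).toLp _ := by
    funext s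
    refine Lp.ext ?_
    exact (coeFn_evalLp htT M s).trans (MemLp.coeFn_toLp _).symm
  rw [h1]
  refine continuous_toLp_of_dominated (f := fun s ω => M ω (projIcc t T htT s)) _
    (Lp.memLp M).norm (fun r ω => ?_) fun ω => (M ω).continuous.comp continuous_projIcc
  rw [enorm_norm]
  exact enorm_apply_le _ _

end Integral

theorem IsIntegrator.mono {Ω : Type*} {mΩ : MeasurableSpace Ω} {P : Measure Ω}
    {F : Filtration ℝ mΩ} {V : ℝ → Ω → ℝ} {t T : ℝ} {C C' : ℝ≥0}
    (h : IsIntegrator P F V t T C) (hC : C ≤ C') : IsIntegrator P F V t T C' where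
  continuous := h.continuous
  adapted := h.adapted
  bound p hp s hs := (h.bound p hp s hs).trans (by gcongr)

/-- One step of the iteration that produces the factorial in the Picard estimate. -/
theorem lintegral_ofReal_pow {t s : ℝ} (hts : t ≤ s) {K : ℝ} (hK : 0 ≤ K) (N : ℕ) :
    ENNReal.ofReal K * ∫⁻ r in Ioc t s, ENNReal.ofReal ((K * (r - t)) ^ N / N.factorial) =
      ENNReal.ofReal ((K * (s - t)) ^ (N + 1) / (N + 1).factorial) := by
  rw [← ofReal_integral_eq_lintegral_ofReal, ← ENNReal.ofReal_mul hK,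
    ← intervalIntegral.integral_of_le hts]
  · congr 1
    have : ∀ r, (K * (r - t)) ^ N / N.factorial = K ^ N / N.factorial * (r - t) ^ N := fun r => by
      rw [mul_pow]; ring
    simp only [this]
    rw [intervalIntegral.integral_const_mul,
      intervalIntegral.integral_comp_sub_right (fun r => r ^ N), integral_pow, sub_self,
      Nat.factorial_succ, mul_pow, zero_pow N.succ_ne_zero]
    push_cast
    field_simp
    ring
  · exact (Continuous.integrableOn_Icc (by fun_prop)).mono_set Ioc_subset_Icc_self
  · refine (ae_restrict_iff' measurableSet_Ioc).2 (Eventually.of_forall fun r hr => ?_)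
    have := mul_nonneg hK (sub_nonneg.2 hr.1.le)
    simp only [Pi.zero_apply]
    positivity

theorem edist_apply_le {X E : Type*} [TopologicalSpace X] [CompactSpace X] [PseudoMetricSpace E]
    (f g : C(X, E)) (x : X) : edist (f x) (g x) ≤ edist f g := by
  rw [ContinuousMap.edist_eq_iSup]
  exact le_iSup (fun x => edist (f x) (g x)) x

/-! ## Existence for stochastic differential equations in `L²` -/

/-- Picard iteration on the adapted elements of `C([t,T]; L²)`. The coefficients `A` act on random
variables, not on their values, so that a dependence on the law is included. -/
theorem exists_sde_solution {Ω : Type*} {mΩ : MeasurableSpace Ω} {P : Measure Ω}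
    [IsFiniteMeasure P] {F : Filtration ℝ mΩ} {t T : ℝ} (htT : t ≤ T) {J : Type*} [Fintype J]
    {d : ℕ} {V : J → ℝ → Ω → ℝ} {C : ℝ≥0} (hV : ∀ j, IsIntegrator P F (V j) t T C)
    {A : J → Fin d → ℝ → (Fin d → Lp ℝ 2 P) → Lp ℝ 2 P} {L : ℝ≥0}
    (hAL : ∀ j i, ∀ r ∈ Icc t T, LipschitzWith L (A j i r))
    (hAc : ∀ j i X, ContinuousOn (fun r => A j i r X) (Icc t T))
    (hAm : ∀ j i, ∀ r ∈ Icc t T, ∀ X, (∀ i, AEStronglyMeasurable[F r] (X i) P) →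
      AEStronglyMeasurable[F r] (A j i r X) P)
    (x₀ : Fin d → Lp ℝ 2 P) (hx₀ : ∀ i, AEStronglyMeasurable[F t] (x₀ i) P) :
    ∃ (X : ℝ → Fin d → Lp ℝ 2 P) (M : J → Fin d → Lp C(Icc t T, ℝ) 2 P),
      Continuous X ∧ (∀ s ∈ Icc t T, ∀ i, AEStronglyMeasurable[F s] (X s i) P) ∧
      (∀ j i, IsIntegral P F (V j) t T (NNReal.sqrt C) (fun r => A j i r (X r)) (M j i)) ∧
      ∀ s i, X s i = x₀ i + ∑ j, evalLp htT (M j i) s := by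
  set D := NNReal.sqrt C with hD
  -- Adaptedness is a closed condition, so the fixed point can be sought in this complete subspace.
  let S : Set C(Icc t T, Fin d → Lp ℝ 2 P) :=
    {X | ∀ (s : Icc t T) i, AEStronglyMeasurable[F s] (X s i) P}
  have hSc : IsClosed S := by
    have : S = ⋂ s : Icc t T, ⋂ i, (fun X : C(Icc t T, Fin d → Lp ℝ 2 P) => X s i) ⁻¹'
        {x | AEStronglyMeasurable[F s] x P} := by ext X; simp [S]
    rw [this]
    exact isClosed_iInter fun s => isClosed_iInter fun i =>
      (isClosed_aestronglyMeasurable (F.le s)).preimage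
        ((continuous_apply i).comp (continuous_eval_const s))
  let G : C(Icc t T, Fin d → Lp ℝ 2 P) → J → Fin d → ℝ → Lp ℝ 2 P :=
    fun X j i r => A j i r (X (projIcc t T htT r))
  have hGc : ∀ X j i, ContinuousOn (G X j i) (Icc t T) := by
    intro X j i
    have h1 : ContinuousOn (fun q : (Fin d → Lp ℝ 2 P) × ℝ => A j i q.2 q.1)
        (univ ×ˢ Icc t T) :=
      continuousOn_prod_of_continuousOn_lipschitzOnWith _ L (fun X _ => hAc j i X)
        (fun r hr => (hAL j i r hr).lipschitzOnWith)
    exact h1.comp (f := fun r => (X (projIcc t T htT r), r))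
      ((X.continuous.comp continuous_projIcc).prodMk continuous_id).continuousOn
      (fun r hr => ⟨mem_univ _, hr⟩)
  have hGm : ∀ X ∈ S, ∀ j i, ∀ s ∈ Icc t T, AEStronglyMeasurable[F s] (G X j i s) P := by
    intro X hX j i s hs
    refine hAm j i s hs _ fun i => ?_
    have : AEStronglyMeasurable[F s] (X ⟨s, hs⟩ i) P := hX ⟨s, hs⟩ i
    rwa [← projIcc_of_mem htT hs] at this
  -- The integral is constructed for adapted `X` only; for other `X` an arbitrary value is chosen.
  have hM : ∀ X j i, ∃ M, X ∈ S → IsIntegral P F (V j) t T D (G X j i) M := by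
    intro X j i
    by_cases hX : X ∈ S
    · obtain ⟨M, hM⟩ := (hV j).exists_isIntegral htT (hGc X j i) (hGm X hX j i)
      exact ⟨M, fun _ => hM⟩
    · exact ⟨0, fun h => absurd h hX⟩
  choose M hM using hM
  let Φ₀ : C(Icc t T, Fin d → Lp ℝ 2 P) → C(Icc t T, Fin d → Lp ℝ 2 P) := fun X =>
    ⟨fun s i => x₀ i + ∑ j, evalLp htT (M X j i) s, continuous_pi fun i =>
      continuous_const.add (continuous_finsetSum _ fun j _ =>
        (continuous_evalLp htT _).comp continuous_subtype_val)⟩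
  have hev : ∀ X ∈ S, ∀ j i, ∀ s : Icc t T, AEStronglyMeasurable[F s] (evalLp htT (M X j i) s) P := by
    intro X hX j i s
    refine ((hM X j i hX).aestronglyMeasurable (hV j) (hGc X j i) (hGm X hX j i) s).congr ?_
    have := coeFn_evalLp htT (M X j i) s
    rw [projIcc_val] at this
    exact this.symm
  have hΦS : ∀ X ∈ S, Φ₀ X ∈ S := by
    intro X hX s i
    have h1 : AEStronglyMeasurable[F s] (⇑(x₀ i) + ∑ j, ⇑(evalLp htT (M X j i) s)) P :=
      ((hx₀ i).mono (F.mono s.2.1)).add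
        (Finset.sum_induction _ (fun f => AEStronglyMeasurable[F s] f P) (fun _ _ e1 e2 => e1.add e2)
          aestronglyMeasurable_const fun j _ => hev X hX j i s)
    refine h1.congr ?_
    refine ((Lp.coeFn_add _ _).trans (EventuallyEq.rfl.add ?_)).symm
    exact Lp.coeFn_finsetSum _ _
  let Φ : S → S := fun X => ⟨Φ₀ X, hΦS X X.2⟩
  set κ : ℝ≥0 := Fintype.card J * (D * L) with hκ
  have hstep : ∀ (X Y : S) (s : Icc t T), edist ((Φ X).1 s) ((Φ Y).1 s) ^ 2 ≤
      ENNReal.ofReal (κ ^ 2 : ℝ≥0) * ∫⁻ r in Ioc t s, edist (X.1 (projIcc t T htT r))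
        (Y.1 (projIcc t T htT r)) ^ 2 := by
    intro X Y s
    have h1 : ∫⁻ r in Ioc t s, edist (X.1 (projIcc t T htT r)) (Y.1 (projIcc t T htT r)) ^ 2 =
        eLpNorm (fun r => X.1 (projIcc t T htT r) - Y.1 (projIcc t T htT r)) 2
          (volume.restrict (Ioc t s)) ^ 2 := by
      rw [eLpNorm_two_sq]
      simp only [edist_eq_enorm_sub]
    rw [h1, ENNReal.ofReal_coe_nnreal, ENNReal.coe_pow, ← mul_pow]
    refine pow_le_pow_left' (edist_pi_le_iff.2 fun i => ?_) 2
    have h2 : ∀ j, ‖evalLp htT (M X j i) s - evalLp htT (M Y j i) s‖ₑ ≤ (D * L : ℝ≥0) *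
        eLpNorm (fun r => X.1 (projIcc t T htT r) - Y.1 (projIcc t T htT r)) 2
          (volume.restrict (Ioc t s)) := by
      intro j
      have h3 : ‖evalLp htT (M X j i) s - evalLp htT (M Y j i) s‖ₑ =
          eLpNorm (fun ω => M X j i ω s - M Y j i ω s) 2 P := by
        rw [Lp.enorm_def]
        refine eLpNorm_congr_ae ((Lp.coeFn_sub _ _).trans ?_)
        have e1 := coeFn_evalLp htT (M X j i) s
        have e2 := coeFn_evalLp htT (M Y j i) s
        rw [projIcc_val] at e1 e2
        exact e1.sub e2
      rw [h3, ENNReal.coe_mul, mul_assoc]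
      refine (IsIntegral.eLpNorm_sub_le (hV j).adapted (hM X j i X.2) (hM Y j i Y.2)
        (hGc X j i) (hGc Y j i) (hGm X X.2 j i) s).trans ?_
      gcongr
      have := eLpNorm_le_nnreal_smul_eLpNorm_of_ae_le_mul (c := L)
        (μ := volume.restrict (Ioc t s)) (f := fun r => G X j i r - G Y j i r)
        (g := fun r => X.1 (projIcc t T htT r) - Y.1 (projIcc t T htT r)) (p := 2) ?_
      · exact this
      · refine (ae_restrict_iff' measurableSet_Ioc).2 (Eventually.of_forall fun r hr => ?_)
        have := (hAL j i r ⟨hr.1.le, hr.2.trans s.2.2⟩).dist_le_mul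
          (X.1 (projIcc t T htT r)) (Y.1 (projIcc t T htT r))
        rw [dist_eq_norm, dist_eq_norm] at this
        exact this
    have h4 : edist ((Φ X).1 s i) ((Φ Y).1 s i) =
        ‖∑ j, (evalLp htT (M X j i) s - evalLp htT (M Y j i) s)‖ₑ := by
      rw [Finset.sum_sub_distrib, ← edist_eq_enorm_sub]
      exact edist_add_left _ _ _
    rw [h4]
    refine (enorm_sum_le _ _).trans ((Finset.sum_le_sum fun j _ => h2 j).trans_eq ?_)
    rw [Finset.sum_const, Finset.card_univ, nsmul_eq_mul, hκ]
    push_cast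
    ring
  have hiter : ∀ (N : ℕ) (X Y : S) (s : Icc t T),
      edist ((Φ^[N] X).1 s) ((Φ^[N] Y).1 s) ^ 2 ≤
        ENNReal.ofReal (((κ ^ 2 : ℝ≥0) * (s - t)) ^ N / N.factorial) * edist X Y ^ 2 := by
    intro N X Y
    induction N with
    | zero =>
      intro s
      simp only [Function.iterate_zero, id, pow_zero, Nat.factorial_zero, Nat.cast_one, div_one,
        ENNReal.ofReal_one, one_mul]
      exact pow_le_pow_left' (edist_apply_le X.1 Y.1 s) 2
    | succ N ih =>
      intro s
      rw [Function.iterate_succ_apply', Function.iterate_succ_apply']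
      refine (hstep _ _ s).trans ?_
      rw [← lintegral_ofReal_pow s.2.1 (NNReal.coe_nonneg (κ ^ 2)), mul_assoc, ← lintegral_mul_const']
      · gcongr 1
        refine setLIntegral_mono' measurableSet_Ioc fun r hr => ?_
        have hr' : r ∈ Icc t T := ⟨hr.1.le, hr.2.trans s.2.2⟩
        rw [projIcc_of_mem htT hr']
        exact ih ⟨r, hr'⟩
      · exact ENNReal.pow_ne_top (edist_ne_top _ _)
  -- The estimate concerns squared distances, hence `1 / 4` for a contraction factor `1 / 2`. The
  -- factorial makes some iterate a contraction on an interval of any length.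
  obtain ⟨N, hN⟩ : ∃ N : ℕ, ((κ ^ 2 : ℝ≥0) * (T - t)) ^ N / N.factorial < 1 / 4 :=
    ((FloorSemiring.tendsto_pow_div_factorial_atTop _).eventually_lt_const (by norm_num)).exists
  have hcontr : ContractingWith (1 / 2 : ℝ≥0) (Φ^[N]) := by
    refine ⟨by norm_num, fun X Y => ?_⟩
    have : ∀ s, edist ((Φ^[N] X).1 s) ((Φ^[N] Y).1 s) ≤ (1 / 2 : ℝ≥0) * edist X Y := by
      intro s
      rw [← ENNReal.pow_le_pow_left_iff two_ne_zero, mul_pow]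
      refine (hiter N X Y s).trans (mul_le_mul_left ?_ _)
      rw [← ENNReal.coe_pow, ← ENNReal.ofReal_coe_nnreal]
      refine ENNReal.ofReal_le_ofReal (le_trans ?_ (hN.le.trans (by norm_num)))
      have := s.2.2
      have := s.2.1
      gcongr
    rw [Subtype.edist_eq, ContinuousMap.edist_eq_iSup]
    exact iSup_le this
  have : Nonempty S := by
    refine ⟨⟨0, fun s i => ?_⟩⟩
    have h0 : AEStronglyMeasurable[F s] (fun _ : Ω => (0 : ℝ)) P := aestronglyMeasurable_const
    exact h0.congr (Lp.coeFn_zero ℝ 2 P).symm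
  have : CompleteSpace S := hSc.completeSpace_coe
  -- The unique fixed point of the iterate is also fixed by `Φ`.
  have hfix := hcontr.isFixedPt_fixedPoint_iterate
  set X := ContractingWith.fixedPoint Φ^[N] hcontr with hX
  refine ⟨fun s => X.1 (projIcc t T htT s), M X, X.1.continuous.comp continuous_projIcc, ?_,
    fun j i => hM X j i X.2, ?_⟩
  · intro s hs i
    have : AEStronglyMeasurable[F s] (X.1 ⟨s, hs⟩ i) P := X.2 ⟨s, hs⟩ i
    rw [← projIcc_of_mem htT hs] at this
    exact this
  · intro s i
    have h1 : (Φ X).1 (projIcc t T htT s) i = X.1 (projIcc t T htT s) i := by rw [hfix]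
    refine h1.symm.trans ?_
    simp only [Φ, Φ₀, ContinuousMap.coe_mk, evalLp, projIcc_val]

/-! ## Brownian motion with an independent initial condition -/

theorem memLp_of_map_gaussianReal {Ω : Type*} [MeasurableSpace Ω] {P : Measure Ω} {X : Ω → ℝ}
    (hX : Measurable X) {v : ℝ≥0} (h : P.map X = gaussianReal 0 v) :
    MemLp X 2 P ∧ ∫ ω, X ω ∂P = 0 ∧ ∫ ω, X ω ^ 2 ∂P = v := by
  have h1 : MemLp id 2 (P.map X) := h ▸ memLp_id_gaussianReal' 2 (by simp)
  refine ⟨(memLp_map_measure_iff aestronglyMeasurable_id hX.aemeasurable).1 h1, ?_, ?_⟩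
  · rw [← integral_id_gaussianReal (μ := 0) (v := v), ← h,
      integral_map (f := fun x => x) hX.aemeasurable (by fun_prop)]
  · have h2 := variance_id_gaussianReal (μ := 0) (v := v)
    rw [variance_of_integral_eq_zero aemeasurable_id (by simp)] at h2
    rw [← h2, ← h, integral_map hX.aemeasurable (by fun_prop)]
    rfl

/-- A `k`-dimensional Brownian motion on `[t,T]` with respect to the filtration `F`. -/
structure IsNoise {Ω : Type*} {mΩ : MeasurableSpace Ω} (P : Measure Ω) (F : Filtration ℝ mΩ)
    (t T : ℝ) {k : ℕ} (W : ℝ → Ω → Fin k → ℝ) : Prop where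
  adapted : ∀ r s, r ≤ s → Measurable[F s] (W r)
  continuous : ∀ ω, Continuous fun s => W s ω
  const_left : ∀ ω, ∀ s ≤ t, W s ω = W t ω
  const_right : ∀ ω, ∀ s ≥ T, W s ω = W T ω
  zero : ∀ᵐ ω ∂P, W t ω = 0
  law : ∀ s r, t ≤ s → s ≤ r → r ≤ T → P.map (fun ω => W r ω - W s ω) =
    Measure.pi (fun _ : Fin k => gaussianReal 0 (r - s).toNNReal)
  indep : ∀ s r, t ≤ s → s ≤ r → r ≤ T →
    Indep (MeasurableSpace.comap (fun ω => W r ω - W s ω) inferInstance) (F s) P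

namespace IsNoise

variable {Ω : Type*} {mΩ : MeasurableSpace Ω} {P : Measure Ω} {F : Filtration ℝ mΩ} {t T : ℝ}
  {k : ℕ} {W : ℝ → Ω → Fin k → ℝ}

theorem measurable (h : IsNoise P F t T W) (s : ℝ) : Measurable (W s) :=
  (h.adapted s s le_rfl).mono (F.le s) le_rfl

theorem isBMWith (h : IsNoise P F t T W) (j : Fin k) :
    IsBMWith P F (fun s ω => W s ω j) t T := by
  have hlaw : ∀ s r, t ≤ s → s ≤ r → r ≤ T →
      P.map (fun ω => W r ω j - W s ω j) = gaussianReal 0 (r - s).toNNReal := by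
    intro s r hs hsr hr
    have e1 := Measure.map_map (μ := P) (measurable_pi_apply j)
      ((h.measurable r).sub (h.measurable s))
    refine e1.symm.trans ?_
    have e2 := h.law s r hs hsr hr
    change (P.map fun ω => W r ω - W s ω).map _ = _
    rw [e2]
    exact (measurePreserving_eval (fun _ : Fin k => gaussianReal 0 (r - s).toNNReal) j).map_eq
  have hmeas : ∀ s r, Measurable fun ω => W r ω j - W s ω j := fun s r =>
    ((measurable_pi_apply j).comp (h.measurable r)).sub
      ((measurable_pi_apply j).comp (h.measurable s))
  exact
  { continuous := fun ω => (continuous_apply j).comp (h.continuous ω)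
    adapted := fun s _ =>
      ((measurable_pi_apply j).comp (h.adapted s s le_rfl)).stronglyMeasurable
    memLp := fun s r hs hsr hr => (memLp_of_map_gaussianReal (hmeas s r) (hlaw s r hs hsr hr)).1
    mean := fun s r hs hsr hr => (memLp_of_map_gaussianReal (hmeas s r) (hlaw s r hs hsr hr)).2.1
    var := fun s r hs hsr hr => by
      rw [(memLp_of_map_gaussianReal (hmeas s r) (hlaw s r hs hsr hr)).2.2,
        Real.coe_toNNReal _ (by linarith)]
    indep := fun s r hs hsr hr Y hY => by
      have h1 : IndepFun (fun ω => W r ω - W s ω) Y P := by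
        rw [IndepFun_iff_Indep]
        exact indep_of_indep_of_le_right (h.indep s r hs hsr hr)
          (Measurable.comap_le (m₁ := F s) hY.measurable)
      exact (h1.comp (measurable_pi_apply j) measurable_id).symm }

end IsNoise

section Noise

variable {Ω : Type*} [mΩ : MeasurableSpace Ω] {P : Measure Ω} {t T : ℝ} {k : ℕ}
  {W : ℝ → Ω → Fin k → ℝ} {E : Type*} [mE : MeasurableSpace E] {π : Measure E}

/-- The filtration generated by `W` and an initial condition. -/
def noiseFiltration (E : Type*) [MeasurableSpace E] (hW : ∀ s, Measurable (W s)) :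
    Filtration ℝ (inferInstance : MeasurableSpace (Ω × E)) where
  seq s := MeasurableSpace.comap (fun ω => ((fun q : Iic s => W q ω.1), ω.2)) inferInstance
  mono' s r hsr := by
    have h : (fun ω : Ω × E => ((fun q : Iic s => W q ω.1), ω.2)) =
        (fun p : (Iic r → Fin k → ℝ) × E => ((fun q : Iic s => p.1 ⟨q, q.2.trans hsr⟩), p.2)) ∘
          fun ω => ((fun q : Iic r => W q ω.1), ω.2) := rfl
    simp only
    rw [h, ← MeasurableSpace.comap_comp]
    refine MeasurableSpace.comap_mono (Measurable.comap_le ?_)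
    exact (measurable_pi_lambda _ fun q => (measurable_pi_apply _).comp measurable_fst).prodMk
      measurable_snd
  le' s := Measurable.comap_le (Measurable.prodMk (measurable_pi_lambda
    (fun (ω : Ω × E) (q : Iic s) => W q ω.1) fun q => (hW q).comp measurable_fst) measurable_snd)

theorem measurable_noiseFiltration (hW : ∀ s, Measurable (W s)) (s : ℝ) :
    Measurable[noiseFiltration E hW s] (fun ω : Ω × E => ((fun q : Iic s => W q ω.1), ω.2)) :=
  comap_measurable _

theorem measurable_noiseFiltration_snd (hW : ∀ s, Measurable (W s)) (s : ℝ) :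
    Measurable[noiseFiltration E hW s] (Prod.snd : Ω × E → E) :=
  Measurable.comp (g := fun p : (Iic s → Fin k → ℝ) × E => p.2) measurable_snd (measurable_noiseFiltration hW s)

theorem measurable_noiseFiltration_fst (hW : ∀ s, Measurable (W s)) {r s : ℝ} (hrs : r ≤ s) :
    Measurable[noiseFiltration E hW s] (fun ω : Ω × E => W r ω.1) :=
  Measurable.comp (g := fun p : (Iic s → Fin k → ℝ) × E => p.1 ⟨r, hrs⟩)
    ((measurable_pi_apply _).comp measurable_fst) (measurable_noiseFiltration hW s)

variable [IsProbabilityMeasure P] [IsProbabilityMeasure π]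

/-- The initial condition lives on a second factor. The joint law of increment, past and initial
condition is thus a product of three measures, to be bracketed differently. -/
theorem IsBrownianOn.indep_noiseFiltration (h : IsBrownianOn P t T W) {s r : ℝ} (hs : t ≤ s)
    (hsr : s ≤ r) (hr : r ≤ T) :
    Indep (MeasurableSpace.comap (fun ω : Ω × E => W r ω.1 - W s ω.1) inferInstance)
      (noiseFiltration E h.measurable s) (P.prod π) := by
  set X₀ : Ω → Fin k → ℝ := fun ω => W r ω - W s ω with hX₀
  set U₀ : Ω → Iic s → Fin k → ℝ := fun ω q => W q ω with hU₀
  have hX : Measurable X₀ := (h.measurable r).sub (h.measurable s)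
  have hU : Measurable U₀ := measurable_pi_lambda _ fun q => h.measurable q
  have h1 : IndepFun (fun ω : Ω × E => X₀ ω.1) (fun ω => (U₀ ω.1, ω.2)) (P.prod π) := by
    have hXf : Measurable fun ω : Ω × E => X₀ ω.1 := hX.comp measurable_fst
    have hUf : Measurable fun ω : Ω × E => (U₀ ω.1, ω.2) :=
      (hU.comp measurable_fst).prodMk measurable_snd
    rw [indepFun_iff_map_prod_eq_prod_map_map hXf.aemeasurable hUf.aemeasurable]
    have e1 : (P.prod π).map (fun ω => X₀ ω.1) = P.map X₀ := by
      have := Measure.map_map (μ := P.prod π) hX measurable_fst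
      rw [Measure.map_fst_prod, measure_univ, one_smul] at this
      exact this.symm
    have e2 : (P.prod π).map (fun ω => (U₀ ω.1, ω.2)) = (P.map U₀).prod π := by
      have := Measure.map_prod_map P π hU measurable_id
      rw [Measure.map_id] at this
      exact this.symm
    have e3 : (P.prod π).map (fun ω => ((X₀ ω.1, U₀ ω.1), ω.2)) =
        (P.map fun ω => (X₀ ω, U₀ ω)).prod π := by
      have := Measure.map_prod_map P π (hX.prodMk hU) measurable_id
      rw [Measure.map_id] at this
      exact this.symm
    have : IsProbabilityMeasure (P.map X₀) := Measure.isProbabilityMeasure_map hX.aemeasurable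
    have : IsProbabilityMeasure (P.map U₀) := Measure.isProbabilityMeasure_map hU.aemeasurable
    rw [e1, e2, ← Measure.prodAssoc_prod, ← (indepFun_iff_map_prod_eq_prod_map_map
      hX.aemeasurable hU.aemeasurable).1 (h.indep s r hs hsr hr), ← e3]
    exact (Measure.map_map (MeasurableEquiv.prodAssoc.measurable)
      ((hXf.prodMk (hU.comp measurable_fst)).prodMk measurable_snd)).symm
  rwa [IndepFun_iff_Indep] at h1

theorem IsBrownianOn.isNoise (h : IsBrownianOn P t T W) :
    IsNoise (P.prod π) (noiseFiltration E h.measurable) t T fun s ω => W s ω.1 where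
  adapted _ _ hrs := measurable_noiseFiltration_fst h.measurable hrs
  continuous ω := h.continuous ω.1
  const_left ω := h.const_left ω.1
  const_right ω := h.const_right ω.1
  zero := Measure.quasiMeasurePreserving_fst.ae h.zero
  law s r hs hsr hr := by
    have h1 := Measure.map_map (μ := P.prod π) ((h.measurable r).sub (h.measurable s))
      measurable_fst
    rw [Measure.map_fst_prod, measure_univ, one_smul] at h1
    exact h1.symm.trans (h.law s r hs hsr hr)
  indep _ _ hs hsr hr := h.indep_noiseFiltration hs hsr hr

end Noise

/-! ## McKean-Vlasov coefficients as maps of `L²` -/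

theorem enorm_pi_sq_le {ι : Type*} [Fintype ι] (v : ι → ℝ) : ‖v‖ₑ ^ 2 ≤ ∑ i, ‖v i‖ₑ ^ 2 := by
  have h : ‖v‖ₑ ≤ (∑ i, ‖v i‖ₑ ^ 2) ^ (1 / 2 : ℝ) := by
    rw [← edist_zero_right, edist_pi_le_iff]
    intro i
    rw [Pi.zero_apply, edist_zero_right]
    have h1 : ‖v i‖ₑ ^ 2 ≤ ∑ i, ‖v i‖ₑ ^ 2 :=
      Finset.single_le_sum (f := fun i => ‖v i‖ₑ ^ 2) (fun _ _ => zero_le) (Finset.mem_univ i)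
    have h2 := ENNReal.rpow_le_rpow h1 (show (0 : ℝ) ≤ 1 / 2 by norm_num)
    rwa [← ENNReal.rpow_natCast, ← ENNReal.rpow_mul, Nat.cast_ofNat,
      mul_one_div_cancel two_ne_zero, ENNReal.rpow_one] at h2
  refine (pow_le_pow_left' h 2).trans_eq ?_
  rw [← ENNReal.rpow_natCast, ← ENNReal.rpow_mul, Nat.cast_ofNat,
    one_div_mul_cancel two_ne_zero, ENNReal.rpow_one]

theorem ennreal_add_sq_le (a b : ℝ≥0∞) : (a + b) ^ 2 ≤ 2 * (a ^ 2 + b ^ 2) := by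
  have h := ENNReal.rpow_add_le_mul_rpow_add_rpow a b (p := 2) (by norm_num)
  norm_num at h
  exact h

/-- A scalar coefficient of a McKean-Vlasov equation. -/
structure IsLipCoef {d l : ℕ} (f : ℝ → P2 (State d l) → State d l → ℝ) (L : ℝ≥0) : Prop where
  lip : ∀ r m m' z z', edist (f r m z) (f r m' z') ≤ L * (P2.wass m m' + edist z z')
  cont : ∀ m z, Continuous fun r => f r m z
  bdd : ∀ m, ∃ B, ∀ r, |f r m 0| ≤ B

section Lift

variable {Ω : Type*} {mΩ : MeasurableSpace Ω} {P : Measure Ω} [IsProbabilityMeasure P] {d l : ℕ}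
  {ζ : Ω → Fin l → ℝ}

/-- The random state with components `x` and `ζ`. -/
noncomputable def toState (ζ : Ω → Fin l → ℝ) (x : Fin d → Lp ℝ 2 P) (ω : Ω) : State d l :=
  (fun i => x i ω, ζ ω)

omit [IsProbabilityMeasure P] in
theorem measurable_toState (hζ : Measurable ζ) (x : Fin d → Lp ℝ 2 P) :
    Measurable (toState ζ x) :=
  (measurable_pi_lambda _ fun i => (Lp.stronglyMeasurable (x i)).measurable).prodMk hζ

omit [IsProbabilityMeasure P] in
theorem memLp_toState (hζ : MemLp ζ 2 P) (x : Fin d → Lp ℝ 2 P) : MemLp (toState ζ x) 2 P :=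
  memLp_prod_iff.2 ⟨memLp_pi_iff.2 fun i => Lp.memLp (x i), hζ⟩

/-- The law of the random state with components `x` and `ζ`. -/
noncomputable def lawOf (hζm : Measurable ζ) (hζ : MemLp ζ 2 P) (x : Fin d → Lp ℝ 2 P) : P2 (State d l) :=
  ⟨P.map (toState ζ x), Measure.isProbabilityMeasure_map (measurable_toState hζm x).aemeasurable, by
    rw [lintegral_map (by fun_prop) (measurable_toState hζm x), ← eLpNorm_two_sq]
    exact ENNReal.pow_lt_top (memLp_toState hζ x).2⟩

/-- Both states live on one probability space, so their joint law is a coupling. -/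
theorem wass_lawOf_le (hζm : Measurable ζ) (hζ : MemLp ζ 2 P) (x y : Fin d → Lp ℝ 2 P) :
    P2.wass (lawOf hζm hζ x) (lawOf hζm hζ y) ^ 2 ≤
      ∫⁻ ω, edist (toState ζ x ω) (toState ζ y ω) ^ 2 ∂P := by
  have h := P2.wass_le_of_map (P := P) (m := lawOf hζm hζ x) (m' := lawOf hζm hζ y)
    (measurable_toState hζm x).aemeasurable (measurable_toState hζm y).aemeasurable rfl rfl
  refine (pow_le_pow_left' h 2).trans_eq ?_
  rw [← ENNReal.rpow_natCast, ← ENNReal.rpow_mul, Nat.cast_ofNat,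
    one_div_mul_cancel two_ne_zero, ENNReal.rpow_one]

omit [IsProbabilityMeasure P] in
theorem lintegral_edist_toState_le (x y : Fin d → Lp ℝ 2 P) :
    ∫⁻ ω, edist (toState ζ x ω) (toState ζ y ω) ^ 2 ∂P ≤ d * edist x y ^ 2 := by
  calc ∫⁻ ω, edist (toState ζ x ω) (toState ζ y ω) ^ 2 ∂P
      ≤ ∫⁻ ω, ∑ i, ‖x i ω - y i ω‖ₑ ^ 2 ∂P := by
        refine lintegral_mono fun ω => ?_
        rw [toState, toState, Prod.edist_eq, edist_self, max_eq_left zero_le, edist_eq_enorm_sub]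
        exact enorm_pi_sq_le _
    _ = ∑ i, edist (x i) (y i) ^ 2 := by
        rw [lintegral_finsetSum']
        · refine Finset.sum_congr rfl fun i _ => ?_
          rw [Lp.edist_def, eLpNorm_two_sq]
          rfl
        · exact fun i _ => (((Lp.stronglyMeasurable (x i)).measurable.sub
            (Lp.stronglyMeasurable (y i)).measurable).enorm.pow_const 2).aemeasurable
    _ ≤ ∑ _i : Fin d, edist x y ^ 2 :=
        Finset.sum_le_sum fun i _ => pow_le_pow_left' (edist_le_pi_edist x y i) 2
    _ = d * edist x y ^ 2 := by simp

namespace IsLipCoef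

variable {f : ℝ → P2 (State d l) → State d l → ℝ} {L : ℝ≥0}

theorem lipschitzWith (h : IsLipCoef f L) (r : ℝ) (m : P2 (State d l)) : LipschitzWith L (f r m) :=
  fun z z' => by simpa [P2.wass_self] using h.lip r m m z z'

theorem enorm_le (h : IsLipCoef f L) (m : P2 (State d l)) : ∃ B : ℝ, ∀ r z,
    ‖f r m z‖ₑ ≤ ‖B + L * ‖z‖‖ₑ := by
  obtain ⟨B, hB⟩ := h.bdd m
  refine ⟨B, fun r z => enorm_le_iff_norm_le.2 ?_⟩
  have h1 := (h.lipschitzWith r m).dist_le_mul z 0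
  rw [dist_zero_right, Real.dist_eq] at h1
  have h2 := hB r
  rw [Real.norm_eq_abs, Real.norm_eq_abs]
  refine le_trans ?_ (le_abs_self _)
  have h3 := abs_add_le (f r m z - f r m 0) (f r m 0)
  rw [sub_add_cancel] at h3
  linarith

theorem memLp (h : IsLipCoef f L) (hζ : MemLp ζ 2 P) (r : ℝ) (m : P2 (State d l))
    (x : Fin d → Lp ℝ 2 P) : MemLp (fun ω => f r m (toState ζ x ω)) 2 P := by
  obtain ⟨B, hB⟩ := h.enorm_le m
  have h1 := memLp_toState hζ x
  exact MemLp.mono ((memLp_const B).add (h1.norm.const_mul (L : ℝ)))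
    ((h.lipschitzWith r m).continuous.comp_aestronglyMeasurable h1.1)
    (Eventually.of_forall fun ω => enorm_le_iff_norm_le.1 (hB r _))

/-- The coefficient `f`, evaluated along the random state with components `x` and `ζ`. -/
noncomputable def lift (h : IsLipCoef f L) (hζm : Measurable ζ) (hζ : MemLp ζ 2 P) (r : ℝ)
    (x : Fin d → Lp ℝ 2 P) : Lp ℝ 2 P :=
  (h.memLp hζ r (lawOf hζm hζ x) x).toLp _

theorem coeFn_lift (h : IsLipCoef f L) (hζm : Measurable ζ) (hζ : MemLp ζ 2 P) (r : ℝ)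
    (x : Fin d → Lp ℝ 2 P) :
    h.lift hζm hζ r x =ᵐ[P] fun ω => f r (lawOf hζm hζ x) (toState ζ x ω) :=
  MemLp.coeFn_toLp _

/-- With `I` the mean squared distance of the two states, the Wasserstein distance and the distance
in space each contribute at most `2 L² I`, and `I ≤ d · edist x y ^ 2` because the control component
is shared. -/
theorem lipschitzWith_lift (h : IsLipCoef f L) (hζm : Measurable ζ) (hζ : MemLp ζ 2 P) (r : ℝ) :
    LipschitzWith (NNReal.sqrt (4 * L ^ 2 * d)) (h.lift hζm hζ r) := by
  intro x y
  rw [← ENNReal.pow_le_pow_left_iff two_ne_zero, mul_pow, ← ENNReal.coe_pow, NNReal.sq_sqrt, lift,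
    lift, Lp.edist_toLp_toLp, eLpNorm_two_sq]
  set w := P2.wass (lawOf hζm hζ x) (lawOf hζm hζ y)
  set I := ∫⁻ ω, edist (toState ζ x ω) (toState ζ y ω) ^ 2 ∂P with hI
  have hw : w ^ 2 ≤ I := wass_lawOf_le hζm hζ x y
  calc ∫⁻ ω, ‖f r (lawOf hζm hζ x) (toState ζ x ω) - f r (lawOf hζm hζ y) (toState ζ y ω)‖ₑ ^ 2 ∂P
      ≤ ∫⁻ ω, (L : ℝ≥0∞) ^ 2 * (2 * (w ^ 2 + edist (toState ζ x ω) (toState ζ y ω) ^ 2)) ∂P := by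
        refine lintegral_mono fun ω => ?_
        rw [← edist_eq_enorm_sub]
        refine (pow_le_pow_left' (h.lip _ _ _ _ _) 2).trans ?_
        rw [mul_pow]
        gcongr
        exact ennreal_add_sq_le _ _
    _ = (L : ℝ≥0∞) ^ 2 * (2 * (w ^ 2 + I)) := by
        rw [lintegral_const_mul' _ _ (by simp), lintegral_const_mul' _ _ (by simp),
          lintegral_add_left measurable_const, lintegral_const, measure_univ, mul_one]
    _ ≤ (L : ℝ≥0∞) ^ 2 * (2 * (I + I)) := by gcongr
    _ = 4 * L ^ 2 * I := by ring
    _ ≤ 4 * L ^ 2 * (d * edist x y ^ 2) := by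
        gcongr
        exact lintegral_edist_toState_le x y
    _ = ((4 * L ^ 2 * d : ℝ≥0) : ℝ≥0∞) * edist x y ^ 2 := by push_cast; ring

theorem continuous_lift (h : IsLipCoef f L) (hζm : Measurable ζ) (hζ : MemLp ζ 2 P)
    (x : Fin d → Lp ℝ 2 P) : Continuous fun r => h.lift hζm hζ r x := by
  obtain ⟨B, hB⟩ := h.enorm_le (lawOf hζm hζ x)
  exact continuous_toLp_of_dominated (f := fun r ω => f r (lawOf hζm hζ x) (toState ζ x ω))
    (fun r => h.memLp hζ r _ x)
    ((memLp_const B).add ((memLp_toState hζ x).norm.const_mul (L : ℝ))) (fun r ω => hB r _)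
    fun ω => h.cont _ _

theorem aestronglyMeasurable_lift (h : IsLipCoef f L) (hζm : Measurable ζ) (hζ : MemLp ζ 2 P)
    {m : MeasurableSpace Ω} (hζm' : Measurable[m] ζ) (r : ℝ) {x : Fin d → Lp ℝ 2 P}
    (hx : ∀ i, AEStronglyMeasurable[m] (x i) P) :
    AEStronglyMeasurable[m] (h.lift hζm hζ r x) P := by
  choose x' hx'm hx' using hx
  refine ⟨fun ω => f r (lawOf hζm hζ x) ((fun i => x' i ω), ζ ω), ?_, ?_⟩
  · have h1 : Measurable[m] fun ω => ((fun i => x' i ω), ζ ω) :=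
      (measurable_pi_lambda _ fun i => (hx'm i).measurable).prodMk hζm'
    exact ((h.lipschitzWith r _).continuous.measurable.comp h1).stronglyMeasurable
  · filter_upwards [h.coeFn_lift hζm hζ r x, ae_all_iff.2 hx'] with ω e1 e2
    rw [e1, toState]
    simp only [e2]

end IsLipCoef

end Lift

/-! ## Measurability on the path space -/

theorem isCadlag_ite {E : Type*} [TopologicalSpace E] (t : ℝ) (a : E) {g : ℝ → E}
    (hg : Continuous g) : IsCadlag fun s => if s < t then a else g s := by
  intro s
  rcases lt_or_ge s t with h | h
  · have h1 : (fun s => if s < t then a else g s) =ᶠ[𝓝 s] fun _ => a := by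
      filter_upwards [gt_mem_nhds h] with r hr using if_pos hr
    exact ⟨(continuousAt_const.congr h1.symm).continuousWithinAt, a,
      (tendsto_const_nhds.congr' h1.symm).mono_left nhdsWithin_le_nhds⟩
  · refine ⟨?_, ?_⟩
    · refine hg.continuousWithinAt.congr (fun r hr => ?_) ?_
      · exact if_neg (not_lt.2 (h.trans hr))
      · exact if_neg (not_lt.2 h)
    · rcases h.eq_or_lt with rfl | h
      · exact ⟨a, tendsto_const_nhds.congr' (by
          filter_upwards [self_mem_nhdsWithin] with r hr using (if_pos hr).symm)⟩
      · refine ⟨g s, (hg.tendsto s).mono_left nhdsWithin_le_nhds |>.congr' ?_⟩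
        filter_upwards [nhdsWithin_le_nhds (lt_mem_nhds h)] with r hr
        exact (if_neg (not_lt.2 hr.le)).symm

namespace D0

variable {a b : ℝ} {d l : ℕ}

/-- Time is approximated from the right by the next grid point `τ n s`, which takes countably many
values and lies strictly beyond `s`; right-continuity gives the limit. -/
theorem measurable_uncurry_eval : Measurable fun p : ℝ × D0 a b d l => p.2.1 p.1 := by
  let τ : ℕ → ℝ → ℝ := fun n s => (⌊s * (n + 1)⌋ + 1) / (n + 1)
  have hτ1 : ∀ n s, s < τ n s := fun n s => by
    have h0 : (0 : ℝ) < n + 1 := by positivity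
    simp only [τ]
    rw [lt_div_iff₀ h0]
    exact Int.lt_floor_add_one _
  have hτ2 : ∀ n s, τ n s ≤ s + 1 / ((n : ℝ) + 1) := fun n s => by
    have h0 : (0 : ℝ) < n + 1 := by positivity
    simp only [τ]
    rw [div_le_iff₀ h0, add_mul, one_div_mul_cancel h0.ne']
    linarith [Int.floor_le (s * (n + 1))]
  refine measurable_of_tendsto_metrizable (f := fun n (p : ℝ × D0 a b d l) => p.2.1 (τ n p.1))
    (fun n => ?_) (tendsto_pi_nhds.2 fun p => ?_)
  · have h1 : Measurable fun q : ℤ × D0 a b d l => q.2.1 (((q.1 : ℝ) + 1) / (n + 1)) :=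
      measurable_from_prod_countable_right fun z =>
        measurable_eval (((z : ℝ) + 1) / (n + 1))
    exact h1.comp (f := fun p : ℝ × D0 a b d l => (⌊p.1 * (n + 1)⌋, p.2))
      (Int.measurable_floor.comp (measurable_fst.mul_const _) |>.prodMk measurable_snd)
  · refine (p.2.tendsto_right p.1).comp (tendsto_nhdsWithin_iff.2 ⟨?_, ?_⟩)
    · have h2 : Tendsto (fun n : ℕ => p.1 + 1 / ((n : ℝ) + 1)) atTop (𝓝 p.1) := by
        have := (tendsto_one_div_add_atTop_nhds_zero_nat (𝕜 := ℝ)).const_add p.1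
        rwa [add_zero] at this
      exact tendsto_of_tendsto_of_tendsto_of_le_of_le tendsto_const_nhds h2
        (fun n => (hτ1 n p.1).le) fun n => hτ2 n p.1
    · exact Eventually.of_forall fun n => hτ1 n p.1

/-- Rational times suffice: right-continuity is used first in the earlier time, then in the later
one. -/
theorem measurableSet_monotone_xi : MeasurableSet {y : D0 a b d l | Monotone y.xi} := by
  have : {y : D0 a b d l | Monotone y.xi} =
      ⋂ (p : ℚ) (q : ℚ) (_ : p ≤ q), {y | (y.1 p).2 ≤ (y.1 q).2} := by
    ext y
    simp only [mem_iInter, mem_ofPred_eq]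
    refine ⟨fun h p q hpq => h (by exact_mod_cast hpq), fun h s r hsr => ?_⟩
    rcases hsr.eq_or_lt with rfl | hsr
    · exact le_rfl
    have h1 : ∀ q : ℚ, s < q → (y.1 s).2 ≤ (y.1 q).2 := fun q hq =>
      mem_of_forall_rat (C := {z | z.2 ≤ (y.1 q).2})
        (isClosed_le continuous_snd continuous_const) hq
        fun p _ hp => h p q (by exact_mod_cast hp.le)
    exact mem_of_forall_rat (C := {z | (y.1 s).2 ≤ z.2})
      (isClosed_le continuous_const continuous_snd) (lt_add_one r)
      fun q hq _ => h1 q (hsr.trans hq)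
  rw [this]
  exact MeasurableSet.iInter fun p => MeasurableSet.iInter fun q => MeasurableSet.iInter fun _ =>
    measurableSet_le (measurable_snd.comp (measurable_eval (p : ℝ)))
      (measurable_snd.comp (measurable_eval (q : ℝ)))

theorem measurableSet_xi_const (t : ℝ) :
    MeasurableSet {y : D0 a b d l | ∀ s ≥ t, y.xi s = y.xi t} := by
  have : {y : D0 a b d l | ∀ s ≥ t, y.xi s = y.xi t} =
      ⋂ (q : ℚ) (_ : t ≤ q), {y | (y.1 q).2 = (y.1 t).2} := by
    ext y
    simp only [mem_iInter, mem_ofPred_eq]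
    exact ⟨fun h q hq => h q hq, fun h s hs => mem_of_forall_rat (C := {z | z.2 = (y.1 t).2})
      (isClosed_eq continuous_snd continuous_const) (lt_add_one s)
      fun q hq _ => h q (hs.le.trans hq.le)⟩
  rw [this]
  exact MeasurableSet.iInter fun q => MeasurableSet.iInter fun _ =>
    measurableSet_eq_fun (measurable_snd.comp (measurable_eval (q : ℝ)))
      (measurable_snd.comp (measurable_eval t))

/-- Time integrals of a continuous function along the path are measurable. -/
theorem measurable_integral {E : Type*} [NormedAddCommGroup E] [NormedSpace ℝ E]
    [MeasurableSpace E] [BorelSpace E] [SecondCountableTopology E] {t T s : ℝ}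
    (hs : s ∈ Icc t T) {H : ℝ × State d l → E} (hH : ContinuousOn H (Icc t T ×ˢ univ)) :
    Measurable fun y : D0 a b d l => ∫ r in t..s, H (r, y.1 r) := by
  have htT := hs.1.trans hs.2
  have h1 : Continuous fun p : ℝ × State d l => H (projIcc t T htT p.1, p.2) :=
    hH.comp_continuous (by fun_prop) fun p => ⟨(projIcc t T htT p.1).2, mem_univ _⟩
  have h2 : ∀ y : D0 a b d l, ∫ r in t..s, H (r, y.1 r) =
      ∫ r in Ioc t s, H (projIcc t T htT r, y.1 r) := by
    intro y
    rw [intervalIntegral.integral_of_le hs.1]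
    refine setIntegral_congr_fun measurableSet_Ioc fun r hr => ?_
    rw [projIcc_of_mem htT ⟨hr.1.le, hr.2.trans hs.2⟩]
  rw [funext h2]
  have h3 : StronglyMeasurable fun p : D0 a b d l × ℝ => H (projIcc t T htT p.2, p.1.1 p.2) :=
    (h1.measurable.comp (measurable_snd.prodMk
      (measurable_uncurry_eval.comp measurable_swap))).stronglyMeasurable
  exact h3.integral_prod_right'.measurable

end D0

/-- A control that is constant from `t` on does not charge `(t,s]`. If a component is not monotone
on the whole line, its `stieltjes` measure is `0` by definition. -/
theorem intAgainst_eq_zero {l : ℕ} {t s : ℝ} (hts : t ≤ s) (h : ℝ → Fin l → ℝ) {ζ : ℝ → Fin l → ℝ}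
    (hζ : ∀ r ≥ t, ζ r = ζ t) : intAgainst (Ioc t s) h ζ = 0 := by
  refine Finset.sum_eq_zero fun j _ => ?_
  have h1 : stieltjes (fun r => ζ r j) (Ioc t s) = 0 := by
    unfold stieltjes
    split_ifs with hm
    · have h2 : ∀ r ≥ t, hm.stieltjesFunction r = ζ t j := fun r hr => by
        rw [Monotone.stieltjesFunction_eq]
        refine rightLim_eq_of_tendsto (tendsto_const_nhds.congr' ?_)
        filter_upwards [self_mem_nhdsWithin] with q hq
        rw [hζ q (hr.trans (le_of_lt hq))]
      rw [StieltjesFunction.measure_Ioc, h2 t le_rfl, h2 s hts, sub_self, ENNReal.ofReal_zero]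
    · simp
  rw [Measure.restrict_eq_zero.2 h1, integral_zero_measure]

/-! ## Convergence of Riemann sums and convergence in measure -/

theorem tendsto_riemann_sum {t s : ℝ} (hts : t ≤ s) {f : ℝ → ℝ} (hf : ContinuousOn f (Icc t s)) :
    Tendsto (fun n : ℕ => ∑ j ∈ Finset.range n, f (t + j * ((s - t) / n)) *
      (t + (j + 1) * ((s - t) / n) - (t + j * ((s - t) / n)))) atTop (𝓝 (∫ r in t..s, f r)) := by
  set x : ℕ → ℕ → ℝ := fun n j => t + j * ((s - t) / n) with hx
  have hsucc : ∀ n j, t + (j + 1) * ((s - t) / n) = x n (j + 1) := fun n j => by simp [hx]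
  have h0 : ∀ n : ℕ, 0 ≤ (s - t) / n := fun n => div_nonneg (by linarith) (by positivity)
  have hmono : ∀ n, Monotone (x n) := fun n i j hij => by
    have := h0 n
    simp only [hx]; gcongr
  have hlow : ∀ n j, t ≤ x n j := fun n j => by
    have := mul_nonneg (Nat.cast_nonneg (α := ℝ) j) (h0 n)
    simp only [hx]; linarith
  have hup : ∀ n, ∀ j ∈ Finset.range n, x n (j + 1) ≤ s := fun n j hj => by
    have hj := Finset.mem_range.1 hj
    refine (hmono n (show j + 1 ≤ n from hj)).trans_eq ?_
    simp only [hx]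
    rw [mul_div_cancel₀ _ (by have : 0 < n := by lia
                              positivity)]
    ring
  have hlim := tendsto_eLpNorm_step hf 1
  simp only [eLpNorm_one_eq_lintegral_enorm, hsucc] at hlim ⊢
  have hint : ∀ n, ∀ j ∈ Finset.range n, IntegrableOn ((Ioc (x n j) (x n (j + 1))).indicator
      fun _ => f (x n j)) (Ioc t s) := fun n j _ =>
    (integrableOn_const measure_Ioc_lt_top.ne).indicator measurableSet_Ioc
  have h1 := tendsto_integral_of_L1 (μ := volume.restrict (Ioc t s)) f
    (F := fun n r => ∑ j ∈ Finset.range n, (Ioc (x n j) (x n (j + 1))).indicator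
      (fun _ => f (x n j)) r) (l := atTop)
    ((hf.mono Ioc_subset_Icc_self).aestronglyMeasurable measurableSet_Ioc)
    (Eventually.of_forall fun n => integrable_finsetSum _ (hint n))
    (hlim.congr fun n => lintegral_congr fun r => by rw [← enorm_neg, neg_sub])
  rw [intervalIntegral.integral_of_le hts]
  refine h1.congr fun n => ?_
  rw [integral_finsetSum _ (hint n)]
  refine Finset.sum_congr rfl fun j hj => ?_
  rw [setIntegral_indicator measurableSet_Ioc, inter_eq_right.2 (Ioc_subset_Ioc (hlow n j)
    (hup n j hj)), setIntegral_const, Real.volume_real_Ioc_of_le (hmono n j.le_succ), smul_eq_mul,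
    mul_comm]

/-- Convergence is carried from `Ω` to path space. The limit `g` need not be measurable there, as
long as it has a measurable version `g'`. -/
theorem tendstoInMeasure_map {α β E : Type*} {mα : MeasurableSpace α} {mβ : MeasurableSpace β}
    [PseudoEMetricSpace E] [MeasurableSpace E] [BorelSpace E] [SecondCountableTopology E]
    {μ : Measure α} {h : α → β} (hh : Measurable h) {f : ℕ → β → E} (hf : ∀ n, Measurable (f n))
    {g g' : β → E} (hg' : Measurable g') (hgg' : g' =ᵐ[μ.map h] g)
    (hfg : TendstoInMeasure μ (fun n x => f n (h x)) atTop fun x => g' (h x)) :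
    TendstoInMeasure (μ.map h) f atTop g := by
  refine TendstoInMeasure.congr_right hgg' fun ε hε => ?_
  refine (hfg ε hε).congr fun n => ?_
  rw [Measure.map_apply hh (measurableSet_le measurable_const ((hf n).edist hg'))]
  rfl

/-! ## Solutions of the McKean-Vlasov equation -/

/-- The integrators of the equation: time (`none`) and the coordinates of the Brownian motion. -/
def driver {Ω : Type*} {k : ℕ} (W : ℝ → Ω → Fin k → ℝ) : Option (Fin k) → ℝ → Ω → ℝ
  | none => fun s _ => s
  | some j => fun s ω => W s ω j

theorem grid_mem {t T s : ℝ} (hs : s ∈ Icc t T) {n : ℕ} (q : ℕ) (hq : q ∈ Finset.range n) :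
    t + q * ((s - t) / n) ∈ Icc t T := by
  have hqn : (q : ℝ) ≤ n := by exact_mod_cast (Finset.mem_range.1 hq).le
  have hn : (0 : ℝ) < n := by
    have := (Nat.zero_le q).trans_lt (Finset.mem_range.1 hq)
    exact_mod_cast this
  have h3 : 0 ≤ (s - t) / n := div_nonneg (by linarith [hs.1]) hn.le
  have h4 : (q : ℝ) * ((s - t) / n) ≤ n * ((s - t) / n) := by gcongr
  rw [mul_div_cancel₀ _ hn.ne'] at h4
  exact ⟨by linarith [mul_nonneg (Nat.cast_nonneg (α := ℝ) q) h3], by linarith [hs.2]⟩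

section McKeanVlasov

variable {Ω : Type*} {mΩ : MeasurableSpace Ω} {P : Measure Ω} [IsProbabilityMeasure P]
  {F : Filtration ℝ mΩ} {t T : ℝ} {d l k : ℕ} {W : ℝ → Ω → Fin k → ℝ} {ζ : Ω → Fin l → ℝ}

theorem IsNoise.isIntegrator_driver (h : IsNoise P F t T W) (j : Option (Fin k)) :
    IsIntegrator P F (driver W j) t T (max 8 (T - t).toNNReal) := by
  rcases j with - | j
  · exact isIntegrator_time.mono (le_max_right _ _)
  · exact (h.isBMWith j).isIntegrator.mono (le_max_left _ _)

theorem tendsto_wass_lawOf (hζm : Measurable ζ) (hζ : MemLp ζ 2 P) {X : ℝ → Fin d → Lp ℝ 2 P}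
    (hX : Continuous X) (s : ℝ) :
    Tendsto (fun r => P2.wass (lawOf hζm hζ (X r)) (lawOf hζm hζ (X s))) (𝓝 s) (𝓝 0) := by
  have h1 : Tendsto (fun r => (d : ℝ≥0∞) * edist (X r) (X s) ^ 2) (𝓝 s) (𝓝 0) := by
    have h2 := ((ENNReal.continuous_pow 2).tendsto 0).comp
      (tendsto_iff_edist_tendsto_0.1 (hX.tendsto s))
    have h3 := ENNReal.Tendsto.const_mul (a := (d : ℝ≥0∞)) h2 (Or.inr (by simp))
    simpa using h3
  have h2 : Tendsto (fun r => P2.wass (lawOf hζm hζ (X r)) (lawOf hζm hζ (X s)) ^ 2) (𝓝 s) (𝓝 0) :=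
    tendsto_of_tendsto_of_tendsto_of_le_of_le tendsto_const_nhds h1 (fun _ => zero_le)
      fun r => (wass_lawOf_le hζm hζ _ _).trans (lintegral_edist_toState_le _ _)
  have h3 := ((ENNReal.continuous_rpow_const (y := 1 / 2)).tendsto 0).comp h2
  rw [ENNReal.zero_rpow_of_pos (by norm_num)] at h3
  refine h3.congr fun r => ?_
  rw [Function.comp_apply, ← ENNReal.rpow_natCast, ← ENNReal.rpow_mul, Nat.cast_ofNat,
    mul_one_div_cancel two_ne_zero, ENNReal.rpow_one]

/-- Once the law is inserted, the coefficient is continuous in time and uniformly Lipschitz in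
space, hence jointly continuous. -/
theorem IsLipCoef.continuous_lawOf {f : ℝ → P2 (State d l) → State d l → ℝ} {L : ℝ≥0}
    (h : IsLipCoef f L) (hζm : Measurable ζ) (hζ : MemLp ζ 2 P) {X : ℝ → Fin d → Lp ℝ 2 P}
    (hX : Continuous X) :
    Continuous fun p : ℝ × State d l => f p.1 (lawOf hζm hζ (X p.1)) p.2 := by
  refine continuous_prod_of_continuous_lipschitzWith' _ L (fun r => ?_) fun z => ?_
  · exact h.lipschitzWith r (lawOf hζm hζ (X r))
  · refine continuous_iff_continuousAt.2 fun s => tendsto_iff_edist_tendsto_0.2 ?_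
    have h1 := ENNReal.Tendsto.const_mul (a := (L : ℝ≥0∞)) (tendsto_wass_lawOf hζm hζ hX s)
      (Or.inr (by simp))
    have h2 := h1.add (tendsto_iff_edist_tendsto_0.1 ((h.cont (lawOf hζm hζ (X s)) z).tendsto s))
    rw [mul_zero, add_zero] at h2
    refine tendsto_of_tendsto_of_tendsto_of_le_of_le tendsto_const_nhds h2 (fun _ => zero_le)
      fun r => (edist_triangle _ (f r (lawOf hζm hζ (X s)) z) _).trans ?_
    refine add_le_add ?_ le_rfl
    simpa using h.lip r (lawOf hζm hζ (X r)) (lawOf hζm hζ (X s)) z z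

/-- A solution of the McKean-Vlasov equation with coefficients `f`, control `ζ` and driving
noise `W`, together with its stochastic integrals `M`. -/
structure IsSolution (F : Filtration ℝ mΩ) (htT : t ≤ T) (W : ℝ → Ω → Fin k → ℝ)
    {f : Option (Fin k) → Fin d → ℝ → P2 (State d l) → State d l → ℝ} {L : ℝ≥0}
    (hf : ∀ j i, IsLipCoef (f j i) L) (hζm : Measurable ζ) (hζ : MemLp ζ 2 P)
    (x₀ : Fin d → Lp ℝ 2 P) (X : ℝ → Fin d → Lp ℝ 2 P)
    (M : Option (Fin k) → Fin d → Lp C(Icc t T, ℝ) 2 P) : Prop where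
  continuous : Continuous X
  adapted : ∀ s ∈ Icc t T, ∀ i, AEStronglyMeasurable[F s] (X s i) P
  integral : ∀ j i, IsIntegral P F (driver W j) t T (NNReal.sqrt (max 8 (T - t).toNNReal))
    (fun r => (hf j i).lift hζm hζ r (X r)) (M j i)
  eq : ∀ s i, X s i = x₀ i + ∑ j, evalLp htT (M j i) s

variable {f : Option (Fin k) → Fin d → ℝ → P2 (State d l) → State d l → ℝ} {L : ℝ≥0}
  {hf : ∀ j i, IsLipCoef (f j i) L} {hζm : Measurable ζ} {hζ : MemLp ζ 2 P}
  {x₀ : Fin d → Lp ℝ 2 P} {X : ℝ → Fin d → Lp ℝ 2 P}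
  {M : Option (Fin k) → Fin d → Lp C(Icc t T, ℝ) 2 P}

theorem IsNoise.exists_isSolution (hN : IsNoise P F t T W) (htT : t ≤ T)
    (hf : ∀ j i, IsLipCoef (f j i) L) (hζm : Measurable ζ) (hζ : MemLp ζ 2 P)
    (hζF : ∀ s, t ≤ s → Measurable[F s] ζ) (hx₀ : ∀ i, AEStronglyMeasurable[F t] (x₀ i) P) :
    ∃ X M, IsSolution F htT W hf hζm hζ x₀ X M := by
  obtain ⟨X, M, h1, h2, h3, h4⟩ := exists_sde_solution htT hN.isIntegrator_driver
    (A := fun j i r => (hf j i).lift hζm hζ r) (fun j i r _ => (hf j i).lipschitzWith_lift hζm hζ r)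
    (fun j i X => ((hf j i).continuous_lift hζm hζ X).continuousOn)
    (fun j i r hr X hX => (hf j i).aestronglyMeasurable_lift hζm hζ (hζF r hr.1) r hX) x₀ hx₀
  exact ⟨X, M, h1, h2, h3, h4⟩

namespace IsSolution

variable {htT : t ≤ T}

theorem continuous_lift (h : IsSolution F htT W hf hζm hζ x₀ X M) (j : Option (Fin k)) (i : Fin d) :
    Continuous fun r => (hf j i).lift hζm hζ r (X r) := by
  have h1 : Continuous fun p : ℝ × (Fin d → Lp ℝ 2 P) => (hf j i).lift hζm hζ p.1 p.2 :=
    continuous_prod_of_continuous_lipschitzWith' _ _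
      (fun r => (hf j i).lipschitzWith_lift hζm hζ r) fun x => (hf j i).continuous_lift hζm hζ x
  exact h1.comp (continuous_id.prodMk h.continuous)

/-- The stochastic integrals are limits of Riemann sums along any version of the solution. -/
theorem tendsto_riemann (h : IsSolution F htT W hf hζm hζ x₀ X M)
    (hζF : ∀ s, t ≤ s → Measurable[F s] ζ) {Y : ℝ → Ω → State d l}
    (hY : ∀ s ∈ Icc t T, Y s =ᵐ[P] toState ζ (X s)) (j : Option (Fin k)) (i : Fin d)
    (s : Icc t T) :
    Tendsto (fun n : ℕ => eLpNorm (fun ω => M j i ω s - ∑ q ∈ Finset.range n,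
      f j i (t + q * ((s - t) / n)) (lawOf hζm hζ (X (t + q * ((s - t) / n))))
          (Y (t + q * ((s - t) / n)) ω) *
        (driver W j (t + (q + 1) * ((s - t) / n)) ω - driver W j (t + q * ((s - t) / n)) ω)) 2 P)
      atTop (𝓝 0) := by
  have h1 := (h.integral j i).tendsto_riemann (h.continuous_lift j i).continuousOn
    (fun r hr => (hf j i).aestronglyMeasurable_lift hζm hζ (hζF r hr.1) r (h.adapted r hr)) s
  refine h1.congr fun n => eLpNorm_congr_ae ?_
  have h3 : ∀ᵐ ω ∂P, ∀ q ∈ Finset.range n,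
      (hf j i).lift hζm hζ (t + q * ((s - t) / n)) (X (t + q * ((s - t) / n))) ω =
      f j i (t + q * ((s - t) / n)) (lawOf hζm hζ (X (t + q * ((s - t) / n))))
          (Y (t + q * ((s - t) / n)) ω) := by
    refine (ae_ball_iff (Finset.range n).countable_toSet).2 fun q hq => ?_
    filter_upwards [(hf j i).coeFn_lift hζm hζ (t + q * ((s - t) / n)) (X (t + q * ((s - t) / n))),
      hY _ (grid_mem s.2 q hq)] with ω e1 e2
    rw [e1, e2]
  filter_upwards [h3] with ω h3
  rw [Finset.sum_congr rfl fun q hq => by rw [h3 q hq]]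

/-- The time integral is the pathwise integral. -/
theorem integral_time (h : IsSolution F htT W hf hζm hζ x₀ X M)
    (hζF : ∀ s, t ≤ s → Measurable[F s] ζ) {Y : ℝ → Ω → State d l}
    (hYm : ∀ s, Measurable (Y s)) (hYc : ∀ ω, ContinuousOn (fun s => Y s ω) (Icc t T))
    (hY : ∀ s ∈ Icc t T, Y s =ᵐ[P] toState ζ (X s)) (i : Fin d) (s : Icc t T) :
    (fun ω => M none i ω s) =ᵐ[P]
      fun ω => ∫ r in t..s, f none i r (lawOf hζm hζ (X r)) (Y r ω) := by
  have hc := (hf none i).continuous_lawOf hζm hζ h.continuous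
  set R : ℕ → Ω → ℝ := fun n ω => ∑ q ∈ Finset.range n,
      f none i (t + q * ((s - t) / n)) (lawOf hζm hζ (X (t + q * ((s - t) / n))))
          (Y (t + q * ((s - t) / n)) ω) *
        (t + (q + 1) * ((s - t) / n) - (t + q * ((s - t) / n))) with hR
  have hRm : ∀ n, AEStronglyMeasurable (R n) P := fun n => by
    refine (Finset.measurable_sum _ fun q _ => ?_).aestronglyMeasurable
    exact (((hf none i).lipschitzWith _ _).continuous.measurable.comp (hYm _)).mul_const _
  -- The same Riemann sums converge in `L²` to the abstract integral and pathwise to the ordinary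
  -- one; limits in measure are unique.
  have h1 : TendstoInMeasure P R atTop fun ω => M none i ω s := by
    refine tendstoInMeasure_of_tendsto_eLpNorm two_ne_zero hRm
      (aestronglyMeasurable_eval (Lp.aestronglyMeasurable _) _) ?_
    refine (h.tendsto_riemann hζF hY none i s).congr fun n => ?_
    exact eLpNorm_sub_comm _ _ _ _
  have h2 : TendstoInMeasure P R atTop
      fun ω => ∫ r in t..s, f none i r (lawOf hζm hζ (X r)) (Y r ω) := by
    refine tendstoInMeasure_of_tendsto_ae hRm (Eventually.of_forall fun ω => ?_)
    exact tendsto_riemann_sum s.2.1 (hc.comp_continuousOn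
      (continuousOn_id.prodMk ((hYc ω).mono (Icc_subset_Icc_right s.2.2))))
  exact tendstoInMeasure_ae_unique h1 h2

end IsSolution

end McKeanVlasov

/-! ## The law on path space -/

section PathLaw

variable {Ω : Type*} {mΩ : MeasurableSpace Ω} {P : Measure Ω} {t T : ℝ} {d l k : ℕ}
  {J : Type*} [Fintype J]

/-- The path with value `Zpre` before time `t` that jumps to `Z` at time `t` and moves by the sum
of the integrals `M` afterwards. -/
noncomputable def pathOf (htT : t ≤ T) (Zpre Z : Ω → State d l)
    (M : J → Fin d → Lp C(Icc t T, ℝ) 2 P) (ω : Ω) : D0 t T d l :=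
  ⟨fun s => if s < t then Zpre ω else
      ((fun i => (Z ω).1 i + ∑ j, M j i ω (projIcc t T htT s)), (Z ω).2),
    isCadlag_ite t _ ((continuous_pi fun i => continuous_const.add (continuous_finsetSum _
      fun j _ => (M j i ω).continuous.comp continuous_projIcc)).prodMk continuous_const),
    fun s hs => by simp only [if_pos hs, if_pos (sub_one_lt t)],
    fun s hs => by
      simp only [if_neg (not_lt.2 (htT.trans hs)), if_neg (not_lt.2 htT),
        projIcc_of_right_le htT hs, projIcc_right]⟩

variable {htT : t ≤ T} {Zpre Z : Ω → State d l} {M : J → Fin d → Lp C(Icc t T, ℝ) 2 P}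

theorem pathOf_of_lt {s : ℝ} (hs : s < t) (ω : Ω) : (pathOf htT Zpre Z M ω).1 s = Zpre ω :=
  if_pos hs

theorem pathOf_of_le {s : ℝ} (hs : t ≤ s) (ω : Ω) : (pathOf htT Zpre Z M ω).1 s =
    ((fun i => (Z ω).1 i + ∑ j, M j i ω (projIcc t T htT s)), (Z ω).2) :=
  if_neg (not_lt.2 hs)

theorem continuousOn_pathOf (ω : Ω) : ContinuousOn (pathOf htT Zpre Z M ω).1 (Icc t T) := by
  have h : Continuous fun s => (((fun i => (Z ω).1 i + ∑ j, M j i ω (projIcc t T htT s)),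
      (Z ω).2) : State d l) :=
    (continuous_pi fun i => continuous_const.add (continuous_finsetSum _
      fun j _ => (M j i ω).continuous.comp continuous_projIcc)).prodMk continuous_const
  exact h.continuousOn.congr fun s hs => pathOf_of_le hs.1 ω

theorem measurable_pathOf (hpre : Measurable Zpre) (hZ : Measurable Z) :
    Measurable (pathOf htT Zpre Z M) := by
  refine D0.measurable_of_eval fun s => ?_
  rcases lt_or_ge s t with hs | hs
  · simpa only [pathOf_of_lt hs] using hpre
  · simp only [pathOf_of_le hs]
    refine (measurable_pi_lambda _ fun i => ?_).prodMk (measurable_snd.comp hZ)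
    refine ((measurable_pi_apply i).comp (measurable_fst.comp hZ)).add
      (Finset.measurable_sum _ fun j _ => ?_)
    exact ((continuous_eval_const _).comp_stronglyMeasurable
      (Lp.stronglyMeasurable (M j i))).measurable

/-- The sup norms of the integrals are square integrable since the `M j i` belong to `L²(Ω;
C([t,T]))`; this places the law in `P2D`. -/
theorem iSup_enorm_pathOf_le (ω : Ω) : (⨆ s, ‖(pathOf htT Zpre Z M ω).1 s‖ₑ) ≤
    ‖‖Zpre ω‖ + (‖Z ω‖ + ∑ i, ∑ j, ‖M j i ω‖)‖ₑ := by
  have hMn : ∀ i j, 0 ≤ ‖M j i ω‖ := fun _ _ => norm_nonneg _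
  have hS : 0 ≤ ∑ i, ∑ j, ‖M j i ω‖ := Finset.sum_nonneg fun i _ => Finset.sum_nonneg fun j _ => hMn i j
  refine iSup_le fun s => enorm_le_iff_norm_le.2 ?_
  rw [Real.norm_of_nonneg (by positivity)]
  rcases lt_or_ge s t with hs | hs
  · rw [pathOf_of_lt hs]
    linarith [norm_nonneg (Z ω)]
  · rw [pathOf_of_le hs]
    refine le_trans ?_ (le_add_of_nonneg_left (norm_nonneg _))
    refine norm_prod_le_iff.2 ⟨?_, ?_⟩
    · refine (pi_norm_le_iff_of_nonneg (by positivity)).2 fun i => (norm_add_le _ _).trans ?_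
      refine add_le_add ((norm_le_pi_norm _ i).trans (norm_fst_le _)) ((norm_sum_le _ _).trans ?_)
      refine (Finset.sum_le_sum fun j _ => (M j i ω).norm_coe_le_norm _).trans ?_
      exact Finset.single_le_sum (f := fun i => ∑ j, ‖M j i ω‖)
        (fun i _ => Finset.sum_nonneg fun j _ => hMn i j) (Finset.mem_univ i)
    · exact (norm_snd_le (Z ω)).trans (le_add_of_nonneg_right hS)

theorem lintegral_iSup_pathOf_lt_top (hpre : MemLp Zpre 2 P) (hZ : MemLp Z 2 P) :
    ∫⁻ ω, (⨆ s, ‖(pathOf htT Zpre Z M ω).1 s‖ₑ) ^ 2 ∂P < ∞ := by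
  refine (lintegral_mono fun ω => pow_le_pow_left' (iSup_enorm_pathOf_le ω) 2).trans_lt ?_
  rw [← eLpNorm_two_sq]
  refine ENNReal.pow_lt_top (MemLp.eLpNorm_lt_top ?_)
  refine hpre.norm.add (hZ.norm.add ?_)
  exact memLp_finsetSum _ fun i _ => memLp_finsetSum _ fun j _ => (Lp.memLp (M j i)).norm

/-- The noise as a random continuous path. -/
def noisePath {W : ℝ → Ω → Fin k → ℝ} {F : Filtration ℝ mΩ} (hN : IsNoise P F t T W) (ω : Ω) :
    CPath t T k :=
  ⟨fun s => W s ω, hN.continuous ω, hN.const_left ω, hN.const_right ω⟩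

theorem measurable_noisePath {W : ℝ → Ω → Fin k → ℝ} {F : Filtration ℝ mΩ}
    (hN : IsNoise P F t T W) : Measurable (noisePath hN) :=
  (measurable_pi_lambda _ fun s => hN.measurable s).subtype_mk

variable [IsProbabilityMeasure P]

/-- The law of `pathOf`. -/
noncomputable def pathLaw (htT : t ≤ T) (Zpre Z : Ω → State d l)
    (M : J → Fin d → Lp C(Icc t T, ℝ) 2 P) (hpre : Measurable Zpre) (hZ : Measurable Z)
    (hpre2 : MemLp Zpre 2 P) (hZ2 : MemLp Z 2 P) : P2D t T d l :=
  ⟨P.map (pathOf htT Zpre Z M),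
    Measure.isProbabilityMeasure_map (measurable_pathOf hpre hZ).aemeasurable,
    (lintegral_map_le _ _).trans_lt (lintegral_iSup_pathOf_lt_top hpre2 hZ2)⟩

theorem marginal_pathLaw (hpre : Measurable Zpre) (hZ : Measurable Z) (hpre2 : MemLp Zpre 2 P)
    (hZ2 : MemLp Z 2 P) (s : ℝ) :
    ((pathLaw htT Zpre Z M hpre hZ hpre2 hZ2).marginal s).meas =
      P.map fun ω => (pathOf htT Zpre Z M ω).1 s :=
  Measure.map_map (D0.measurable_eval s) (measurable_pathOf hpre hZ)

end PathLaw

/-! ## The law of the solution is admissible -/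

theorem tendstoInMeasure_pi {α κ ι : Type*} [Fintype ι] {mα : MeasurableSpace α} {μ : Measure α}
    {u : Filter κ} {f : κ → α → ι → ℝ} {g : α → ι → ℝ}
    (h : ∀ i, TendstoInMeasure μ (fun n x => f n x i) u fun x => g x i) :
    TendstoInMeasure μ f u g := by
  intro ε hε
  have h1 := tendsto_finsetSum (Finset.univ : Finset ι) fun i _ => h i ε hε
  rw [Finset.sum_const_zero] at h1
  refine tendsto_of_tendsto_of_tendsto_of_le_of_le tendsto_const_nhds h1 (fun _ => zero_le)
    fun n => ?_
  refine (measure_mono fun x hx => ?_).trans (measure_iUnion_fintype_le μ _)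
  simp only [mem_iUnion, mem_ofPred_eq] at hx ⊢
  by_contra! hlt
  refine absurd hx (not_le.2 ?_)
  rw [edist_pi_def, Finset.sup_lt_iff hε]
  exact fun i _ => hlt i

/-- The supremum is rewritten as the `σ`-algebra of a single map, so that independence can be stated
for random variables and transported. -/
theorem natFiltration_eq_comap (t T : ℝ) (d l k : ℕ) (s : ℝ) : natFiltration t T d l k s =
    MeasurableSpace.comap (fun (ω : D0 t T d l × CPath t T k) (q : Iic s) =>
      (ω.1.1 q, ω.2.1 q)) inferInstance := by
  change _ = MeasurableSpace.comap _ (⨆ q, _)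
  rw [MeasurableSpace.comap_iSup, iSup_subtype]
  simp only [MeasurableSpace.comap_comp]
  rfl

theorem IndepFun.of_comp {Ω Ω' β β' : Type*} {mΩ : MeasurableSpace Ω} {mΩ' : MeasurableSpace Ω'}
    {mβ : MeasurableSpace β} {mβ' : MeasurableSpace β'} {P : Measure Ω} {H : Ω → Ω'}
    (hH : Measurable H) {f : Ω' → β} (hf : Measurable f) {g : Ω' → β'} (hg : Measurable g)
    (h : IndepFun (fun ω => f (H ω)) (fun ω => g (H ω)) P) : IndepFun f g (P.map H) := by
  rw [indepFun_iff_measure_inter_preimage_eq_mul] at h ⊢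
  intro A B hA hB
  rw [Measure.map_apply hH ((hf hA).inter (hg hB)), Measure.map_apply hH (hf hA),
    Measure.map_apply hH (hg hB)]
  exact h A B hA hB

section Weak

variable {Ω : Type*} {mΩ : MeasurableSpace Ω} {P : Measure Ω} [IsProbabilityMeasure P]
  {F : Filtration ℝ mΩ} {t T : ℝ} {d l k : ℕ} {W : ℝ → Ω → Fin k → ℝ} {Y : Ω → D0 t T d l}

omit [IsProbabilityMeasure P] in
-- Up to null sets the past of the path and of the noise is measurable with respect to `F s`, from
-- which the increment of the noise is independent.
theorem IsNoise.isFBrownian (hN : IsNoise P F t T W) (hYm : Measurable Y)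
    (hY : ∀ s, t ≤ s → s ≤ T → ∀ r ≤ s, AEStronglyMeasurable[F s] (fun ω => (Y ω).1 r) P) :
    IsFBrownian t T (P.map fun ω => (Y ω, noisePath hN ω)) := by
  have hH : Measurable fun ω => (Y ω, noisePath hN ω) := hYm.prodMk (measurable_noisePath hN)
  have hev : ∀ s, Measurable fun ω : D0 t T d l × CPath t T k => ω.2.1 s := fun s =>
    (measurable_pi_apply s).comp (measurable_subtype_coe.comp measurable_snd)
  have hev' : ∀ s, Measurable fun ω : D0 t T d l × CPath t T k => ω.1.1 s := fun s =>
    (D0.measurable_eval s).comp measurable_fst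
  refine ⟨?_, fun s r hs hsr hr => ⟨?_, ?_⟩⟩
  · rw [ae_map_iff hH.aemeasurable (measurableSet_eq_fun (hev t) measurable_const)]
    exact hN.zero
  · exact (Measure.map_map ((hev r).sub (hev s)) hH).trans (hN.law s r hs hsr hr)
  · rw [natFiltration_eq_comap]
    refine IndepFun.of_comp (f := fun ω : D0 t T d l × CPath t T k => ω.2.1 r - ω.2.1 s)
      (g := fun (ω : D0 t T d l × CPath t T k) (q : Iic s) => (ω.1.1 q, ω.2.1 q)) hH
      ((hev r).sub (hev s))
      (measurable_pi_lambda _ fun q => (hev' q).prodMk (hev q)) ?_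
    choose Y' hY'm hY' using fun q : Iic s => hY s hs (hsr.trans hr) q q.2
    have h1 : IndepFun (fun ω => W r ω - W s ω) (fun ω (q : Iic s) => (Y' q ω, W q ω)) P := by
      rw [IndepFun_iff_Indep]
      refine indep_of_indep_of_le_right (hN.indep s r hs hsr hr)
        (Measurable.comap_le (m₁ := F s) ?_)
      have h2 : ∀ q : Iic s, Measurable[F s] fun ω => (Y' q ω, W q ω) := fun q =>
        (hY'm q).measurable.prodMk (hN.adapted q s q.2)
      exact @measurable_pi_lambda _ _ _ (F s) _ _ h2
    -- There are uncountably many times, each with its own null set, but independence of a process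
    -- involves only finitely many coordinates at a time.
    exact IndepFun.process_congr_right (X := fun (q : Iic s) ω => (Y' q ω, W q ω))
      (X' := fun (q : Iic s) ω => ((Y ω).1 q, W q ω)) h1 fun q => by
        filter_upwards [hY' q] with ω hω
        rw [hω]

variable {ζ : Ω → Fin l → ℝ} {f : Option (Fin k) → Fin d → ℝ → P2 (State d l) → State d l → ℝ}
  {L : ℝ≥0} {hf : ∀ j i, IsLipCoef (f j i) L} {hζm : Measurable ζ} {hζ : MemLp ζ 2 P}
  {x₀ : Fin d → Lp ℝ 2 P} {X : ℝ → Fin d → Lp ℝ 2 P}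
  {M : Option (Fin k) → Fin d → Lp C(Icc t T, ℝ) 2 P} {htT : t ≤ T} {Zpre Z : Ω → State d l}

namespace IsSolution

/-- The continuous paths assembled from the integrals are a version of the solution, which was
obtained only as a curve in `L²`. -/
theorem pathOf_ae_eq (h : IsSolution F htT W hf hζm hζ x₀ X M) (hZζ : ∀ ω, (Z ω).2 = ζ ω)
    (hZx : ∀ i, x₀ i =ᵐ[P] fun ω => (Z ω).1 i) {s : ℝ} (hs : t ≤ s) :
    (fun ω => (pathOf htT Zpre Z M ω).1 s) =ᵐ[P] toState ζ (X s) := by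
  have h1 : ∀ᵐ ω ∂P, ∀ i, X s i ω = (Z ω).1 i + ∑ j, M j i ω (projIcc t T htT s) := by
    refine ae_all_iff.2 fun i => ?_
    rw [h.eq s i]
    filter_upwards [Lp.coeFn_add (x₀ i) (∑ j, evalLp htT (M j i) s), hZx i,
      Lp.coeFn_finsetSum Finset.univ fun j => evalLp htT (M j i) s,
      ae_all_iff.2 fun j => coeFn_evalLp htT (M j i) s] with ω e1 e2 e3 e4
    rw [e1, Pi.add_apply, e2, e3, Finset.sum_apply]
    simp only [e4]
  filter_upwards [h1] with ω h1
  rw [pathOf_of_le hs, toState, hZζ]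
  simp only [h1]

theorem pathOf_start (h : IsSolution F htT W hf hζm hζ x₀ X M) :
    (fun ω => (pathOf htT Zpre Z M ω).1 t) =ᵐ[P] Z := by
  filter_upwards [ae_all_iff.2 fun j => ae_all_iff.2 fun i => (h.integral j i).start htT] with ω h1
  rw [pathOf_of_le le_rfl]
  simp only [projIcc_left, h1, Pi.zero_apply, Finset.sum_const_zero, add_zero]

theorem isFBrownian (h : IsSolution F htT W hf hζm hζ x₀ X M) (hN : IsNoise P F t T W)
    (hZζ : ∀ ω, (Z ω).2 = ζ ω) (hZx : ∀ i, x₀ i =ᵐ[P] fun ω => (Z ω).1 i)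
    (hpre : ∀ s, t ≤ s → Measurable[F s] Zpre) (hZ : ∀ s, t ≤ s → Measurable[F s] Z) :
    IsFBrownian t T (P.map fun ω => (pathOf htT Zpre Z M ω, noisePath hN ω)) := by
  refine hN.isFBrownian (measurable_pathOf ((hpre t le_rfl).mono (F.le t) le_rfl)
    ((hZ t le_rfl).mono (F.le t) le_rfl)) fun s hts hsT r hrs => ?_
  rcases lt_or_ge r t with hr | hr
  · simp only [pathOf_of_lt hr]
    exact (hpre s hts).stronglyMeasurable.aestronglyMeasurable
  · have hX : ∀ i, AEStronglyMeasurable[F s] (X r i) P := fun i =>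
      (h.adapted r ⟨hr, hrs.trans hsT⟩ i).mono (F.mono hrs)
    choose x' hx'm hx' using hX
    refine ⟨fun ω => ((fun i => x' i ω), (Z ω).2), ?_, ?_⟩
    · have h0 : Measurable[F s] fun ω i => x' i ω :=
        @measurable_pi_lambda _ _ _ (F s) _ _ fun i => (hx'm i).measurable
      have h1 : Measurable[F s] fun ω => ((fun i => x' i ω), (Z ω).2) :=
        h0.prodMk (measurable_snd.comp (hZ s hts))
      exact h1.stronglyMeasurable
    · filter_upwards [h.pathOf_ae_eq (Zpre := Zpre) hZζ hZx hr, ae_all_iff.2 hx'] with ω e1 e2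
      rw [e1, toState, hZζ]
      simp only [e2]

theorem tendstoInMeasure_riemann (h : IsSolution F htT W hf hζm hζ x₀ X M)
    (hN : IsNoise P F t T W) (hZζ : ∀ ω, (Z ω).2 = ζ ω)
    (hZx : ∀ i, x₀ i =ᵐ[P] fun ω => (Z ω).1 i) (hpre : Measurable Zpre)
    (hZ : ∀ s, t ≤ s → Measurable[F s] Z) (i : Fin d) (s : Icc t T) :
    TendstoInMeasure P (fun (n : ℕ) ω => ∑ q ∈ Finset.range n, ∑ j,
      f (some j) i (t + q * ((s - t) / n)) (lawOf hζm hζ (X (t + q * ((s - t) / n))))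
          ((pathOf htT Zpre Z M ω).1 (t + q * ((s - t) / n))) *
        (W (t + (q + 1) * ((s - t) / n)) ω j - W (t + q * ((s - t) / n)) ω j)) atTop
      fun ω => ∑ j, M (some j) i ω s := by
  have hYm : Measurable (pathOf htT Zpre Z M) :=
    measurable_pathOf hpre ((hZ t le_rfl).mono (F.le t) le_rfl)
  have hζF : ∀ s, t ≤ s → Measurable[F s] ζ := fun s hs =>
    (funext hZζ : (fun ω => (Z ω).2) = ζ) ▸ measurable_snd.comp (hZ s hs)
  have hRm : ∀ (n q : ℕ) j, AEStronglyMeasurable (fun ω =>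
      f (some j) i (t + q * ((s - t) / n)) (lawOf hζm hζ (X (t + q * ((s - t) / n))))
          ((pathOf htT Zpre Z M ω).1 (t + q * ((s - t) / n))) *
        (W (t + (q + 1) * ((s - t) / n)) ω j - W (t + q * ((s - t) / n)) ω j)) P := fun n q j =>
    ((((hf (some j) i).lipschitzWith _ _).continuous.measurable.comp
      ((D0.measurable_eval _).comp hYm)).mul (((measurable_pi_apply j).comp (hN.measurable _)).sub
        ((measurable_pi_apply j).comp (hN.measurable _)))).aestronglyMeasurable
  have hMm : ∀ j, AEStronglyMeasurable (fun ω => M j i ω s) P := fun j =>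
    aestronglyMeasurable_eval (Lp.aestronglyMeasurable _) _
  refine tendstoInMeasure_of_tendsto_eLpNorm two_ne_zero
    (fun n => Finset.aestronglyMeasurable_fun_sum _ fun q _ =>
      Finset.aestronglyMeasurable_fun_sum _ fun j _ => hRm n q j)
    (Finset.aestronglyMeasurable_fun_sum _ fun j _ => hMm _) ?_
  have h1 := tendsto_finsetSum (Finset.univ : Finset (Fin k)) fun j _ =>
    h.tendsto_riemann hζF (Y := fun s ω => (pathOf htT Zpre Z M ω).1 s)
      (fun s hs => h.pathOf_ae_eq hZζ hZx hs.1) (some j) i s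
  rw [Finset.sum_const_zero] at h1
  refine tendsto_of_tendsto_of_tendsto_of_le_of_le tendsto_const_nhds h1 (fun _ => zero_le)
    fun n => ?_
  rw [eLpNorm_sub_comm]
  refine le_trans (le_of_eq ?_) (eLpNorm_sum_le (fun j _ => (hMm (some j)).sub
    (Finset.aestronglyMeasurable_fun_sum _ fun q _ => hRm n q j)) one_le_two)
  refine congrArg (fun g => eLpNorm g 2 P) (funext fun ω => ?_)
  simp only [Pi.sub_apply, Finset.sum_apply, Finset.sum_sub_distrib]
  rw [Finset.sum_comm]
  rfl

/-- The control jumps only at time `t`, so the singular integral over `(t,s]` vanishes. The Riemann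
sums converge to the noise integrals, which are what the equation leaves after subtracting the
drift. -/
theorem isWeakSolution (h : IsSolution F htT W hf hζm hζ x₀ X M) (hN : IsNoise P F t T W)
    (hZζ : ∀ ω, (Z ω).2 = ζ ω) (hZx : ∀ i, x₀ i =ᵐ[P] fun ω => (Z ω).1 i)
    (hpre : ∀ s, t ≤ s → Measurable[F s] Zpre) (hZ : ∀ s, t ≤ s → Measurable[F s] Z)
    (hpre' : Measurable Zpre) (hZ' : Measurable Z)
    (hpre2 : MemLp Zpre 2 P) (hZ2 : MemLp Z 2 P)
    {b : ℝ → P2 (State d l) → State d l → Fin d → ℝ}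
    {σ : ℝ → P2 (State d l) → State d l → Matrix (Fin d) (Fin k) ℝ}
    {γ : ℝ → Matrix (Fin d) (Fin l) ℝ}
    (hb : ∀ r ∈ Icc t T, ∀ m z i, b r m z i = f none i r m z)
    (hσ : ∀ r ∈ Icc t T, ∀ m z i j, σ r m z i j = f (some j) i r m z)
    (hγ : ∀ᵐ ω ∂P, (Z ω).1 = (Zpre ω).1 + (γ t).mulVec ((Z ω).2 - (Zpre ω).2)) :
    IsWeakSolution t T b σ γ (pathLaw htT Zpre Z M hpre' hZ' hpre2 hZ2)
      (P.map fun ω => (pathOf htT Zpre Z M ω, noisePath hN ω)) := by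
  have hYm : Measurable (pathOf htT Zpre Z M) := measurable_pathOf hpre' hZ'
  have hH : Measurable fun ω => (pathOf htT Zpre Z M ω, noisePath hN ω) :=
    hYm.prodMk (measurable_noisePath hN)
  have hev : ∀ s, Measurable fun ω : D0 t T d l × CPath t T k => ω.2.1 s := fun s =>
    (measurable_pi_apply s).comp (measurable_subtype_coe.comp measurable_snd)
  have hev' : ∀ s, Measurable fun ω : D0 t T d l × CPath t T k => ω.1.1 s := fun s =>
    (D0.measurable_eval s).comp measurable_fst
  have hζF : ∀ s, t ≤ s → Measurable[F s] ζ := fun s hs =>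
    (funext hZζ : (fun ω => (Z ω).2) = ζ) ▸ measurable_snd.comp (hZ s hs)
  have hmarg : ∀ r, t ≤ r → (pathLaw htT Zpre Z M hpre' hZ' hpre2 hZ2).marginal r =
      lawOf hζm hζ (X r) := fun r hr => P2.ext <|
    (marginal_pathLaw hpre' hZ' hpre2 hZ2 r).trans (Measure.map_congr (h.pathOf_ae_eq hZζ hZx hr))
  refine ⟨Measure.map_map measurable_fst hH, h.isFBrownian hN hZζ hZx hpre hZ, ?_, fun s hs => ?_⟩
  · rw [ae_map_iff hH.aemeasurable]
    · filter_upwards [hγ, h.pathOf_start (Zpre := Zpre) (Z := Z)] with ω e1 e2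
      simp only [D0.X, D0.xi, D0.pre, e2, pathOf_of_lt (sub_one_lt t)]
      exact e1
    · refine measurableSet_eq_fun (measurable_fst.comp (hev' t)) ?_
      have : Continuous fun p : State d l × State d l => p.1.1 + (γ t).mulVec (p.2.2 - p.1.2) := by
        fun_prop
      exact this.measurable.comp ((hev' (t - 1)).prodMk (hev' t))
  · have hdrift : ∀ y : D0 t T d l, ∫ r in t..s, b r
        ((pathLaw htT Zpre Z M hpre' hZ' hpre2 hZ2).marginal r) (y.1 r) =
        ∫ r in t..s, (fun p : ℝ × State d l => fun i => f none i p.1 (lawOf hζm hζ (X p.1)) p.2)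
          (r, y.1 r) := fun y => by
      refine intervalIntegral.integral_congr fun r hr => ?_
      rw [uIcc_of_le hs.1] at hr
      funext i
      simp only [hmarg r hr.1, hb r ⟨hr.1, hr.2.trans hs.2⟩]
    have hcont : Continuous fun p : ℝ × State d l => fun i =>
        f none i p.1 (lawOf hζm hζ (X p.1)) p.2 :=
      continuous_pi fun i => (hf none i).continuous_lawOf hζm hζ h.continuous
    -- The version `g'` omits the singular integral, which is almost surely zero, and is thereby
    -- measurable.
    refine tendstoInMeasure_map hH (g' := fun ω => ω.1.X s - ω.1.X t -
      ∫ r in t..s, b r ((pathLaw htT Zpre Z M hpre' hZ' hpre2 hZ2).marginal r) (ω.1.1 r))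
      (fun n => ?_) ?_ ?_ ?_
    · refine Finset.measurable_sum _ fun q hq => measurable_pi_lambda _ fun i => ?_
      simp only [Matrix.mulVec, dotProduct, hσ _ (grid_mem hs q hq)]
      refine Finset.measurable_sum _ fun j _ => ?_
      exact (((hf (some j) i).lipschitzWith _ _).continuous.measurable.comp (hev' _)).mul
        ((measurable_pi_apply j).comp ((hev _).sub (hev _)))
    · simp only [hdrift]
      exact ((measurable_fst.comp (hev' s)).sub (measurable_fst.comp (hev' t))).sub
        ((D0.measurable_integral hs hcont.continuousOn).comp measurable_fst)
    · have h1 : ∀ᵐ ω ∂P.map fun ω => (pathOf htT Zpre Z M ω, noisePath hN ω),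
          ∀ r ≥ t, ω.1.xi r = ω.1.xi t := by
        refine (ae_map_iff hH.aemeasurable (p := fun ω : D0 t T d l × CPath t T k =>
          ∀ r ≥ t, ω.1.xi r = ω.1.xi t)
          ((D0.measurableSet_xi_const t).preimage measurable_fst)).2 ?_
        refine Eventually.of_forall fun ω r hr => ?_
        simp only [D0.xi, pathOf_of_le hr, pathOf_of_le le_rfl]
      filter_upwards [h1] with ω h1
      funext i
      simp only [Pi.sub_apply, intAgainst_eq_zero hs.1 _ h1, sub_zero]
    · refine tendstoInMeasure_pi fun i => ?_
      refine TendstoInMeasure.congr (fun n => ?_) ?_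
        (h.tendstoInMeasure_riemann hN hZζ hZx hpre' hZ i ⟨s, hs⟩)
      · refine Eventually.of_forall fun ω => ?_
        simp only [Finset.sum_apply]
        refine Finset.sum_congr rfl fun q hq => ?_
        simp only [Matrix.mulVec, dotProduct, hσ _ (grid_mem hs q hq),
          hmarg _ (grid_mem hs q hq).1]
        rfl
      · filter_upwards [h.pathOf_start (Zpre := Zpre) (Z := Z), h.integral_time hζF
          (Y := fun s ω => (pathOf htT Zpre Z M ω).1 s)
          (fun s => (D0.measurable_eval s).comp hYm) (fun ω => continuousOn_pathOf ω)
          (fun s hs => h.pathOf_ae_eq hZζ hZx hs.1) i ⟨s, hs⟩] with ω e1 e2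
        have e3 : (∫ r in t..s, b r ((pathLaw htT Zpre Z M hpre' hZ' hpre2 hZ2).marginal r)
            ((pathOf htT Zpre Z M ω).1 r)) i = M none i ω ⟨s, hs⟩ := by
          rw [hdrift, e2]
          refine (ContinuousLinearMap.intervalIntegral_comp_comm
            (ContinuousLinearMap.proj (R := ℝ) (φ := fun _ : Fin d => ℝ) i) ?_).symm
          refine ContinuousOn.intervalIntegrable ?_
          rw [uIcc_of_le hs.1]
          exact hcont.comp_continuousOn (continuousOn_id.prodMk
            ((continuousOn_pathOf ω).mono (Icc_subset_Icc_right hs.2)))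
        simp only [Pi.sub_apply, D0.X, e1, e3]
        rw [pathOf_of_le hs.1, projIcc_of_mem htT hs]
        simp only [Fintype.sum_option]
        ring

end IsSolution

end Weak

/-! ## Reachable states -/

section Reachable

variable {d l k : ℕ} {T : ℝ} {b : ℝ → P2 (State d l) → State d l → Fin d → ℝ}
  {σ : ℝ → P2 (State d l) → State d l → Matrix (Fin d) (Fin k) ℝ}
  {γ : ℝ → Matrix (Fin d) (Fin l) ℝ} {c : ℝ → P2 (State d l) → State d l → Fin l → ℝ}

/-- The scalar coefficients of the equation, extended to all times by constants. -/
noncomputable def scalarCoef (hT : 0 ≤ T) (b : ℝ → P2 (State d l) → State d l → Fin d → ℝ)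
    (σ : ℝ → P2 (State d l) → State d l → Matrix (Fin d) (Fin k) ℝ) :
    Option (Fin k) → Fin d → ℝ → P2 (State d l) → State d l → ℝ
  | none, i, r, m, z => b (projIcc 0 T hT r) m z i
  | some j, i, r, m, z => σ (projIcc 0 T hT r) m z i j

theorem IsLipCoef.of_continuousOn {L : ℝ≥0} (hT : 0 ≤ T) {g : ℝ → P2 (State d l) → State d l → ℝ}
    (hlip : ∀ t ∈ Icc 0 T, ∀ m m' z z',
      edist (g t m z) (g t m' z') ≤ L * (P2.wass m m' + edist z z'))
    (hcont : ∀ m z, ContinuousOn (fun t => g t m z) (Icc 0 T)) :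
    IsLipCoef (fun r => g (projIcc 0 T hT r)) L where
  lip r := hlip _ (projIcc 0 T hT r).2
  cont m z := (hcont m z).comp_continuous (continuous_subtype_val.comp continuous_projIcc)
    fun r => (projIcc 0 T hT r).2
  bdd m := by
    obtain ⟨B, hB⟩ := isCompact_Icc.exists_bound_of_continuousOn (hcont m 0)
    exact ⟨B, fun r => hB _ (projIcc 0 T hT r).2⟩

theorem Coefficients.exists_isLipCoef (h : Coefficients T b σ γ c) (hT : 0 ≤ T) :
    ∃ L, ∀ j i, IsLipCoef (scalarCoef hT b σ j i) L := by
  obtain ⟨L₁, h₁⟩ := h.b_lip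
  obtain ⟨L₂, h₂⟩ := h.σ_lip
  refine ⟨max L₁ L₂, fun j i => ?_⟩
  rcases j with - | j
  · refine IsLipCoef.of_continuousOn (g := fun r m z => b r m z i) hT (fun t ht m m' z z' => ?_)
      fun m z => (continuous_apply i).comp_continuousOn (h.b_cont m z)
    refine (edist_le_pi_edist _ _ i).trans ((h₁ t ht m m' z z').trans ?_)
    gcongr
    exact le_max_left _ _
  · refine IsLipCoef.of_continuousOn (g := fun r m z => σ r m z i j) hT (fun t ht m m' z z' => ?_)
      fun m z => (continuous_id.matrix_elem i j).comp_continuousOn (h.σ_cont m z)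
    refine (h₂ t ht m m' z z' i j).trans ?_
    gcongr
    exact le_max_right _ _

theorem P2.memLp (m : P2 (State d l)) : MemLp id 2 m.meas :=
  ⟨aestronglyMeasurable_id, by
    have h : eLpNorm id 2 m.meas ^ 2 < ∞ := (eLpNorm_two_sq _ _).trans_lt m.2.2
    rwa [ENNReal.pow_lt_top_iff, or_iff_left two_ne_zero] at h⟩

/-- A state is reachable as soon as it is coupled with the initial state by a jump. -/
theorem reachable_of_coupling (hcoef : Coefficients T b σ γ c) {t : ℝ} (ht : t ∈ Icc 0 T)
    {m m' : P2 (State d l)} (π : Measure (State d l × State d l)) (h₁ : π.map Prod.fst = m.meas)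
    (h₂ : π.map Prod.snd = m'.meas)
    (hγ : ∀ᵐ p ∂π, p.2.1 = p.1.1 + (γ t).mulVec (p.2.2 - p.1.2))
    (hmono : ∀ᵐ p ∂π, p.1.2 ≤ p.2.2) : Reachable T b σ γ t m' m := by
  have hπ : IsProbabilityMeasure π := by
    have : IsProbabilityMeasure (π.map Prod.fst) := h₁ ▸ m.2.1
    exact Measure.isProbabilityMeasure_of_map Prod.fst
  have hT : 0 ≤ T := ht.1.trans ht.2
  obtain ⟨L, hf⟩ := hcoef.exists_isLipCoef hT
  -- The space is the product of a Brownian space with `(State d l × State d l, π)`: the states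
  -- before and after the jump are drawn from `π`, independently of the noise.
  obtain ⟨Ω, mΩ, P, hP, W, hW⟩ := exists_isBrownianOn k ht.2
  have hN : IsNoise (P.prod π) (noiseFiltration (State d l × State d l) hW.measurable) t T
    fun s ω => W s ω.1 := hW.isNoise
  set F := noiseFiltration (State d l × State d l) hW.measurable
  let Zpre : Ω × State d l × State d l → State d l := fun ω => ω.2.1
  let Z : Ω × State d l × State d l → State d l := fun ω => ω.2.2
  have hpreF : ∀ s, t ≤ s → Measurable[F s] Zpre := fun s _ =>
    measurable_fst.comp (measurable_noiseFiltration_snd hW.measurable s)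
  have hZF : ∀ s, t ≤ s → Measurable[F s] Z := fun s _ =>
    measurable_snd.comp (measurable_noiseFiltration_snd hW.measurable s)
  have hpre : Measurable Zpre := measurable_fst.comp measurable_snd
  have hZ : Measurable Z := measurable_snd.comp measurable_snd
  have hlaw : (P.prod π).map Prod.snd = π := by
    rw [Measure.map_snd_prod, measure_univ, one_smul]
  have hpre_law : (P.prod π).map Zpre = m.meas := by
    rw [← h₁, ← hlaw, Measure.map_map measurable_fst measurable_snd, hlaw]
    rfl
  have hZ_law : (P.prod π).map Z = m'.meas := by
    rw [← h₂, ← hlaw, Measure.map_map measurable_snd measurable_snd, hlaw]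
    rfl
  have hpre2 : MemLp Zpre 2 (P.prod π) :=
    (memLp_map_measure_iff aestronglyMeasurable_id hpre.aemeasurable).1 (hpre_law ▸ m.memLp)
  have hZ2 : MemLp Z 2 (P.prod π) :=
    (memLp_map_measure_iff aestronglyMeasurable_id hZ.aemeasurable).1 (hZ_law ▸ m'.memLp)
  have hZ2x : ∀ i, MemLp (fun ω => (Z ω).1 i) 2 (P.prod π) :=
    memLp_pi_iff.1 (memLp_prod_iff.1 hZ2).1
  have hζ2 : MemLp (fun ω => (Z ω).2) 2 (P.prod π) := (memLp_prod_iff.1 hZ2).2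
  have hζm : Measurable fun ω => (Z ω).2 := measurable_snd.comp hZ
  have hx₀ : ∀ i, AEStronglyMeasurable[F t] ((hZ2x i).toLp _) (P.prod π) := fun i => by
    have h0 : Measurable[F t] fun ω => (Z ω).1 i :=
      (measurable_pi_apply i).comp (measurable_fst.comp (hZF t le_rfl))
    exact ⟨_, h0.stronglyMeasurable, MemLp.coeFn_toLp _⟩
  obtain ⟨X, M, hS⟩ := hN.exists_isSolution ht.2 hf hζm hζ2
    (fun s hs => measurable_snd.comp (hZF s hs)) hx₀
  have hZx : ∀ i, (hZ2x i).toLp _ =ᵐ[P.prod π] fun ω => (Z ω).1 i := fun i => MemLp.coeFn_toLp _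
  have hsub : ∀ r ∈ Icc t T, r ∈ Icc 0 T := fun r hr => ⟨ht.1.trans hr.1, hr.2⟩
  have hweak := hS.isWeakSolution hN (fun _ => rfl) hZx hpreF hZF hpre hZ hpre2 hZ2
    (b := b) (σ := σ) (γ := γ)
    (fun r hr m z i => by simp only [scalarCoef, projIcc_of_mem hT (hsub r hr)])
    (fun r hr m z i j => by simp only [scalarCoef, projIcc_of_mem hT (hsub r hr)])
    (Measure.quasiMeasurePreserving_snd.ae hγ)
  refine ⟨pathLaw ht.2 Zpre Z M hpre hZ hpre2 hZ2, ⟨P2.ext ?_, ?_, _, hweak⟩, P2.ext ?_⟩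
  · refine (marginal_pathLaw hpre hZ hpre2 hZ2 (t - 1)).trans ?_
    simp only [pathOf_of_lt (sub_one_lt t)]
    exact hpre_law
  · refine (ae_map_iff (measurable_pathOf hpre hZ).aemeasurable
      D0.measurableSet_monotone_xi).2 ?_
    filter_upwards [Measure.quasiMeasurePreserving_snd.ae hmono] with ω hω r s hrs
    simp only [D0.xi]
    rcases lt_or_ge s t with hs | hs
    · rw [pathOf_of_lt hs, pathOf_of_lt (hrs.trans_lt hs)]
    · rw [pathOf_of_le hs]
      rcases lt_or_ge r t with hr | hr
      · rw [pathOf_of_lt hr]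
        exact hω
      · rw [pathOf_of_le hr]
  · exact (marginal_pathLaw hpre hZ hpre2 hZ2 t).trans
      ((Measure.map_congr hS.pathOf_start).trans hZ_law)

/-- The coupling shifts the atom along `dir γ t j` and leaves the rest in place. This is an
admissible jump because `h ≥ 0` and the direction is `(γ(t), 1) eⱼ`. -/
theorem reachable_mix_dirac (hcoef : Coefficients T b σ γ c) {t : ℝ} (ht : t ∈ Icc 0 T)
    (j : Fin l) (a : unitInterval) (m : P2 (State d l)) (z : State d l) {h : ℝ} (hh : 0 ≤ h) :
    Reachable T b σ γ t (P2.mix a m (P2.dirac (z + h • dir γ t j)))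
      (P2.mix a m (P2.dirac z)) := by
  refine reachable_of_coupling hcoef ht (ENNReal.ofReal a • Measure.dirac (z, z + h • dir γ t j) +
    ENNReal.ofReal (1 - a) • m.meas.map fun w => (w, w)) ?_ ?_ ?_ ?_
  · rw [Measure.map_add _ _ measurable_fst, Measure.map_smul, Measure.map_smul,
      Measure.map_dirac' measurable_fst, Measure.map_map measurable_fst (by fun_prop), P2.mix_meas]
    congr 2
    exact Measure.map_id
  · rw [Measure.map_add _ _ measurable_snd, Measure.map_smul, Measure.map_smul,
      Measure.map_dirac' measurable_snd, Measure.map_map measurable_snd (by fun_prop), P2.mix_meas]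
    congr 2
    exact Measure.map_id
  · rw [ae_add_measure_iff]
    refine ⟨Measure.ae_smul_measure ?_ _, Measure.ae_smul_measure ?_ _⟩
    · rw [ae_dirac_eq, eventually_pure]
      simp [dir, Matrix.mulVec_smul]
    · refine (ae_map_iff (by fun_prop) (measurableSet_eq_fun (by fun_prop) ?_)).2
        (Eventually.of_forall fun w => by simp)
      have : Continuous fun p : State d l × State d l => p.1.1 + (γ t).mulVec (p.2.2 - p.1.2) := by
        fun_prop
      exact this.measurable
  · rw [ae_add_measure_iff]
    refine ⟨Measure.ae_smul_measure ?_ _, Measure.ae_smul_measure ?_ _⟩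
    · rw [ae_dirac_eq, eventually_pure]
      refine le_add_of_nonneg_right fun i => ?_
      simp only [dir, Prod.smul_mk, Pi.smul_apply, smul_eq_mul, Pi.zero_apply]
      refine mul_nonneg hh ?_
      rw [Pi.single_apply]
      split_ifs <;> norm_num
    · exact (ae_map_iff (by fun_prop) (measurableSet_le (by fun_prop) (by fun_prop))).2
        (Eventually.of_forall fun w => le_rfl)

end Reachable

end SingularMFC

/-! ### The gradient inequality -/

theorem mainTheorem9 (d l k : ℕ) (T : ℝ) (hT : 0 < T)
    (b : ℝ → SingularMFC.P2 (SingularMFC.State d l) → SingularMFC.State d l → Fin d → ℝ)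
    (σ : ℝ → SingularMFC.P2 (SingularMFC.State d l) → SingularMFC.State d l →
      Matrix (Fin d) (Fin k) ℝ)
    (γ : ℝ → Matrix (Fin d) (Fin l) ℝ)
    (c : ℝ → SingularMFC.P2 (SingularMFC.State d l) → SingularMFC.State d l → Fin l → ℝ)
    (hcoef : SingularMFC.Coefficients T b σ γ c)
    (u : ℝ → SingularMFC.P2 (SingularMFC.State d l) → ℝ)
    (δu : ℝ → SingularMFC.P2 (SingularMFC.State d l) → SingularMFC.State d l → ℝ)
    (hu : SingularMFC.IsC122 T u δu)
    (t : ℝ) (ht : t ∈ Set.Icc 0 T)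
    (hopt : ∀ m m' : SingularMFC.P2 (SingularMFC.State d l),
      SingularMFC.Reachable T b σ γ t m' m →
        (u t m : EReal) + SingularMFC.Cm γ c t m m' ≥ (u t m' : EReal)) :
    ∀ (m : SingularMFC.P2 (SingularMFC.State d l)) (x : Fin d → ℝ) (ξ : Fin l → ℝ) (j : Fin l),
      fderiv ℝ (δu t m) (x, ξ) ((γ t).mulVec (Pi.single j 1), Pi.single j 1)
        ≤ c t m (x, ξ) j := by
  intro m x ξ j
  exact SingularMFC.fderiv_le_of_reachable hcoef hu ht hopt j
    (fun a m z h hh => SingularMFC.reachable_mix_dirac hcoef ht j a m z hh) m (x, ξ)
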